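/- Let $n\ge 2$ and let $Q,B$ be real $n\times n$ matrices in the canonical form $$Q=\begin{pmatrix}Q_0&0\\0&0\end{pmatrix},\qquad B=\begin{pmatrix}\star&\star&\cdots&\star&\star\\ B_1&\star&\cdots&\star&\star\\ 0&B_2&\cdots&\star&\star\\ \vdots&\vdots&\ddots&\vdots&\vdots\\ 0&0&\cdots&B_m&\star\end{pmatrix}$$ with respect to a decomposition $\mathbb R^n=\mathbb R^{p_0}\oplus\cdots\oplus\mathbb R^{p_m}$, where $p_0\ge p_1\ge\dots\ge p_m\ge1$, $p_0+\dots+p_m=n$, $Q_0$ is a symmetric strictly positive $p_0\times p_0$ matrix, each $B_j$ is a $p_j\times p_{j-1}$ matrix of rank $p_j$ ($1\le j\le m$), and the blocks $\star$ are arbitrary ($m=0$ is the case of invertible $Q$). Let $D=p_0+3p_1+\dots+(2m+1)p_m$, $Q(t)=\int_0^te^{sB}Qe^{sB^{T}}ds$ and $V(t)=\det Q(t)$. Assume that for some $\gamma>0$ $$V(t)\ge\gamma\,t^{D}e^{t\operatorname{tr}B}\qquad\text{for all }t>0.$$ Let $r>2$, with $r<\frac{2D}{D-2}$ if $D>2$,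 let $q>0$ satisfy $\frac2q=D\left(\frac12-\frac1r\right)$, and let $q',r'$ be the conjugate exponents. Let $J\subseteq\mathbb R$ be an interval containing $0$ (for instance $J=[0,\infty)$ or $J=\mathbb R$). There is a constant $C>0$, depending only on $n$, $r$ and $\gamma$, such that the following holds. Let $\varphi\in L^2(\mathbb R^n)$, let $F$ be a measurable function on $\mathbb R^n\times J$ with $\big\|e^{\frac{\operatorname{tr}B}{2}t}\|F(\cdot,t)\|_{L^{r'}_x}\big\|_{L^{q'}_t(J)}<\infty$, and let $u$ be a weak solution on $\mathbb R^n\times J$ of the Cauchy problem $$\partial_tu-i\operatorname{tr}(Q\nabla^2u)-\langle Bx,\nabla u\rangle=F,\qquad u(\cdot,0)=\varphi,$$ that is, $u$ is measurable, $u(\cdot,t)\in L^2(\mathbb R^n)$ for $t\in J$ with norm bounded on compact subsets of $J$, and for all $\psi\in C_c^\infty(\mathbb R^n)$ and $t\in J$ $$\int u(x,t)\psi\,dx=\int\varphi\psi\,dx+\int_0^t\!\!\int\Big(u(x,s)\big[i\operatorname{tr}(Q\nabla^2\psi)-\operatorname{div}(\psi\,Bx)\big]+F(x,s)\psi\Big)dx\,ds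 .$$ Then $$\Big(\int_Je^{\frac{q\operatorname{tr}B}{2}t}\Big(\int_{\mathbb R^n}|u|^r\,dx\Big)^{\frac qr}dt\Big)^{\frac1q}\le C\Big\{\|\varphi\|_{L^2(\mathbb R^n)}+\Big(\int_Je^{\frac{q'\operatorname{tr}B}{2}t}\Big(\int_{\mathbb R^n}|F|^{r'}dx\Big)^{\frac{q'}{r'}}dt\Big)^{\frac1{q'}}\Big\}.$$ In particular, if $\operatorname{tr}B=0$, there is a constant $C>0$, depending only on $n$ and $\gamma$, such that for every such $J$, every $\varphi\in L^2(\mathbb R^n)$, every $F\in L^{\frac{2(D+2)}{D+4}}(\mathbb R^n\times J)$ and every weak solution $u$ as above, $$\|u\|_{L^{\frac{2(D+2)}{D}}(\mathbb R^n\times J)}\le C\Big(\|\varphi\|_{L^2(\mathbb R^n)}+\|F\|_{L^{\frac{2(D+2)}{D+4}}(\mathbb R^n\times J)}\Big).$$ -/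

import Mathlib

open MeasureTheory
open scoped ENNReal NNReal ContDiff

namespace DriftSchrodinger

/-- The ambient space `ℝⁿ = ℝ^{p₀} ⊕ ℝ^{p₁} ⊕ ⋯ ⊕ ℝ^{pₘ}` has its coordinates indexed by the pairs
(block, position in the block). -/
abbrev Idx {m : ℕ} (p : Fin (m + 1) → ℕ) : Type := Σ j : Fin (m + 1), Fin (p j)

/-- The `(i, j)` block (a `pᵢ × pⱼ` matrix) of a matrix on `ℝ^{p₀} ⊕ ⋯ ⊕ ℝ^{pₘ}`. -/
def block {m : ℕ} {p : Fin (m + 1) → ℕ} (M : Matrix (Idx p) (Idx p) ℝ) (i j : Fin (m + 1)) :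
    Matrix (Fin (p i)) (Fin (p j)) ℝ :=
  Matrix.of fun a b => M ⟨i, a⟩ ⟨j, b⟩

/-- The pair `(Q, B)` is in canonical form with block sizes `p₀ ≥ p₁ ≥ ⋯ ≥ pₘ ≥ 1`,
`p₀ + ⋯ + pₘ = n`: the only nonzero block of `Q` is its top left block `Q₀`, which is symmetric and
strictly positive; `B` vanishes below its first block subdiagonal, whose blocks `B₁, …, Bₘ`
(`B_{j+1}` being of size `p_{j+1} × p_j`) have full rank `p_{j+1}`; the other blocks of `B` are
arbitrary. -/
structure IsCanonicalForm (n : ℕ) {m : ℕ} (p : Fin (m + 1) → ℕ)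
    (Q B : Matrix (Idx p) (Idx p) ℝ) : Prop where
  antitone : Antitone p
  one_le : ∀ j, 1 ≤ p j
  sum_eq : ∑ j, p j = n
  posDef : (block Q 0 0).PosDef
  Q_zero : ∀ i j : Fin (m + 1), (i ≠ 0 ∨ j ≠ 0) → block Q i j = 0
  B_rank : ∀ j : Fin m, (block B j.succ j.castSucc).rank = p j.succ
  B_zero : ∀ i j : Fin (m + 1), (j : ℕ) + 1 < (i : ℕ) → block B i j = 0

/-- The local homogeneous dimension `D = p₀ + 3 p₁ + ⋯ + (2m+1) pₘ`. -/
def homDim {m : ℕ} (p : Fin (m + 1) → ℕ) : ℕ :=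
  ∑ j : Fin (m + 1), (2 * (j : ℕ) + 1) * p j

section General

variable {ι : Type} [Fintype ι] [DecidableEq ι]

/-- The controllability Gramian `Q(t) = ∫₀ᵗ e^{sB} Q e^{sBᵀ} ds` (integrated entry by entry). -/
noncomputable def gramian (Q B : Matrix ι ι ℝ) (t : ℝ) : Matrix ι ι ℝ :=
  Matrix.of fun i j =>
    ∫ s in (0 : ℝ)..t, (NormedSpace.exp (s • B) * Q * NormedSpace.exp (s • B.transpose)) i j

/-- The volume function `V(t) = det Q(t)`. -/
noncomputable def volumeFn (Q B : Matrix ι ι ℝ) (t : ℝ) : ℝ :=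
  (gramian Q B t).det

/-- Hypothesis (A) with constant `γ` and dimension `D`:
`V(t) ≥ γ t^D e^{t tr B}` for every `t > 0`. -/
def HypothesisA (D : ℕ) (γ : ℝ) (Q B : Matrix ι ι ℝ) : Prop :=
  ∀ t : ℝ, 0 < t → γ * t ^ D * Real.exp (t * B.trace) ≤ volumeFn Q B t

/-- The partial derivative `∂ᵢ ψ`. -/
noncomputable def partialDeriv (i : ι) (ψ : EuclideanSpace ℝ ι → ℂ) (x : EuclideanSpace ℝ ι) : ℂ :=
  fderiv ℝ ψ x (EuclideanSpace.single i (1 : ℝ))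

/-- `tr(Q ∇²ψ)`. -/
noncomputable def trHess (Q : Matrix ι ι ℝ) (ψ : EuclideanSpace ℝ ι → ℂ)
    (x : EuclideanSpace ℝ ι) : ℂ :=
  ∑ i, ∑ j, (Q i j : ℂ) * partialDeriv j (partialDeriv i ψ) x

/-- `⟨Bx, ∇ψ⟩`. -/
noncomputable def driftTerm (B : Matrix ι ι ℝ) (ψ : EuclideanSpace ℝ ι → ℂ)
    (x : EuclideanSpace ℝ ι) : ℂ :=
  ∑ i, ((∑ j, B i j * x j : ℝ) : ℂ) * partialDeriv i ψ x

/-- The formal transpose (for the bilinear pairing `∫ u ψ dx`) of the spatial operator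
`i tr(Q∇²·) + ⟨Bx, ∇·⟩`, that is `ψ ↦ i tr(Q∇²ψ) - div(ψ Bx)`, where
`div(ψ Bx) = ⟨Bx, ∇ψ⟩ + (tr B) ψ`. -/
noncomputable def transposeOp (Q B : Matrix ι ι ℝ) (ψ : EuclideanSpace ℝ ι → ℂ)
    (x : EuclideanSpace ℝ ι) : ℂ :=
  Complex.I * trHess Q ψ x - (driftTerm B ψ x + (B.trace : ℂ) * ψ x)

/-- `u` is a weak solution, with values in `L²(ℝⁿ)`, on the time interval `J ∋ 0` of
`∂ₜu - i tr(Q∇²u) - ⟨Bx, ∇u⟩ = F`, `u(·, 0) = φ`: `u` is jointly measurable, `u(·, t) ∈ L²` with norm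
bounded for `t` in compact subsets of `J`, and for every test function `ψ ∈ C_c^∞(ℝⁿ)` and every
time `t ∈ J` the equation, tested against `ψ` and integrated in time from `0` to `t`, holds. -/
structure IsSolution (Q B : Matrix ι ι ℝ) (J : Set ℝ) (φ : EuclideanSpace ℝ ι → ℂ)
    (F u : ℝ → EuclideanSpace ℝ ι → ℂ) : Prop where
  measurable : AEStronglyMeasurable (Function.uncurry u) ((volume.restrict J).prod volume)
  memLp : ∀ t ∈ J, MemLp (u t) 2 volume
  locally_bounded : ∀ K : Set ℝ, K ⊆ J → IsCompact K →
    ∃ M : ℝ≥0, ∀ t ∈ K, eLpNorm (u t) 2 volume ≤ M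
  equation : ∀ ψ : EuclideanSpace ℝ ι → ℂ, ContDiff ℝ ∞ ψ → HasCompactSupport ψ → ∀ t ∈ J,
    ∫ x, u t x * ψ x =
      (∫ x, φ x * ψ x) +
        ∫ s in (0 : ℝ)..t, ((∫ x, u s x * transposeOp Q B ψ x) + ∫ x, F s x * ψ x)

/-- The weighted mixed norm
`(∫_J e^{q τ t} (∫ |u(x,t)|^r dx)^{q/r} dt)^{1/q} = ‖e^{τ t} u‖_{L^q_t(J; L^r_x)}`,
with values in `[0, ∞]`. -/
noncomputable def mixedNorm (J : Set ℝ) (τ q r : ℝ) (u : ℝ → EuclideanSpace ℝ ι → ℂ) : ℝ≥0∞ :=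
  (∫⁻ t in J, ENNReal.ofReal (Real.exp (q * τ * t)) * (∫⁻ x, ‖u t x‖ₑ ^ r) ^ (q / r)) ^ (1 / q)

end General

/-- The pair `(q, r)` of (finite) exponents is admissible in dimension `D`. -/
def Admissible (D : ℕ) (q r : ℝ) : Prop :=
  0 < q ∧ 2 ≤ r ∧ (2 < D → r ≤ 2 * (D : ℝ) / ((D : ℝ) - 2)) ∧
    2 / q = (D : ℝ) * (1 / 2 - 1 / r)

end DriftSchrodinger

/-! Duality moves the evolution from `u` onto test functions. On the Fourier side the formal
transpose of the spatial operator is transport along Bᵀ plus multiplication by a quadratic symbol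
(`transposeCLM_fourier`), so its group is explicit: `propagator` composes with e^{sBᵀ} and
multiplies by a unimodular exponential of the quadratic form of ∫₀ˢ e^{σB}Qe^{σBᵀ}dσ. For s > 0 this
is the form of the Gramian Q(s), whose determinant is V(s); negative s reduces to -s by a cocycle
identity.

Dispersion. A linear change of variables turns the form into ±|ξ|². Multiplying by this chirp on the
Fourier side amounts, up to unimodular factors and a reflection, to multiplying by a chirp in space
and then taking a Fourier transform, so Hausdorff-Young alone gives an L^{r'} to L^r bound
(`eLpNorm_fourier_quadratic_le`). The loss is V(s)^{-(1/2-1/r)} times the Jacobian factor e^{-s tr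
B/r}, and Hypothesis (A) turns it into |s|^{-D(1/2-1/r)} e^{-s tr B/2}
(`eLpNorm_fourier_propagator_le`). The weight e^{t tr B/2} cancels the exponential, makes the
adjoint evolution isometric on L², and admissibility leaves exactly |t-s|^{-2/q}.

Strichartz. Below the endpoint q > 2, so 2/q < 1 and the Hardy-Littlewood-Sobolev inequality holds
on the line. The TT* argument (`lintegral_iSup_inner_rpow_le`) bounds the contribution of φ. The
Duhamel term needs no further idea: its integrand is bounded by a positive kernel, so the integral
from 0 to t is dominated by the full fractional integral. L^r norms in space are recovered from a
countable norming family of Schwartz functions.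

Weak solutions. Neither uniqueness nor a representation formula for `u` is needed. The pairing of
`u` with a test function evolved backwards is estimated increment by increment on a fine partition
(`norm_pairing_sub_le`), which yields a Duhamel inequality for an arbitrary weak solution
(`IsSolution.enorm_pairing_le`). The resulting constant depends on D, r and γ only, and D takes
finitely many values once n is fixed. -/

namespace DriftSchrodinger

open FourierTransform LineDeriv

/-! ### Fractional integration on the line -/

/-- The kernel of the one dimensional fractional integral. -/
noncomputable def rieszKernel (α x : ℝ) : ℝ≥0∞ := ENNReal.ofReal (|x| ^ (-α))

lemma measurable_rieszKernel (α : ℝ) : Measurable (rieszKernel α) := by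
  unfold rieszKernel; fun_prop

lemma rieszKernel_neg (α x : ℝ) : rieszKernel α (-x) = rieszKernel α x := by
  simp [rieszKernel]

lemma lintegral_even_le {f : ℝ → ℝ≥0∞} (hf : ∀ x, f (-x) = f x) :
    ∫⁻ x, f x ≤ 2 * ∫⁻ x in Set.Ioi 0, f x := by
  have h1 : ∫⁻ x, f x = (∫⁻ x in Set.Ioi 0, f x) + ∫⁻ x in Set.Iic 0, f x := by
    rw [← lintegral_add_compl f (measurableSet_Ioi (a := (0 : ℝ))), Set.compl_Ioi]
  have h2 : ∫⁻ x in Set.Iic 0, f x = ∫⁻ x in Set.Ioi 0, f x := by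
    rw [setLIntegral_congr (Iio_ae_eq_Iic (a := (0 : ℝ))).symm,
      ← (Measure.measurePreserving_neg (volume : Measure ℝ)).setLIntegral_comp_preimage_emb
        (MeasurableEquiv.neg ℝ).measurableEmbedding f (Set.Iio 0)]
    simp [hf]
  rw [h1, h2, two_mul]

lemma lintegral_rieszKernel_near {α : ℝ} (hα : α < 1) {R : ℝ} (hR : 0 < R) :
    ∫⁻ x, {x : ℝ | |x| ≤ R}.indicator (rieszKernel α) x
      ≤ ENNReal.ofReal (2 / (1 - α)) * ENNReal.ofReal (R ^ (1 - α)) := by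
  refine (lintegral_even_le (fun x => ?_)).trans ?_
  · simp [Set.indicator, rieszKernel_neg]
  have h1 : ∫⁻ x in Set.Ioi 0, {x : ℝ | |x| ≤ R}.indicator (rieszKernel α) x
      = ∫⁻ x in Set.Ioc 0 R, ENNReal.ofReal (x ^ (-α)) := by
    rw [← lintegral_indicator measurableSet_Ioi, ← lintegral_indicator measurableSet_Ioc]
    congr 1
    ext x
    by_cases hx : 0 < x
    · simp [Set.indicator, hx, rieszKernel, abs_of_pos hx]
    · simp [Set.indicator, hx]
  have hi : IntegrableOn (fun x : ℝ => x ^ (-α)) (Set.Ioc 0 R) := by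
    have := intervalIntegral.intervalIntegrable_rpow' (a := 0) (b := R) (r := -α) (by linarith)
    rwa [intervalIntegrable_iff_integrableOn_Ioc_of_le hR.le] at this
  rw [h1, ← ofReal_integral_eq_lintegral_ofReal hi
    ((ae_restrict_iff' measurableSet_Ioc).2 (.of_forall fun x hx => Real.rpow_nonneg hx.1.le _)),
    ← intervalIntegral.integral_of_le hR.le, integral_rpow (Or.inl (by linarith)),
    Real.zero_rpow (by linarith), ← ENNReal.ofReal_mul (by apply div_nonneg <;> linarith)]
  rw [show (2 : ℝ≥0∞) = ENNReal.ofReal 2 by simp, ← ENNReal.ofReal_mul (by norm_num)]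
  apply ENNReal.ofReal_le_ofReal
  rw [show -α + 1 = 1 - α by ring]
  apply le_of_eq
  ring

lemma lintegral_rieszKernel_far {α q : ℝ} (hα : α * q = 2) (hq : 0 < q) {R : ℝ} (hR : 0 < R) :
    ∫⁻ x, ({x : ℝ | R < |x|}.indicator (rieszKernel α) x) ^ q ≤ ENNReal.ofReal (2 / R) := by
  refine (lintegral_even_le (fun x => ?_)).trans ?_
  · simp [Set.indicator, rieszKernel_neg]
  have h1 : ∫⁻ x in Set.Ioi 0, ({x : ℝ | R < |x|}.indicator (rieszKernel α) x) ^ q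
      = ∫⁻ x in Set.Ioi R, ENNReal.ofReal (x ^ (-2 : ℝ)) := by
    rw [← lintegral_indicator measurableSet_Ioi, ← lintegral_indicator measurableSet_Ioi]
    congr 1
    ext x
    by_cases hx : 0 < x
    · by_cases hxR : R < x
      · simp only [Set.indicator, Set.mem_Ioi, hx, if_true, Set.mem_ofPred_eq, abs_of_pos hx, hxR,
          rieszKernel]
        rw [ENNReal.ofReal_rpow_of_pos (by positivity), ← Real.rpow_mul hx.le]
        congr 2; linarith
      · simp [Set.indicator, hx, abs_of_pos hx, hxR, hq]
    · have : ¬ R < x := by linarith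
      simp [Set.indicator, hx, this]
  rw [h1, ← ofReal_integral_eq_lintegral_ofReal (integrableOn_Ioi_rpow_of_lt (by norm_num) hR)
    ((ae_restrict_iff' measurableSet_Ioi).2
      (.of_forall fun x hx => Real.rpow_nonneg (hR.trans hx).le _)),
    integral_Ioi_rpow_of_lt (by norm_num) hR,
    show (2 : ℝ≥0∞) = ENNReal.ofReal 2 by simp, ← ENNReal.ofReal_mul (by norm_num)]
  apply ENNReal.ofReal_le_ofReal
  norm_num
  rw [Real.rpow_neg_one, div_eq_mul_inv]

/-- The constant in the Hardy-Littlewood-Sobolev inequality. -/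
noncomputable def hlsConst (q : ℝ) : ℝ := 2 / (1 - 2 / q) + 2 ^ (1 / q)

/-- Cut the kernel at distance R. Near the origin, h ≤ M and the kernel is integrable because 2/q <
1; far away, Hölder applies because the q-th power of the kernel is |x|^{-2}, integrable at
infinity. Both contributions scale like M^{p-1} for the right R. -/
lemma lintegral_rieszKernel_mul_le {q p : ℝ} (hq : 2 < q) (hpq : p.HolderConjugate q)
    {h : ℝ → ℝ≥0∞} (hh : AEMeasurable h) (hn : ∫⁻ s, h s ^ p ≤ 1) (t : ℝ) {M : ℝ≥0∞}
    (hM : M ≠ ⊤) :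
    ∫⁻ s, {s | h s ≤ M}.indicator h s * rieszKernel (2 / q) (t - s)
      ≤ ENNReal.ofReal (hlsConst q) * M ^ (p - 1) := by
  have hp := hpq.pos
  have hq0 := hpq.symm.pos
  have hp1 := hpq.lt
  rcases eq_or_ne M 0 with rfl | hM0
  · rw [ENNReal.zero_rpow_of_pos (by linarith), mul_zero, nonpos_iff_eq_zero]
    rw [← lintegral_zero (μ := (volume : Measure ℝ))]
    congr 1
    ext s
    by_cases hs : h s = 0 <;> simp [Set.indicator, hs]
  set m : ℝ := M.toReal with hm
  have hmpos : 0 < m := ENNReal.toReal_pos hM0 hM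
  have hMm : M = ENNReal.ofReal m := (ENNReal.ofReal_toReal hM).symm
  -- This radius balances the two parts: m R^{1-2/q} and R^{-1/q} are both m^{p-1}, since p/q = p -
  -- 1.
  set R : ℝ := m ^ (-p) with hRdef
  have hR : 0 < R := by positivity
  have hα : 2 / q < 1 := by rw [div_lt_one hq0]; exact hq
  have hnear := lintegral_rieszKernel_near hα hR
  have hfar := lintegral_rieszKernel_far (α := 2 / q) (q := q) (by field_simp) hq0 hR
  have hkm := measurable_rieszKernel (2 / q)
  have hms1 : MeasurableSet {x : ℝ | |x| ≤ R} := measurableSet_le (by fun_prop) (by fun_prop)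
  have hms2 : MeasurableSet {x : ℝ | R < |x|} := measurableSet_lt (by fun_prop) (by fun_prop)
  have hm1 : Measurable ({x : ℝ | |x| ≤ R}.indicator (rieszKernel (2 / q))) := hkm.indicator hms1
  have hm2 : Measurable ({x : ℝ | R < |x|}.indicator (rieszKernel (2 / q))) := hkm.indicator hms2
  have hpt : ∀ s, {s | h s ≤ M}.indicator h s * rieszKernel (2 / q) (t - s)
      ≤ M * {x : ℝ | |x| ≤ R}.indicator (rieszKernel (2 / q)) (t - s)
        + h s * {x : ℝ | R < |x|}.indicator (rieszKernel (2 / q)) (t - s) := by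
    intro s
    by_cases hs : h s ≤ M
    · by_cases hx : |t - s| ≤ R
      · simp only [Set.indicator, Set.mem_ofPred_eq, hs, hx, if_true, not_lt.2 hx, if_false]
        refine le_add_right ?_
        gcongr
      · simp [Set.indicator, Set.mem_ofPred_eq, hs, hx, not_le.1 hx]
    · simp [Set.indicator, hs]
  have e1 : ∫⁻ s, {x : ℝ | |x| ≤ R}.indicator (rieszKernel (2 / q)) (t - s)
      = ∫⁻ s, {x : ℝ | |x| ≤ R}.indicator (rieszKernel (2 / q)) s :=
    lintegral_sub_left_eq_self _ t
  have e2 : ∫⁻ s, ({x : ℝ | R < |x|}.indicator (rieszKernel (2 / q)) (t - s)) ^ q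
      = ∫⁻ s, ({x : ℝ | R < |x|}.indicator (rieszKernel (2 / q)) s) ^ q :=
    lintegral_sub_left_eq_self (fun s => ({x : ℝ | R < |x|}.indicator (rieszKernel (2 / q)) s) ^ q) t
  have hinv : p⁻¹ + q⁻¹ = 1 := hpq.inv_add_inv_eq_one
  have hpq1 : p * q = p + q := hpq.mul_eq_add
  have b1 : m * R ^ (1 - 2 / q) = m ^ (p - 1) := by
    rw [hRdef, ← Real.rpow_mul hmpos.le]
    nth_rewrite 1 [← Real.rpow_one m]
    rw [← Real.rpow_add hmpos]
    congr 1
    field_simp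
    linarith
  have b2 : (2 / R) ^ (1 / q) = 2 ^ (1 / q) * m ^ (p - 1) := by
    rw [Real.div_rpow (by norm_num) hR.le, hRdef, ← Real.rpow_mul hmpos.le, div_eq_mul_inv,
      ← Real.rpow_neg hmpos.le]
    congr 2
    field_simp
    linarith
  calc _ ≤ ∫⁻ s, (M * {x : ℝ | |x| ≤ R}.indicator (rieszKernel (2 / q)) (t - s)
        + h s * {x : ℝ | R < |x|}.indicator (rieszKernel (2 / q)) (t - s)) := lintegral_mono hpt
    _ = M * (∫⁻ s, {x : ℝ | |x| ≤ R}.indicator (rieszKernel (2 / q)) (t - s))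
        + ∫⁻ s, h s * {x : ℝ | R < |x|}.indicator (rieszKernel (2 / q)) (t - s) := by
      rw [lintegral_add_left (by fun_prop), lintegral_const_mul _ (by fun_prop)]
    _ ≤ M * (ENNReal.ofReal (2 / (1 - 2 / q)) * ENNReal.ofReal (R ^ (1 - 2 / q)))
        + 1 * ENNReal.ofReal (2 / R) ^ (1 / q) := by
      gcongr
      · rw [e1]; exact hnear
      · refine (ENNReal.lintegral_mul_le_Lp_mul_Lq volume hpq hh
          (hm2.comp (measurable_const.sub measurable_id)).aemeasurable).trans ?_
        gcongr
        · exact ENNReal.rpow_le_one hn (by positivity)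
        · exact e2.le.trans hfar
    _ = ENNReal.ofReal (hlsConst q) * M ^ (p - 1) := by
      have h1 : 0 < 1 - 2 / q := by linarith
      rw [hMm, ENNReal.ofReal_rpow_of_pos (by positivity), ENNReal.ofReal_rpow_of_pos hmpos, one_mul,
        ← ENNReal.ofReal_mul (by positivity), ← ENNReal.ofReal_mul (by positivity),
        ← ENNReal.ofReal_mul (by unfold hlsConst; positivity),
        ← ENNReal.ofReal_add (by positivity) (by positivity), b2, hlsConst, add_mul, ← b1]
      congr 2
      ring

/-- Split the plane according to which of f(t), h(s) is larger. Where h(s) ≤ f(t), the truncated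
estimate with M = f(t) bounds the inner integral by f(t)^{p-1}, leaving the integral of f^p; the
other region is symmetric because the kernel is even. On the duality line this replaces maximal
functions and weak-type interpolation. -/
lemma lintegral_rieszKernel_bilinear_of_le_one {q p : ℝ} (hq : 2 < q) (hpq : p.HolderConjugate q)
    {f h : ℝ → ℝ≥0∞} (hf : AEMeasurable f) (hh : AEMeasurable h)
    (hfn : ∫⁻ s, f s ^ p ≤ 1) (hhn : ∫⁻ s, h s ^ p ≤ 1) :
    ∫⁻ t, ∫⁻ s, f t * h s * rieszKernel (2 / q) (t - s) ≤ ENNReal.ofReal (2 * hlsConst q) := by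
  wlog hfm : Measurable f generalizing f
  · have := this (f := hf.mk f) hf.measurable_mk.aemeasurable
      ((lintegral_congr_ae (hf.ae_eq_mk.fun_comp (· ^ p))).symm.le.trans hfn) hf.measurable_mk
    rwa [lintegral_congr_ae (g := fun t => ∫⁻ s, hf.mk f t * h s * rieszKernel (2 / q) (t - s))
      (by filter_upwards [hf.ae_eq_mk] with t ht; simp [ht])]
  wlog hhm : Measurable h generalizing h
  · have := this (h := hh.mk h) hh.measurable_mk.aemeasurable
      ((lintegral_congr_ae (hh.ae_eq_mk.fun_comp (· ^ p))).symm.le.trans hhn) hh.measurable_mk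
    rwa [lintegral_congr (g := fun t => ∫⁻ s, f t * hh.mk h s * rieszKernel (2 / q) (t - s))
      (fun t => lintegral_congr_ae (by filter_upwards [hh.ae_eq_mk] with s hs; simp [hs]))]
  have hkm := measurable_rieszKernel (2 / q)
  have hp := hpq.pos
  have hp1 := hpq.lt
  have hc : 0 ≤ hlsConst q := by
    have : 2 / q < 1 := by rw [div_lt_one (by linarith)]; exact hq
    have : 0 < 1 - 2 / q := by linarith
    unfold hlsConst; positivity
  have key : ∀ f h : ℝ → ℝ≥0∞, Measurable f → Measurable h → ∫⁻ s, f s ^ p ≤ 1 →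
      ∫⁻ s, h s ^ p ≤ 1 →
      ∫⁻ t, f t * ∫⁻ s, {s | h s ≤ f t}.indicator h s * rieszKernel (2 / q) (t - s)
        ≤ ENNReal.ofReal (hlsConst q) := by
    intro f h hf hh hfn hhn
    have hft : ∀ᵐ t, f t ≠ ⊤ := by
      have := ae_lt_top (hf.pow_const p) (hfn.trans_lt ENNReal.one_lt_top).ne
      filter_upwards [this] with t ht h'
      simp [h', ENNReal.top_rpow_of_pos hp] at ht
    calc _ ≤ ∫⁻ t, ENNReal.ofReal (hlsConst q) * f t ^ p := by
          refine lintegral_mono_ae ?_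
          filter_upwards [hft] with t ht
          refine (mul_le_mul_right (lintegral_rieszKernel_mul_le hq hpq hh.aemeasurable hhn t ht)
            (f t)).trans (le_of_eq ?_)
          rw [mul_left_comm]
          congr 1
          rcases eq_or_ne (f t) 0 with h0 | h0
          · simp [h0, hp]
          nth_rewrite 1 [← ENNReal.rpow_one (f t)]
          rw [← ENNReal.rpow_add _ _ h0 ht]
          congr 1; ring
      _ = ENNReal.ofReal (hlsConst q) * ∫⁻ t, f t ^ p := by
          rw [lintegral_const_mul _ (by fun_prop)]
      _ ≤ _ := by
          refine (mul_le_mul_right hfn _).trans ?_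
          simp
  have hind : Measurable fun z : ℝ × ℝ => ({z : ℝ × ℝ | h z.2 ≤ f z.1}.indicator
      (fun z => f z.1 * h z.2 * rieszKernel (2 / q) (z.1 - z.2)) z) := by
    apply Measurable.indicator (by fun_prop)
    exact measurableSet_le (by fun_prop) (by fun_prop)
  have hind2 : Measurable fun z : ℝ × ℝ => ({z : ℝ × ℝ | f z.1 ≤ h z.2}.indicator
      (fun z => f z.1 * h z.2 * rieszKernel (2 / q) (z.1 - z.2)) z) := by
    apply Measurable.indicator (by fun_prop)
    exact measurableSet_le (by fun_prop) (by fun_prop)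
  calc _ ≤ ∫⁻ t, ∫⁻ s, ({z : ℝ × ℝ | h z.2 ≤ f z.1}.indicator
          (fun z => f z.1 * h z.2 * rieszKernel (2 / q) (z.1 - z.2)) (t, s)
        + {z : ℝ × ℝ | f z.1 ≤ h z.2}.indicator
          (fun z => f z.1 * h z.2 * rieszKernel (2 / q) (z.1 - z.2)) (t, s)) := by
        refine lintegral_mono fun t => lintegral_mono fun s => ?_
        rcases le_total (h s) (f t) with h' | h'
        · refine le_add_right ?_; simp [Set.indicator, h']
        · refine le_add_left ?_; simp [Set.indicator, h']
    _ = (∫⁻ t, ∫⁻ s, {z : ℝ × ℝ | h z.2 ≤ f z.1}.indicator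
          (fun z => f z.1 * h z.2 * rieszKernel (2 / q) (z.1 - z.2)) (t, s))
        + ∫⁻ s, ∫⁻ t, {z : ℝ × ℝ | f z.1 ≤ h z.2}.indicator
          (fun z => f z.1 * h z.2 * rieszKernel (2 / q) (z.1 - z.2)) (t, s) := by
        rw [lintegral_lintegral_swap (f := fun s t => {z : ℝ × ℝ | f z.1 ≤ h z.2}.indicator
          (fun z => f z.1 * h z.2 * rieszKernel (2 / q) (z.1 - z.2)) (t, s))
          (hind2.comp measurable_swap).aemeasurable, ← lintegral_add_left hind.lintegral_prod_right']
        refine lintegral_congr fun t => ?_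
        exact lintegral_add_left (hind.comp measurable_prodMk_left) _
    _ ≤ ENNReal.ofReal (hlsConst q) + ENNReal.ofReal (hlsConst q) := by
        gcongr
        · refine le_trans (le_of_eq ?_) (key f h hfm hhm hfn hhn)
          refine lintegral_congr fun t => ?_
          refine Eq.trans ?_ (lintegral_const_mul _ (((hhm.indicator (measurableSet_le hhm measurable_const))).mul
            (hkm.comp (measurable_const.sub measurable_id))))
          refine lintegral_congr fun s => ?_
          by_cases h' : h s ≤ f t <;> simp [Set.indicator, h', mul_assoc]
        · refine le_trans (le_of_eq ?_) (key h f hhm hfm hhn hfn)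
          refine lintegral_congr fun t => ?_
          refine Eq.trans ?_ (lintegral_const_mul _ (((hfm.indicator (measurableSet_le hfm measurable_const))).mul
            (hkm.comp (measurable_const.sub measurable_id))))
          refine lintegral_congr fun s => ?_
          rw [← rieszKernel_neg _ (t - s), neg_sub]
          by_cases h' : f s ≤ h t <;> simp [Set.indicator, h']
          ring
    _ = _ := by rw [← ENNReal.ofReal_add hc hc, two_mul]

/-- The Hardy-Littlewood-Sobolev inequality on the line, in bilinear form, on the duality line. -/
theorem lintegral_rieszKernel_bilinear {q p : ℝ} (hq : 2 < q) (hpq : p.HolderConjugate q)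
    {f h : ℝ → ℝ≥0∞} (hf : AEMeasurable f) (hh : AEMeasurable h) :
    ∫⁻ t, ∫⁻ s, f t * h s * rieszKernel (2 / q) (t - s) ≤ ENNReal.ofReal (2 * hlsConst q) *
      ((∫⁻ t, f t ^ p) ^ (1 / p) * (∫⁻ t, h t ^ p) ^ (1 / p)) := by
  have hp := hpq.pos
  have hkm := measurable_rieszKernel (2 / q)
  have hc : 0 < 2 * hlsConst q := by
    have : 2 / q < 1 := by rw [div_lt_one (by linarith)]; exact hq
    have : 0 < 1 - 2 / q := by linarith
    unfold hlsConst; positivity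
  set X := (∫⁻ t, f t ^ p) ^ (1 / p) with hX
  set Y := (∫⁻ t, h t ^ p) ^ (1 / p) with hY
  have hXp : X ^ p = ∫⁻ t, f t ^ p := by
    rw [hX, ← ENNReal.rpow_mul, one_div_mul_cancel hp.ne', ENNReal.rpow_one]
  have hYp : Y ^ p = ∫⁻ t, h t ^ p := by
    rw [hY, ← ENNReal.rpow_mul, one_div_mul_cancel hp.ne', ENNReal.rpow_one]
  have hz : ∀ {g : ℝ → ℝ≥0∞}, AEMeasurable g → ∫⁻ t, g t ^ p = 0 → ∀ᵐ t, g t = 0 := by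
    intro g hg h0
    rw [lintegral_eq_zero_iff' (hg.pow_const p)] at h0
    filter_upwards [h0] with t ht
    simpa [ENNReal.rpow_eq_zero_iff, hp, hp.not_gt] using ht
  rcases eq_or_ne X 0 with hX0 | hX0
  · have := hz hf (by rw [← hXp, hX0, ENNReal.zero_rpow_of_pos hp])
    rw [lintegral_congr_ae (g := fun _ => 0)]
    · simp
    · filter_upwards [this] with t ht
      simp [ht]
  rcases eq_or_ne Y 0 with hY0 | hY0
  · have := hz hh (by rw [← hYp, hY0, ENNReal.zero_rpow_of_pos hp])
    rw [lintegral_congr (g := fun _ => 0)]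
    · simp
    · intro t
      rw [lintegral_congr_ae (g := fun _ => 0)]
      · simp
      · filter_upwards [this] with t ht
        simp [ht]
  have hcE : ENNReal.ofReal (2 * hlsConst q) ≠ 0 := by simpa using hc
  rcases eq_or_ne X ⊤ with hXt | hXt
  · rw [hXt, ENNReal.top_mul hY0, ENNReal.mul_top hcE]; exact le_top
  rcases eq_or_ne Y ⊤ with hYt | hYt
  · rw [hYt, ENNReal.mul_top hX0, ENNReal.mul_top hcE]; exact le_top
  have hnorm : ∀ {g : ℝ → ℝ≥0∞} {Z : ℝ≥0∞}, AEMeasurable g → Z ≠ 0 → Z ≠ ⊤ →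
      Z ^ p = ∫⁻ t, g t ^ p → ∫⁻ t, (Z⁻¹ * g t) ^ p ≤ 1 := by
    intro g Z hg h0 ht hZ
    simp_rw [ENNReal.mul_rpow_of_nonneg _ _ hp.le]
    rw [lintegral_const_mul'' _ (hg.pow_const p), ← hZ, ENNReal.inv_rpow,
      ENNReal.inv_mul_cancel (by simp [h0, hp, hp.le]) (by simp [ht, hp, h0])]
  have key := lintegral_rieszKernel_bilinear_of_le_one hq hpq (hf.const_mul X⁻¹) (hh.const_mul Y⁻¹)
    (hnorm hf hX0 hXt hXp) (hnorm hh hY0 hYt hYp)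
  have e : ∫⁻ t, ∫⁻ s, X⁻¹ * f t * (Y⁻¹ * h s) * rieszKernel (2 / q) (t - s)
      = X⁻¹ * Y⁻¹ * ∫⁻ t, ∫⁻ s, f t * h s * rieszKernel (2 / q) (t - s) := by
    rw [← lintegral_const_mul' _ _ (by simp [ENNReal.mul_eq_top, hX0, hY0])]
    refine lintegral_congr fun t => ?_
    rw [← lintegral_const_mul' _ _ (by simp [ENNReal.mul_eq_top, hX0, hY0])]
    refine lintegral_congr fun s => ?_
    ring
  rw [e] at key
  calc _ = X * Y * (X⁻¹ * Y⁻¹ * ∫⁻ t, ∫⁻ s, f t * h s * rieszKernel (2 / q) (t - s)) := by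
        rw [← mul_assoc, show X * Y * (X⁻¹ * Y⁻¹) = (X * X⁻¹) * (Y * Y⁻¹) by ring,
          ENNReal.mul_inv_cancel hX0 hXt, ENNReal.mul_inv_cancel hY0 hYt, one_mul, one_mul]
    _ ≤ X * Y * ENNReal.ofReal (2 * hlsConst q) := by gcongr
    _ = _ := by ring

/-- A truncation criterion for `‖G‖_{L^q} ≤ C`, obtained by testing against `m ^ (q - 1)` for bounded
`m ≤ G` with bounded support. -/
lemma lintegral_rpow_le_of_truncation {q p : ℝ} (hpq : p.HolderConjugate q)
    {G : ℝ → ℝ≥0∞} (hG : Measurable G) {C : ℝ≥0∞}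
    (h : ∀ (m : ℝ → ℝ≥0∞) (N : ℕ), Measurable m → (∀ t, m t ≤ G t) → (∀ t, m t ≤ N) →
      (∀ t, t ∉ Set.Icc (-N : ℝ) N → m t = 0) →
      ∫⁻ t, G t * m t ^ (q - 1) ≤ C * (∫⁻ t, m t ^ q) ^ (1 / p)) :
    (∫⁻ t, G t ^ q) ^ (1 / q) ≤ C := by
  have hp := hpq.pos
  have hq := hpq.symm.pos
  have hq1 := hpq.symm.lt
  let m : ℕ → ℝ → ℝ≥0∞ := fun N => (Set.Icc (-N : ℝ) N).indicator fun t => min (G t) N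
  have hm : ∀ N, Measurable (m N) := fun N =>
    (hG.min measurable_const).indicator measurableSet_Icc
  have hmN : ∀ N t, m N t ≤ N := fun N t => by
    by_cases ht : t ∈ Set.Icc (-N : ℝ) N <;> simp [m, ht]
  have hmG : ∀ N t, m N t ≤ G t := fun N t => by
    by_cases ht : t ∈ Set.Icc (-N : ℝ) N <;> simp [m, ht]
  have hm0 : ∀ (N : ℕ) t, t ∉ Set.Icc (-N : ℝ) N → m N t = 0 := fun N t ht => by simp [m, ht]
  have hmono : Monotone m := by
    intro N N' hN t
    have hN' : (N : ℝ) ≤ N' := by exact_mod_cast hN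
    by_cases ht : t ∈ Set.Icc (-N : ℝ) N
    · have ht' : t ∈ Set.Icc (-N' : ℝ) N' := ⟨by linarith [ht.1], by linarith [ht.2]⟩
      simp only [m, Set.indicator_of_mem ht, Set.indicator_of_mem ht']
      gcongr
    · simp [m, ht]
  have hsup : ∀ t, ⨆ N, m N t = G t := by
    intro t
    refine le_antisymm (iSup_le fun N => hmG N t) ?_
    refine le_of_forall_lt fun c hc => ?_
    obtain ⟨N, hN⟩ := ENNReal.exists_nat_gt hc.ne_top
    obtain ⟨N', hN'⟩ := exists_nat_ge |t|
    rw [lt_iSup_iff]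
    refine ⟨max N N', ?_⟩
    have ht : t ∈ Set.Icc (-(max N N' : ℕ) : ℝ) (max N N' : ℕ) := by
      rw [Set.mem_Icc, ← abs_le]
      refine hN'.trans ?_
      exact_mod_cast le_max_right _ _
    simp only [m, Set.indicator_of_mem ht]
    refine lt_min hc (hN.trans_le ?_)
    exact_mod_cast le_max_left _ _
  have hX : ∀ N, (∫⁻ t, m N t ^ q) ≤ C ^ q := by
    intro N
    have h1 := h (m N) N (hm N) (hmG N) (hmN N) (hm0 N)
    set X := ∫⁻ t, m N t ^ q with hXd
    -- Finiteness, available only for the truncated function, is what permits dividing by X^{1/p}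
    -- below.
    have hXt : X ≠ ⊤ := by
      have : X ≤ ∫⁻ t in Set.Icc (-N : ℝ) N, (N : ℝ≥0∞) ^ q := by
        rw [hXd, ← lintegral_indicator measurableSet_Icc]
        refine lintegral_mono fun t => ?_
        by_cases ht : t ∈ Set.Icc (-N : ℝ) N
        · rw [Set.indicator_of_mem ht]
          exact ENNReal.rpow_le_rpow (hmN N t) hq.le
        · simp [hm0 N t ht, hq]
      refine (this.trans_lt ?_).ne
      rw [setLIntegral_const]
      exact ENNReal.mul_lt_top (ENNReal.rpow_lt_top_of_nonneg hq.le (by simp)) (by simp)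
    have h2 : X ≤ C * X ^ (1 / p) := by
      refine le_trans (lintegral_mono fun t => ?_) h1
      calc m N t ^ q = m N t ^ (1 + (q - 1)) := by ring_nf
        _ = m N t ^ (1 : ℝ) * m N t ^ (q - 1) :=
          ENNReal.rpow_add_of_nonneg _ _ (by norm_num) (by linarith)
        _ ≤ G t * m N t ^ (q - 1) := by
          rw [ENNReal.rpow_one]
          gcongr
          exact hmG N t
    rcases eq_or_ne X 0 with h0 | h0
    · rw [h0]; exact zero_le
    have h3 : X = X ^ (1 / q) * X ^ (1 / p) := by
      rw [← ENNReal.rpow_add _ _ h0 hXt]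
      nth_rewrite 1 [← ENNReal.rpow_one X]
      congr 1
      rw [one_div, one_div, add_comm]
      exact hpq.inv_add_inv_eq_one.symm
    have h4 : X ^ (1 / q) ≤ C := by
      rw [h3] at h2
      nth_rewrite 2 [h3] at h2
      have hne0 : X ^ (1 / p) ≠ 0 := by simp [h0, hXt]
      have hnet : X ^ (1 / p) ≠ ⊤ := ENNReal.rpow_ne_top_of_nonneg (by positivity) hXt
      rw [← h3] at h2
      exact (ENNReal.mul_le_mul_iff_left hne0 hnet).1 h2
    calc X = (X ^ (1 / q)) ^ q := by
          rw [← ENNReal.rpow_mul, one_div_mul_cancel hq.ne', ENNReal.rpow_one]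
      _ ≤ C ^ q := by gcongr
  have hlim : ∫⁻ t, G t ^ q ≤ C ^ q := by
    have e : ∀ t, G t ^ q = ⨆ N, m N t ^ q := by
      intro t
      rw [← hsup t]
      exact (ENNReal.orderIsoRpow q hq).map_iSup _
    simp_rw [e]
    rw [lintegral_iSup (fun N => (hm N).pow_const q) (fun N N' hN t => by
      simp only; exact ENNReal.rpow_le_rpow (hmono hN t) hq.le)]
    exact iSup_le hX
  calc _ ≤ (C ^ q) ^ (1 / q) := by gcongr
    _ = C := by rw [← ENNReal.rpow_mul, mul_one_div_cancel hq.ne', ENNReal.rpow_one]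

lemma rpow_sub_one_rpow {q p : ℝ} (hpq : p.HolderConjugate q) (x : ℝ≥0∞) :
    (x ^ (q - 1)) ^ p = x ^ q := by
  rw [← ENNReal.rpow_mul]
  congr 1
  have := hpq.mul_eq_add
  linarith

/-- The Hardy-Littlewood-Sobolev inequality on the line. -/
theorem lintegral_rieszPotential_rpow_le {q p : ℝ} (hq : 2 < q) (hpq : p.HolderConjugate q)
    {f : ℝ → ℝ≥0∞} (hf : Measurable f) :
    (∫⁻ t, (∫⁻ s, f s * rieszKernel (2 / q) (t - s)) ^ q) ^ (1 / q)
      ≤ ENNReal.ofReal (2 * hlsConst q) * (∫⁻ t, f t ^ p) ^ (1 / p) := by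
  have hkm := measurable_rieszKernel (2 / q)
  have hm2 : Measurable fun z : ℝ × ℝ => f z.2 * rieszKernel (2 / q) (z.1 - z.2) := by fun_prop
  refine lintegral_rpow_le_of_truncation hpq hm2.lintegral_prod_right' ?_
  intro m N hm hmG hmN hm0
  have key := lintegral_rieszKernel_bilinear hq hpq (hm.pow_const (q - 1)).aemeasurable
    hf.aemeasurable
  simp_rw [rpow_sub_one_rpow hpq] at key
  calc _ = ∫⁻ t, ∫⁻ s, m t ^ (q - 1) * f s * rieszKernel (2 / q) (t - s) := by
        refine lintegral_congr fun t => ?_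
        rw [mul_comm, ← lintegral_const_mul _ (by fun_prop)]
        refine lintegral_congr fun s => ?_
        ring
    _ ≤ _ := key
    _ = _ := by ring

/-! ### The TT* argument -/

section Hilbert

variable {H : Type*} [NormedAddCommGroup H] [InnerProductSpace ℂ H]

/-- Selecting a maximising index at each time replaces a finite supremum by a single curve. Its
values stay in the family, so pairwise correlation bounds that are uniform in the indices pass to
it. -/
lemma exists_measurable_argmax {z : ℕ → ℝ → H} (hz : ∀ j, StronglyMeasurable (z j)) {M : ℕ → ℝ}
    (hM : ∀ j t, ‖z j t‖ ≤ M j) (v : H) (k : ℕ) :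
    ∃ w : ℝ → H, StronglyMeasurable w ∧ (∀ t, ∃ j, w t = z j t) ∧ (∃ M', ∀ t, ‖w t‖ ≤ M') ∧
      ∀ t, ∀ j ≤ k, ‖inner ℂ v (z j t)‖ₑ ≤ ‖inner ℂ v (w t)‖ₑ := by
  induction k with
  | zero => exact ⟨z 0, hz 0, fun t => ⟨0, rfl⟩, ⟨M 0, hM 0⟩, fun t j hj => by
      rw [Nat.le_zero.1 hj]⟩
  | succ k ih =>
    obtain ⟨w, hw, hwz, ⟨M', hM'⟩, hmax⟩ := ih
    have hi : ∀ {x : ℝ → H}, StronglyMeasurable x → Measurable fun t => ‖inner ℂ v (x t)‖ₑ :=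
      fun hx => ((continuous_const.inner continuous_id).comp_stronglyMeasurable hx).enorm
    classical
    refine ⟨fun t => if ‖inner ℂ v (z (k + 1) t)‖ₑ ≤ ‖inner ℂ v (w t)‖ₑ then w t else z (k + 1) t,
      StronglyMeasurable.ite (measurableSet_le (hi (hz _)) (hi hw)) hw (hz _), fun t => ?_,
      ⟨max M' (M (k + 1)), fun t => ?_⟩, fun t j hj => ?_⟩
    · dsimp only; split_ifs
      exacts [hwz t, ⟨k + 1, rfl⟩]
    · dsimp only; split_ifs
      exacts [(hM' t).trans (le_max_left _ _), (hM _ t).trans (le_max_right _ _)]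
    · dsimp only
      rcases Nat.le_succ_iff.1 hj with h | h
      · split_ifs with hc
        exacts [hmax t j h, (hmax t j h).trans (not_le.1 hc).le]
      · subst h
        split_ifs with hc
        exacts [hc, le_rfl]

/-- The `TT*` argument: a bounded family of curves `z_j` in a Hilbert space whose correlations decay
like `|t - s|^{-2/q}` satisfies a Strichartz type square function estimate. -/
theorem lintegral_iSup_inner_rpow_le [CompleteSpace H] {q p : ℝ} (hq : 2 < q) (hpq : p.HolderConjugate q)
    {z : ℕ → ℝ → H} (hz : ∀ j, StronglyMeasurable (z j)) {M : ℕ → ℝ}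
    (hM : ∀ j t, ‖z j t‖ ≤ M j) {K : ℝ≥0∞}
    (hK : ∀ j l t s, t ≠ s → ‖inner ℂ (z j t) (z l s)‖ₑ ≤ K * rieszKernel (2 / q) (t - s))
    (v : H) :
    (∫⁻ t, (⨆ j, ‖inner ℂ v (z j t)‖ₑ) ^ q) ^ (1 / q)
      ≤ ‖v‖ₑ * (K * ENNReal.ofReal (2 * hlsConst q)) ^ (1 / 2 : ℝ) := by
  have hp := hpq.pos
  have hq0 := hpq.symm.pos
  have hq1 := hpq.symm.lt
  have hkm := measurable_rieszKernel (2 / q)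
  have hi : ∀ {x : ℝ → H}, StronglyMeasurable x → Measurable fun t => ‖inner ℂ v (x t)‖ₑ :=
    fun hx => ((continuous_const.inner continuous_id).comp_stronglyMeasurable hx).enorm
  have hfin : ∀ k : ℕ, ∫⁻ t, (⨆ j : Fin (k + 1), ‖inner ℂ v (z j t)‖ₑ) ^ q
      ≤ (‖v‖ₑ * (K * ENNReal.ofReal (2 * hlsConst q)) ^ (1 / 2 : ℝ)) ^ q := by
    intro k
    obtain ⟨w, hw, hwz, ⟨M', hM'⟩, hmax⟩ := exists_measurable_argmax hz hM v k
    have hmono : ∫⁻ t, (⨆ j : Fin (k + 1), ‖inner ℂ v (z j t)‖ₑ) ^ q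
        ≤ ∫⁻ t, ‖inner ℂ v (w t)‖ₑ ^ q := by
      refine lintegral_mono fun t => ENNReal.rpow_le_rpow ?_ hq0.le
      exact iSup_le fun j => hmax t j (Nat.lt_succ_iff.1 j.2)
    refine hmono.trans ?_
    rw [← ENNReal.rpow_inv_le_iff hq0, ← one_div]
    refine lintegral_rpow_le_of_truncation hpq (hi hw) ?_
    intro m N hm hmG hmN hm0
    have hmt : ∀ t, m t ^ (q - 1) ≠ ⊤ := fun t =>
      ENNReal.rpow_ne_top_of_nonneg (by linarith) ((hmN t).trans_lt (by simp)).ne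
    let a : ℝ → ℝ := fun t => (m t ^ (q - 1)).toReal
    have ham : Measurable a := (hm.pow_const _).ennreal_toReal
    have hae : ∀ t, ENNReal.ofReal (a t) = m t ^ (q - 1) := fun t => ENNReal.ofReal_toReal (hmt t)
    have ha0 : ∀ t, 0 ≤ a t := fun t => ENNReal.toReal_nonneg
    -- The phase that makes ⟨v, w(t)⟩ nonnegative; where the inner product vanishes, division by
    -- zero gives 0, which is harmless.
    let c : ℝ → ℂ := fun t => (starRingEnd ℂ (inner ℂ v (w t))) / ‖inner ℂ v (w t)‖
    have hc1 : ∀ t, ‖c t‖ ≤ 1 := fun t => by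
      simp only [c, norm_div, RCLike.norm_conj, Complex.norm_real, norm_norm]
      exact div_self_le_one _
    have hci : ∀ t, c t * inner ℂ v (w t) = (‖inner ℂ v (w t)‖ : ℂ) := fun t => by
      simp only [c]
      rw [div_mul_eq_mul_div, mul_comm, Complex.mul_conj, Complex.normSq_eq_norm_sq]
      rcases eq_or_ne ‖inner ℂ v (w t)‖ 0 with h0 | h0
      · simp [h0]
      · have : ((‖inner ℂ v (w t)‖ : ℝ) : ℂ) ≠ 0 := by exact_mod_cast h0
        push_cast
        field_simp
    have hwi : StronglyMeasurable fun t => (inner ℂ v (w t) : ℂ) :=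
      (continuous_const.inner continuous_id).comp_stronglyMeasurable hw
    have hcm : Measurable c := by
      have := hwi.measurable
      simp only [c]
      fun_prop
    let h : ℝ → H := fun t => ((a t : ℂ) * c t) • w t
    have hhm : StronglyMeasurable h := by
      refine StronglyMeasurable.smul ?_ hw
      exact Measurable.stronglyMeasurable (by fun_prop)
    have hhint : Integrable h := by
      have hsupp : Integrable ((Set.Icc (-N : ℝ) N).indicator
          fun _ => ((N : ℝ≥0∞) ^ (q - 1)).toReal * M') := by
        rw [integrable_indicator_iff measurableSet_Icc]
        exact integrableOn_const (by simp)
      refine hsupp.mono' hhm.aestronglyMeasurable (.of_forall fun t => ?_)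
      by_cases ht : t ∈ Set.Icc (-N : ℝ) N
      · rw [Set.indicator_of_mem ht]
        simp only [h, norm_smul, norm_mul, Complex.norm_real, Real.norm_of_nonneg (ha0 t)]
        have h1 : a t ≤ ((N : ℝ≥0∞) ^ (q - 1)).toReal := by
          refine ENNReal.toReal_mono (ENNReal.rpow_ne_top_of_nonneg (by linarith) (by simp)) ?_
          exact ENNReal.rpow_le_rpow (hmN t) (by linarith)
        have h2 := hc1 t
        have h3 := hM' t
        have h4 := ha0 t
        calc a t * ‖c t‖ * ‖w t‖ ≤ a t * 1 * ‖w t‖ := by gcongr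
          _ = a t * ‖w t‖ := by ring
          _ ≤ _ := by gcongr
      · have : a t = 0 := by
          simp only [a, hm0 t ht, ENNReal.zero_rpow_of_pos (by linarith : 0 < q - 1),
            ENNReal.toReal_zero]
        simp [h, this, ht]
    set S : H := ∫ t, h t with hS
    have hinner : ∀ t, inner ℂ v (h t) = ((a t * ‖inner ℂ v (w t)‖ : ℝ) : ℂ) := fun t => by
      simp only [h, inner_smul_right]
      rw [mul_assoc, hci]
      push_cast; rfl
    have hvS : ∫⁻ t, ‖inner ℂ v (w t)‖ₑ * m t ^ (q - 1) = ‖inner ℂ v S‖ₑ := by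
      have hnn : ∀ t, 0 ≤ a t * ‖inner ℂ v (w t)‖ := fun t => mul_nonneg (ha0 t) (norm_nonneg _)
      have hint : Integrable fun t => a t * ‖inner ℂ v (w t)‖ := by
        have := (hhint.const_inner (𝕜 := ℂ) v).norm
        refine this.congr (.of_forall fun t => ?_)
        simp only
        rw [hinner, Complex.norm_real, Real.norm_of_nonneg (hnn t)]
      rw [hS, ← integral_inner hhint v, integral_congr_ae (.of_forall hinner), integral_complex_ofReal,
        ← ofReal_norm, Complex.norm_real, Real.norm_of_nonneg (integral_nonneg hnn),
        ofReal_integral_eq_lintegral_ofReal hint (.of_forall hnn)]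
      refine lintegral_congr fun t => ?_
      rw [ENNReal.ofReal_mul (ha0 t), hae, ofReal_norm, mul_comm]
    -- The TT* step: expand ‖S‖² as a double integral of correlations and apply the bilinear
    -- fractional integral inequality to the weight m^{q-1}, whose p-th power is m^q.
    have hSS : ‖S‖ₑ ^ 2 ≤ K * ENNReal.ofReal (2 * hlsConst q) *
        ((∫⁻ t, m t ^ q) ^ (1 / p) * (∫⁻ t, m t ^ q) ^ (1 / p)) := by
      have key := lintegral_rieszKernel_bilinear hq hpq (hm.pow_const (q - 1)).aemeasurable
        (hm.pow_const (q - 1)).aemeasurable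
      simp_rw [rpow_sub_one_rpow hpq] at key
      have e1 : ‖S‖ₑ ^ 2 = ‖(inner ℂ S S : ℂ)‖ₑ := by
        rw [inner_self_eq_norm_sq_to_K]
        simp only [enorm_pow]
        congr 1
        rw [← ofReal_norm, ← ofReal_norm]
        simp
      have hpt : ∀ t, ∀ᵐ s, ‖inner ℂ (h t) (h s)‖ₑ
          ≤ K * (m t ^ (q - 1) * m s ^ (q - 1) * rieszKernel (2 / q) (t - s)) := by
        intro t
        have : ∀ᵐ s : ℝ, s ≠ t := by simp [ae_iff, measure_singleton]
        filter_upwards [this] with s hs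
        obtain ⟨j, hj⟩ := hwz t
        obtain ⟨l, hl⟩ := hwz s
        have h1 : ∀ t, ‖(a t : ℂ) * c t‖ₑ ≤ m t ^ (q - 1) := fun t => by
          rw [← hae, ← ofReal_norm]
          apply ENNReal.ofReal_le_ofReal
          rw [norm_mul, Complex.norm_real, Real.norm_of_nonneg (ha0 t)]
          exact mul_le_of_le_one_right (ha0 t) (hc1 t)
        simp only [h, inner_smul_left, inner_smul_right, enorm_mul, RCLike.enorm_conj]
        rw [← enorm_mul (a s : ℂ), hj, hl]
        have := hK j l t s hs.symm
        calc _ ≤ m s ^ (q - 1) * (m t ^ (q - 1) * (K * rieszKernel (2 / q) (t - s))) := by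
              gcongr
              · exact h1 s
              · rw [← enorm_mul]; exact h1 t
          _ = _ := by ring
      calc ‖S‖ₑ ^ 2 = ‖∫ t, (inner ℂ S (h t) : ℂ)‖ₑ := by rw [e1, integral_inner hhint]
        _ ≤ ∫⁻ t, ‖(inner ℂ S (h t) : ℂ)‖ₑ := enorm_integral_le_lintegral_enorm _
        _ ≤ ∫⁻ t, ∫⁻ s, ‖(inner ℂ (h t) (h s) : ℂ)‖ₑ := by
          refine lintegral_mono fun t => ?_
          have : ‖(inner ℂ S (h t) : ℂ)‖ₑ = ‖(inner ℂ (h t) S : ℂ)‖ₑ := by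
            rw [← ofReal_norm, ← ofReal_norm, norm_inner_symm]
          rw [this, hS, ← integral_inner hhint]
          exact enorm_integral_le_lintegral_enorm _
        _ ≤ ∫⁻ t, ∫⁻ s, K * (m t ^ (q - 1) * m s ^ (q - 1) * rieszKernel (2 / q) (t - s)) :=
          lintegral_mono fun t => lintegral_mono_ae (hpt t)
        _ = K * ∫⁻ t, ∫⁻ s, m t ^ (q - 1) * m s ^ (q - 1) * rieszKernel (2 / q) (t - s) := by
          have hme : Measurable fun x : ℝ × ℝ =>
              m x.1 ^ (q - 1) * m x.2 ^ (q - 1) * rieszKernel (2 / q) (x.1 - x.2) := by fun_prop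
          rw [← lintegral_const_mul _ hme.lintegral_prod_right']
          refine lintegral_congr fun t => ?_
          rw [← lintegral_const_mul _ (by fun_prop)]
        _ ≤ _ := (mul_le_mul_right key K).trans (le_of_eq (mul_assoc _ _ _).symm)
    have hS1 : ‖S‖ₑ ≤ (K * ENNReal.ofReal (2 * hlsConst q)) ^ (1 / 2 : ℝ)
        * (∫⁻ t, m t ^ q) ^ (1 / p) := by
      set X := (∫⁻ t, m t ^ q) ^ (1 / p) with hXd
      have h2 : (0 : ℝ) < 1 / 2 := by norm_num
      calc ‖S‖ₑ = (‖S‖ₑ ^ 2) ^ (1 / 2 : ℝ) := by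
            rw [← ENNReal.rpow_natCast, ← ENNReal.rpow_mul]; norm_num
        _ ≤ (K * ENNReal.ofReal (2 * hlsConst q) * (X * X)) ^ (1 / 2 : ℝ) := by gcongr
        _ = _ := by
            rw [ENNReal.mul_rpow_of_nonneg _ _ h2.le, ← sq, ← ENNReal.rpow_natCast X,
              ← ENNReal.rpow_mul X]
            norm_num
    rw [hvS]
    calc ‖(inner ℂ v S : ℂ)‖ₑ ≤ ‖v‖ₑ * ‖S‖ₑ := by
          rw [← ofReal_norm, ← ofReal_norm, ← ofReal_norm, ← ENNReal.ofReal_mul (norm_nonneg _)]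
          exact ENNReal.ofReal_le_ofReal (norm_inner_le_norm _ _)
      _ ≤ _ := by rw [mul_assoc]; gcongr
  -- The bound for finite suprema is uniform in their number, so monotone convergence gives the full
  -- one.
  have e : ∀ t, (⨆ j, ‖inner ℂ v (z j t)‖ₑ) ^ q
      = ⨆ k : ℕ, (⨆ j : Fin (k + 1), ‖inner ℂ v (z j t)‖ₑ) ^ q := by
    intro t
    have : (⨆ j, ‖inner ℂ v (z j t)‖ₑ) = ⨆ k : ℕ, ⨆ j : Fin (k + 1), ‖inner ℂ v (z j t)‖ₑ := by
      refine le_antisymm (iSup_le fun j => ?_) (iSup_le fun k => iSup_le fun j => ?_)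
      · exact le_iSup_of_le j (le_iSup_of_le (Fin.last j) (by simp))
      · exact le_iSup (fun j => ‖inner ℂ v (z j t)‖ₑ) (j : ℕ)
    rw [this]
    exact (ENNReal.orderIsoRpow q hq0).map_iSup _
  have hall : ∫⁻ t, (⨆ j, ‖inner ℂ v (z j t)‖ₑ) ^ q
      ≤ (‖v‖ₑ * (K * ENNReal.ofReal (2 * hlsConst q)) ^ (1 / 2 : ℝ)) ^ q := by
    simp_rw [e]
    rw [lintegral_iSup (fun k => (Measurable.iSup fun j => hi (hz _)).pow_const q)]
    · exact iSup_le hfin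
    · intro k k' hk t
      refine ENNReal.rpow_le_rpow (iSup_le fun j => ?_) hq0.le
      exact le_iSup_of_le (⟨j, by omega⟩ : Fin (k' + 1)) le_rfl
  rwa [one_div, ENNReal.rpow_inv_le_iff hq0]

end Hilbert

/-! ### The Hausdorff-Young inequality -/

section Fourier

variable {V : Type*} [NormedAddCommGroup V] [InnerProductSpace ℝ V] [FiniteDimensional ℝ V]
  [MeasurableSpace V] [BorelSpace V]

/-- The `L²` Fourier transform of a function in `L¹ ∩ L²` is given by the Fourier integral. -/
lemma coeFn_fourier_toLp {f : V → ℂ} (hf : Integrable f) (hf2 : MemLp f 2) :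
    ((𝓕 (hf2.toLp f) : Lp ℂ 2 (volume : Measure V)) : V → ℂ) =ᵐ[volume] 𝓕 f := by
  have hcont : Continuous (𝓕 f) :=
    VectorFourier.fourierIntegral_continuous Real.continuous_fourierChar
      (by exact continuous_inner) hf
  refine ae_eq_of_integral_contDiff_smul_eq
    ((Lp.memLp _).locallyIntegrable (by norm_num)) hcont.locallyIntegrable ?_
  intro g hg hgc
  have hgc' : HasCompactSupport fun x => (g x : ℂ) := hgc.comp_left (g := Complex.ofReal) (by simp)
  have hgd : ContDiff ℝ ∞ fun x => (g x : ℂ) := Complex.ofRealCLM.contDiff.comp hg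
  let G : SchwartzMap V ℂ := hgc'.toSchwartzMap hgd
  have hG : ∀ x, G x = g x := fun x => rfl
  -- The L² transform agrees with the transform of tempered distributions, and the multiplication
  -- formula moves the latter onto `f` as a Fourier integral; equality against all test functions
  -- then suffices.
  have h1 := congrArg (fun T => T G) (Lp.fourier_toTemperedDistribution_eq (hf2.toLp f))
  simp only [TemperedDistribution.fourier_apply, Lp.toTemperedDistribution_apply] at h1
  have h2 : ∫ x, 𝓕 G x • f x = ∫ x, G x • 𝓕 f x :=
    VectorFourier.integral_fourierIntegral_smul_eq_flip (L := innerₗ V) (F := ℂ)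
      Real.continuous_fourierChar (by exact continuous_inner) G.integrable hf |>.trans (by
        refine integral_congr_ae (.of_forall fun x => ?_)
        simp only [flip_innerₗ]
        rfl)
  have h3 : ∫ x, 𝓕 G x • (hf2.toLp f : V → ℂ) x = ∫ x, 𝓕 G x • f x :=
    integral_congr_ae (by filter_upwards [hf2.coeFn_toLp] with x hx; rw [hx])
  rw [h3, h2] at h1
  simp only [hG] at h1
  simpa [Complex.real_smul] using h1.symm

lemma eLpNorm_fourier_two {f : V → ℂ} (hf : Integrable f) (hf2 : MemLp f 2) :
    eLpNorm (𝓕 f) 2 = eLpNorm f 2 := by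
  rw [← eLpNorm_congr_ae (coeFn_fourier_toLp hf hf2), ← eLpNorm_congr_ae hf2.coeFn_toLp,
    ← Lp.enorm_def, ← Lp.enorm_def, ← ofReal_norm, ← ofReal_norm, Lp.norm_fourier_eq]

lemma lintegral_fourier_sq {f : V → ℂ} (hf : Integrable f) (hf2 : MemLp f 2) :
    ∫⁻ x, ‖𝓕 f x‖ₑ ^ 2 = ∫⁻ x, ‖f x‖ₑ ^ 2 := by
  have h := eLpNorm_fourier_two hf hf2
  rw [eLpNorm_eq_lintegral_rpow_enorm_toReal (by norm_num) (by norm_num),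
    eLpNorm_eq_lintegral_rpow_enorm_toReal (by norm_num) (by norm_num)] at h
  have := ENNReal.rpow_left_injective (x := 1 / (2 : ℝ≥0∞).toReal) (by norm_num) h
  simpa using this

lemma norm_fourier_le (f : V → ℂ) (x : V) : ‖𝓕 f x‖ ≤ ∫ v, ‖f v‖ :=
  VectorFourier.norm_fourierIntegral_le_integral_norm _ _ _ _ _

/-- The constant in the Hausdorff-Young inequality (obtained by real interpolation). -/
noncomputable def hyConst (r : ℝ) : ℝ := 4 * r * 2 ^ (r - 2) / (r - 2)

lemma hyConst_pos {r : ℝ} (hr : 2 < r) : 0 < hyConst r := by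
  have : 0 < r - 2 := by linarith
  unfold hyConst; positivity

/-- Split g at the height h with h^{1-p} G = l/2. The part of g above h has L¹ norm at most h^{1-p}
G, so its transform never exceeds l/2; wherever the transform of g exceeds l, that of the lower part
is at least l/2. Chebyshev and Plancherel bound the measure of that set. -/
lemma volume_lt_norm_fourier_le {r p : ℝ} (hpr : p.HolderConjugate r)
    {g : V → ℂ} (hgm : StronglyMeasurable g) (hg : Integrable g) (hg2 : MemLp g 2) {G : ℝ}
    (hG : 0 < G) (hGe : ∫⁻ x, ‖g x‖ₑ ^ p = ENNReal.ofReal G) {l : ℝ} (hl : 0 < l) :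
    volume {x | l < ‖𝓕 g x‖} ≤ ENNReal.ofReal (4 / l ^ 2) *
      ∫⁻ x, {x | ‖g x‖ ≤ (l / (2 * G)) ^ (-(r - 1))}.indicator (fun x => ‖g x‖ₑ ^ 2) x := by
  have hp := hpr.pos
  have hp1 := hpr.lt
  have hpr1 : p * r = p + r := hpr.mul_eq_add
  set h : ℝ := (l / (2 * G)) ^ (-(r - 1)) with hh
  have hh0 : 0 < h := by positivity
  have hhp : h ^ (1 - p) = l / (2 * G) := by
    rw [hh, ← Real.rpow_mul (by positivity), show -(r - 1) * (1 - p) = 1 by linarith, Real.rpow_one]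
  have hs : MeasurableSet {x | ‖g x‖ ≤ h} := measurableSet_le hgm.norm.measurable measurable_const
  set g2 : V → ℂ := {x | ‖g x‖ ≤ h}.indicator g with hg2d
  set g1 : V → ℂ := {x | ‖g x‖ ≤ h}ᶜ.indicator g with hg1d
  have hg1i : Integrable g1 := hg.indicator hs.compl
  have hg2i : Integrable g2 := hg.indicator hs
  have hg22 : MemLp g2 2 := hg2.indicator hs
  have hsum : g = g1 + g2 := by
    rw [add_comm]; exact (Set.indicator_self_add_compl _ g).symm
  have h1 : ∀ x, ‖𝓕 g1 x‖ ≤ l / 2 := by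
    intro x
    refine (norm_fourier_le g1 x).trans ?_
    rw [integral_norm_eq_lintegral_enorm hg1i.1]
    refine ENNReal.toReal_le_of_le_ofReal (by positivity) ?_
    calc ∫⁻ x, ‖g1 x‖ₑ ≤ ∫⁻ x, ENNReal.ofReal (h ^ (1 - p)) * ‖g x‖ₑ ^ p := by
          refine lintegral_mono fun x => ?_
          by_cases hx : ‖g x‖ ≤ h
          · simp [hg1d, hx]
          · have hx' : h < ‖g x‖ := not_le.1 hx
            have hgx : 0 < ‖g x‖ := hh0.trans hx'
            rw [hg1d, Set.indicator_of_mem (by simpa using hx), ← ofReal_norm,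
              ENNReal.ofReal_rpow_of_pos hgx, ← ENNReal.ofReal_mul (by positivity)]
            apply ENNReal.ofReal_le_ofReal
            calc ‖g x‖ = ‖g x‖ ^ (1 - p) * ‖g x‖ ^ p := by
                  rw [← Real.rpow_add hgx]; simp
              _ ≤ _ := by
                  gcongr ?_ * _
                  exact Real.rpow_le_rpow_of_nonpos hh0 hx'.le (by linarith)
      _ = ENNReal.ofReal (l / 2) := by
          rw [lintegral_const_mul _ (hgm.enorm.pow_const p), hGe, hhp,
            ← ENNReal.ofReal_mul (by positivity)]
          congr 1; field_simp
  have hadd : ∀ x, 𝓕 g x = 𝓕 g1 x + 𝓕 g2 x := by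
    intro x
    have := VectorFourier.fourierIntegral_add (e := Real.fourierChar) (μ := (volume : Measure V))
      (L := innerₗ V) Real.continuous_fourierChar (by exact continuous_inner) hg1i hg2i
    have h' := congrFun this x
    rw [Pi.add_apply] at h'
    rw [hsum]
    exact h'
  have hcont : Continuous (𝓕 g2) :=
    VectorFourier.fourierIntegral_continuous Real.continuous_fourierChar
      (by exact continuous_inner) hg2i
  have hsub : {x | l < ‖𝓕 g x‖} ⊆ {x | ENNReal.ofReal (l ^ 2 / 4) ≤ ‖𝓕 g2 x‖ₑ ^ 2} := by
    intro x hx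
    simp only [Set.mem_ofPred_eq] at hx ⊢
    have h3 : l / 2 ≤ ‖𝓕 g2 x‖ := by
      have := norm_add_le (𝓕 g1 x) (𝓕 g2 x)
      rw [← hadd] at this
      linarith [h1 x]
    rw [← ofReal_norm, ← ENNReal.ofReal_pow (norm_nonneg _)]
    apply ENNReal.ofReal_le_ofReal
    nlinarith
  have hch := mul_meas_ge_le_lintegral (μ := (volume : Measure V))
    (f := fun x => ‖𝓕 g2 x‖ₑ ^ 2) (by fun_prop) (ENNReal.ofReal (l ^ 2 / 4))
  rw [lintegral_fourier_sq hg2i hg22] at hch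
  have e : ∫⁻ x, ‖g2 x‖ₑ ^ 2 = ∫⁻ x, {x | ‖g x‖ ≤ h}.indicator (fun x => ‖g x‖ₑ ^ 2) x := by
    refine lintegral_congr fun x => ?_
    by_cases hx : ‖g x‖ ≤ h <;> simp [hg2d, hx]
  rw [← e]
  calc volume {x | l < ‖𝓕 g x‖} ≤ volume {x | ENNReal.ofReal (l ^ 2 / 4) ≤ ‖𝓕 g2 x‖ₑ ^ 2} :=
        measure_mono hsub
    _ = ENNReal.ofReal (4 / l ^ 2) * (ENNReal.ofReal (l ^ 2 / 4) *
          volume {x | ENNReal.ofReal (l ^ 2 / 4) ≤ ‖𝓕 g2 x‖ₑ ^ 2}) := by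
        rw [← mul_assoc, ← ENNReal.ofReal_mul (by positivity),
          show 4 / l ^ 2 * (l ^ 2 / 4) = 1 by field_simp, ENNReal.ofReal_one, one_mul]
    _ ≤ _ := by gcongr

/-- The integral over levels for one value a of |g|. Since (r-1)(p-1) = 1, the constraint on l reads
l ≤ 2G a^{-(p-1)}, so l^{r-3} is integrated up to that point; this converges at 0 because r > 2. -/
lemma lintegral_rpow_indicator_le {r p : ℝ} (hr : 2 < r) (hpr : p.HolderConjugate r) {G : ℝ}
    (hG : 0 < G) {a : ℝ} (ha : 0 ≤ a) :
    ∫⁻ l in Set.Ioi 0, ENNReal.ofReal (l ^ (r - 3)) *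
      {l : ℝ | a ≤ (l / (2 * G)) ^ (-(r - 1))}.indicator (fun _ => ENNReal.ofReal a ^ 2) l
      ≤ ENNReal.ofReal ((2 * G) ^ (r - 2) / (r - 2)) * ENNReal.ofReal a ^ p := by
  have hp := hpr.pos
  have hp1 := hpr.lt
  have hpr1 : p * r = p + r := hpr.mul_eq_add
  rcases ha.eq_or_lt with rfl | ha
  · simp
  set Λ : ℝ := 2 * G * a ^ (-(p - 1)) with hΛ
  have hΛ0 : 0 < Λ := by positivity
  have hi : IntegrableOn (fun l : ℝ => l ^ (r - 3)) (Set.Ioc 0 Λ) := by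
    have := intervalIntegral.intervalIntegrable_rpow' (a := 0) (b := Λ) (r := r - 3) (by linarith)
    rwa [intervalIntegrable_iff_integrableOn_Ioc_of_le hΛ0.le] at this
  calc _ ≤ ∫⁻ l in Set.Ioc 0 Λ, ENNReal.ofReal (l ^ (r - 3)) * ENNReal.ofReal a ^ 2 := by
        rw [← lintegral_indicator measurableSet_Ioi, ← lintegral_indicator measurableSet_Ioc]
        refine lintegral_mono fun l => ?_
        by_cases hl : 0 < l
        · rw [Set.indicator_of_mem (by exact hl)]
          by_cases hc : a ≤ (l / (2 * G)) ^ (-(r - 1))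
          · have hlΛ : l ≤ Λ := by
              have h1 : l / (2 * G) ≤ a ^ (-(p - 1)) := by
                have h2 : ((l / (2 * G)) ^ (-(r - 1))) ^ (-(p - 1)) = l / (2 * G) := by
                  rw [← Real.rpow_mul (by positivity),
                    show -(r - 1) * -(p - 1) = 1 by linarith, Real.rpow_one]
                rw [← h2]
                exact Real.rpow_le_rpow_of_nonpos ha hc (by linarith)
              rw [div_le_iff₀ (by positivity)] at h1
              rw [hΛ]; linarith
            rw [Set.indicator_of_mem (show l ∈ Set.Ioc 0 Λ from ⟨hl, hlΛ⟩),
              Set.indicator_of_mem (by exact hc)]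
          · rw [Set.indicator_of_notMem (by exact hc)]; simp
        · rw [Set.indicator_of_notMem (by exact hl)]; exact zero_le
    _ = ENNReal.ofReal (Λ ^ (r - 2) / (r - 2)) * ENNReal.ofReal a ^ 2 := by
        rw [lintegral_mul_const _ (by fun_prop), ← ofReal_integral_eq_lintegral_ofReal hi
          ((ae_restrict_iff' measurableSet_Ioc).2 (.of_forall fun x hx => Real.rpow_nonneg hx.1.le _)),
          ← intervalIntegral.integral_of_le hΛ0.le, integral_rpow (Or.inl (by linarith)),
          Real.zero_rpow (by linarith)]
        rw [show r - 3 + 1 = r - 2 by ring, sub_zero]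
    _ = _ := by
        have h2 : 0 < r - 2 := by linarith
        rw [← ENNReal.ofReal_pow ha.le, ENNReal.ofReal_rpow_of_pos ha,
          ← ENNReal.ofReal_mul (by positivity), ← ENNReal.ofReal_mul (by positivity)]
        congr 1
        rw [hΛ, Real.mul_rpow (by positivity) (by positivity), ← Real.rpow_mul ha.le]
        have h3 : a ^ (-(p - 1) * (r - 2)) * a ^ 2 = a ^ p := by
          rw [← Real.rpow_natCast, ← Real.rpow_add ha]
          congr 1
          push_cast
          linarith
        rw [← h3]; ring

/-- Marcinkiewicz interpolation between L¹ and L², with a splitting height that depends on both the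
level and the size of g: layer-cake formula, the level-set bound, then Tonelli to integrate over
levels first. Letting G enter the splitting height makes the upper part vanish from the count, so no
weak-type bound at L¹ appears. -/
lemma lintegral_fourier_rpow_le {r p : ℝ} (hr : 2 < r) (hpr : p.HolderConjugate r)
    {g : V → ℂ} (hg : Integrable g) (hg2 : MemLp g 2) :
    ∫⁻ x, ‖𝓕 g x‖ₑ ^ r ≤ ENNReal.ofReal (hyConst r) * (∫⁻ x, ‖g x‖ₑ ^ p) ^ (r - 1) := by
  have hp := hpr.pos
  have hr0 : 0 < r := by linarith
  wlog hgm : StronglyMeasurable g generalizing g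
  · have := this ((integrable_congr hg.1.ae_eq_mk).1 hg) ((memLp_congr_ae hg.1.ae_eq_mk).1 hg2)
      hg.1.stronglyMeasurable_mk
    convert this using 2
    · exact funext fun x => by rw [Real.fourier_congr_ae hg.1.ae_eq_mk]
    · congr 1
      refine lintegral_congr_ae ?_
      filter_upwards [hg.1.ae_eq_mk] with x hx
      rw [← hx]
  rcases eq_or_ne (∫⁻ x, ‖g x‖ₑ ^ p) ⊤ with ht | ht
  · rw [ht, ENNReal.top_rpow_of_pos (by linarith), ENNReal.mul_top]
    · exact le_top
    · simpa using hyConst_pos hr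
  rcases eq_or_ne (∫⁻ x, ‖g x‖ₑ ^ p) 0 with h0 | h0
  · rw [lintegral_eq_zero_iff (hgm.enorm.pow_const p)] at h0
    have hg0 : g =ᵐ[volume] 0 := by
      filter_upwards [h0] with x hx
      simpa [ENNReal.rpow_eq_zero_iff, hp, hp.not_gt] using hx
    have : ∀ x, 𝓕 g x = 0 := fun x => by
      rw [Real.fourier_congr_ae hg0, Real.fourier_eq]
      simp
    simp [this, hr0]
  set G : ℝ := (∫⁻ x, ‖g x‖ₑ ^ p).toReal with hGd
  have hG : 0 < G := ENNReal.toReal_pos h0 ht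
  have hGe : ∫⁻ x, ‖g x‖ₑ ^ p = ENNReal.ofReal G := (ENNReal.ofReal_toReal ht).symm
  have hcont : Continuous (𝓕 g) :=
    VectorFourier.fourierIntegral_continuous Real.continuous_fourierChar
      (by exact continuous_inner) hg
  have hr3 : ∀ l : ℝ, 0 < l → 4 / l ^ 2 * l ^ (r - 1) = 4 * l ^ (r - 3) := fun l hl => by
    have : l ^ (r - 1) = l ^ (r - 3) * l ^ 2 := by
      rw [← Real.rpow_natCast, ← Real.rpow_add hl]; congr 1; push_cast; ring
    rw [this]; field_simp
  have hgn := hgm.norm.measurable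
  have hmi : Measurable ({z : ℝ × V | ‖g z.2‖ ≤ (z.1 / (2 * G)) ^ (-(r - 1))}.indicator
      (fun z => ENNReal.ofReal ‖g z.2‖ ^ 2)) := by
    refine Measurable.indicator (by fun_prop) ?_
    exact measurableSet_le (by fun_prop) (by fun_prop)
  have hmeas : Measurable fun z : ℝ × V => ENNReal.ofReal (z.1 ^ (r - 3)) *
      ({z : ℝ × V | ‖g z.2‖ ≤ (z.1 / (2 * G)) ^ (-(r - 1))}.indicator
        (fun z => ENNReal.ofReal ‖g z.2‖ ^ 2) z) := by fun_prop
  calc ∫⁻ x, ‖𝓕 g x‖ₑ ^ r = ∫⁻ x, ENNReal.ofReal (‖𝓕 g x‖ ^ r) := by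
        refine lintegral_congr fun x => ?_
        rw [← ofReal_norm, ENNReal.ofReal_rpow_of_nonneg (norm_nonneg _) hr0.le]
    _ = ENNReal.ofReal r * ∫⁻ l in Set.Ioi 0, volume {x | l < ‖𝓕 g x‖} *
          ENNReal.ofReal (l ^ (r - 1)) :=
        lintegral_rpow_eq_lintegral_meas_lt_mul _ (.of_forall fun x => norm_nonneg _)
          hcont.norm.aemeasurable hr0
    _ ≤ ENNReal.ofReal r * ∫⁻ l in Set.Ioi 0, 4 * ∫⁻ x, ENNReal.ofReal (l ^ (r - 3)) *
          {z : ℝ × V | ‖g z.2‖ ≤ (z.1 / (2 * G)) ^ (-(r - 1))}.indicator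
            (fun z => ENNReal.ofReal ‖g z.2‖ ^ 2) (l, x) := by
        refine mul_le_mul_right (setLIntegral_mono' measurableSet_Ioi fun l hl => ?_) _
        have hl : 0 < l := hl
        rw [lintegral_const_mul' _ _ ENNReal.ofReal_ne_top]
        refine (mul_le_mul_left (volume_lt_norm_fourier_le hpr hgm hg hg2 hG hGe hl) _).trans ?_
        rw [mul_right_comm, ← ENNReal.ofReal_mul (by positivity), hr3 l hl,
          ENNReal.ofReal_mul (by norm_num), mul_assoc]
        gcongr
        · simp
        · simp [Set.indicator]
    _ = ENNReal.ofReal r * (4 * ∫⁻ x, ∫⁻ l in Set.Ioi 0, ENNReal.ofReal (l ^ (r - 3)) *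
          {z : ℝ × V | ‖g z.2‖ ≤ (z.1 / (2 * G)) ^ (-(r - 1))}.indicator
            (fun z => ENNReal.ofReal ‖g z.2‖ ^ 2) (l, x)) := by
        rw [lintegral_const_mul _ hmeas.lintegral_prod_right', lintegral_lintegral_swap]
        exact hmeas.aemeasurable
    _ ≤ ENNReal.ofReal r * (4 * ∫⁻ x, ENNReal.ofReal ((2 * G) ^ (r - 2) / (r - 2))
          * ‖g x‖ₑ ^ p) := by
        gcongr with x
        refine le_trans (le_of_eq ?_)
          ((lintegral_rpow_indicator_le hr hpr hG (norm_nonneg (g x))).trans_eq ?_)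
        · simp [Set.indicator]
        · rw [ofReal_norm]
    _ = _ := by
        have h2 : 0 < r - 2 := by linarith
        rw [lintegral_const_mul _ (hgm.enorm.pow_const p), hGe, ENNReal.ofReal_rpow_of_pos hG,
          show (4 : ℝ≥0∞) = ENNReal.ofReal 4 by simp, ← ENNReal.ofReal_mul (by positivity),
          ← ENNReal.ofReal_mul (by positivity), ← ENNReal.ofReal_mul (by positivity),
          ← ENNReal.ofReal_mul (hyConst_pos hr).le]
        congr 1
        rw [hyConst, Real.mul_rpow (by norm_num) hG.le, show r - 1 = (r - 2) + 1 by ring,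
          Real.rpow_add hG, Real.rpow_one]
        ring

/-- The Hausdorff-Young inequality, with a non-sharp constant. -/
theorem eLpNorm_fourier_le {r p : ℝ} (hr : 2 < r) (hpr : p.HolderConjugate r)
    {g : V → ℂ} (hg : Integrable g) (hg2 : MemLp g 2) :
    eLpNorm (𝓕 g) (ENNReal.ofReal r) ≤
      ENNReal.ofReal (hyConst r) ^ (1 / r) * eLpNorm g (ENNReal.ofReal p) := by
  have hp := hpr.pos
  have hr0 : 0 < r := by linarith
  have hpr1 : p * r = p + r := hpr.mul_eq_add
  rw [eLpNorm_eq_lintegral_rpow_enorm_toReal (by simpa using hr0) (by simp),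
    eLpNorm_eq_lintegral_rpow_enorm_toReal (by simpa using hp) (by simp),
    ENNReal.toReal_ofReal hr0.le, ENNReal.toReal_ofReal hp.le]
  calc _ ≤ (ENNReal.ofReal (hyConst r) * (∫⁻ x, ‖g x‖ₑ ^ p) ^ (r - 1)) ^ (1 / r) := by
        gcongr
        exact lintegral_fourier_rpow_le hr hpr hg hg2
    _ = _ := by
        rw [ENNReal.mul_rpow_of_nonneg _ _ (by positivity), ← ENNReal.rpow_mul]
        congr 2
        field_simp
        linarith

end Fourier

/-! ### Dispersive estimates for quadratic symbols -/

lemma det_adjoint {V : Type*} [NormedAddCommGroup V] [InnerProductSpace ℝ V]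
    [FiniteDimensional ℝ V] (L : V →L[ℝ] V) :
    LinearMap.det (ContinuousLinearMap.adjoint L : V →ₗ[ℝ] V) = LinearMap.det (L : V →ₗ[ℝ] V) := by
  let v := stdOrthonormalBasis ℝ V
  have h : LinearMap.toMatrix v.toBasis v.toBasis (ContinuousLinearMap.adjoint L : V →ₗ[ℝ] V)
      = (LinearMap.toMatrix v.toBasis v.toBasis (L : V →ₗ[ℝ] V)).conjTranspose :=
    LinearMap.toMatrix_adjoint v v (L : V →ₗ[ℝ] V)
  rw [← LinearMap.det_toMatrix v.toBasis, h, Matrix.det_conjTranspose, LinearMap.det_toMatrix]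
  simp

section Dispersive

variable {V : Type*} [NormedAddCommGroup V] [InnerProductSpace ℝ V] [FiniteDimensional ℝ V]
  [MeasurableSpace V] [BorelSpace V]

/-- The multiplication formula transfers the transform to the Gaussian, where it is explicit. The
strictly positive real part of b regularises the Schrödinger kernel and makes every integral
absolutely convergent. -/
lemma fourier_gaussian_mul_schwartz {b : ℂ} (hb : 0 < b.re) (η : SchwartzMap V ℂ) (x : V) :
    𝓕 (fun ξ : V => Complex.exp (-b * ‖ξ‖ ^ 2) * η ξ) x =
      (Real.pi / b) ^ (Module.finrank ℝ V / 2 : ℂ) *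
        ∫ y, (𝓕⁻ η) y * Complex.exp (-Real.pi ^ 2 * ‖x + y‖ ^ 2 / b) := by
  set h : V → ℂ := fun ξ => Complex.exp (-b * ‖ξ‖ ^ 2
    + 2 * Real.pi * Complex.I * (inner ℝ (-x) ξ : ℝ)) with hh
  have hi : Integrable h :=
    GaussianFourier.integrable_cexp_neg_mul_sq_norm_add hb (2 * Real.pi * Complex.I) (-x)
  have h1 : 𝓕 (fun ξ : V => Complex.exp (-b * ‖ξ‖ ^ 2) * η ξ) x = ∫ ξ, h ξ * η ξ := by
    rw [Real.fourier_eq']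
    refine integral_congr_ae (.of_forall fun ξ => ?_)
    simp only [hh, smul_eq_mul, ← mul_assoc, ← Complex.exp_add, inner_neg_left, real_inner_comm x ξ]
    congr 2
    push_cast
    ring
  have h2 : ∫ y, 𝓕 h y * (𝓕⁻ η) y = ∫ ξ, h ξ * η ξ := by
    have := VectorFourier.integral_fourierIntegral_smul_eq_flip (L := innerₗ V) (F := ℂ)
      (μ := (volume : Measure V)) (ν := (volume : Measure V))
      Real.continuous_fourierChar (by exact continuous_inner) hi (𝓕⁻ η).integrable
    simp only [flip_innerₗ, smul_eq_mul] at this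
    refine this.trans (integral_congr_ae (.of_forall fun ξ => ?_))
    simp only
    congr 1
    have h3 : 𝓕 (𝓕⁻ η) = η := FourierTransform.fourier_fourierInv_eq η
    exact DFunLike.congr_fun h3 ξ
  rw [h1, ← h2, ← integral_const_mul]
  refine integral_congr_ae (.of_forall fun y => ?_)
  simp only [hh]
  rw [fourier_gaussian_innerProductSpace' hb (-x) y,
    show -x - y = -(x + y) by abel, norm_neg]
  ring

lemma integrable_exp_I_mul_schwartz (η : SchwartzMap V ℂ) {a : V → ℝ} (ha : Continuous a) :
    Integrable fun ξ => Complex.exp (a ξ * Complex.I) * η ξ := by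
  refine η.integrable.norm.mono' ?_ (.of_forall fun ξ => ?_)
  · exact (Continuous.mul (by fun_prop) η.continuous).aestronglyMeasurable
  · simp [Complex.norm_exp_ofReal_mul_I]

/-- Let δ decrease to 0 in the Gaussian formula with b = δ + iπs. Expanding |x+y|² = |x|² + 2⟨x,y⟩ +
|y|² in the limiting kernel gives a unimodular factor in x, a chirp in y and a Fourier character.
This factorisation reduces the dispersive estimate to Hausdorff-Young. -/
lemma fourier_chirp_mul_schwartz {s : ℝ} (hs : s ^ 2 = 1) (η : SchwartzMap V ℂ) (x : V) :
    ‖𝓕 (fun ξ : V => Complex.exp ((-(Real.pi * s * ‖ξ‖ ^ 2) : ℝ) * Complex.I) * η ξ) x‖ =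
      ‖𝓕 (fun y : V => Complex.exp ((Real.pi * s * ‖y‖ ^ 2 : ℝ) * Complex.I) * (𝓕⁻ η) y) (-s • x)‖ := by
  have hs0 : s ≠ 0 := by rintro rfl; simp at hs
  have hsC : (s : ℂ) ^ 2 = 1 := by exact_mod_cast hs
  have hsC0 : (s : ℂ) ≠ 0 := by exact_mod_cast hs0
  have hpi : (Real.pi : ℂ) ≠ 0 := by exact_mod_cast Real.pi_ne_zero
  set b : ℝ → ℂ := fun δ => δ + Real.pi * s * Complex.I with hb
  have hbre : ∀ δ, (b δ).re = δ := fun δ => by simp [hb]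
  have hb0 : b 0 ≠ 0 := by simp [hb, hpi, hsC0]
  have hbc : Continuous b := by fun_prop
  have hpb : (Real.pi : ℂ) / b 0 = -s * Complex.I := by
    rw [div_eq_iff hb0]
    simp only [hb, Complex.ofReal_zero, zero_add]
    linear_combination (-(Real.pi : ℂ)) * hsC + Real.pi * s ^ 2 * Complex.I_sq
  have hpos : ∀ᶠ δ : ℝ in nhdsWithin 0 (Set.Ioi 0), 0 < δ := self_mem_nhdsWithin
  have hbt : Filter.Tendsto b (nhdsWithin 0 (Set.Ioi 0)) (nhds (b 0)) :=
    (hbc.tendsto 0).mono_left nhdsWithin_le_nhds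
  have lim1 : Filter.Tendsto (fun δ => 𝓕 (fun ξ : V => Complex.exp (-b δ * ‖ξ‖ ^ 2) * η ξ) x)
      (nhdsWithin 0 (Set.Ioi 0)) (nhds (𝓕 (fun ξ : V => Complex.exp (-b 0 * ‖ξ‖ ^ 2) * η ξ) x)) := by
    simp_rw [Real.fourier_eq']
    refine tendsto_integral_filter_of_dominated_convergence (fun ξ => ‖η ξ‖) ?_ ?_
      η.integrable.norm ?_
    · refine .of_forall fun δ => Continuous.aestronglyMeasurable ?_
      have := η.continuous
      fun_prop
    · filter_upwards [hpos] with δ hδ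
      refine .of_forall fun ξ => ?_
      rw [norm_smul, norm_mul, Complex.norm_exp_ofReal_mul_I, one_mul, Complex.norm_exp]
      refine mul_le_of_le_one_left (norm_nonneg _) (Real.exp_le_one_iff.2 ?_)
      have : (-b δ * (‖ξ‖ : ℂ) ^ 2).re = -(δ * ‖ξ‖ ^ 2) := by
        rw [← Complex.ofReal_pow, Complex.re_mul_ofReal, Complex.neg_re, hbre]; ring
      rw [this]
      have := mul_nonneg hδ.le (sq_nonneg ‖ξ‖)
      linarith
    · refine .of_forall fun ξ => ?_
      refine Filter.Tendsto.smul tendsto_const_nhds (Filter.Tendsto.mul ?_ tendsto_const_nhds)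
      exact (Complex.continuous_exp.tendsto _).comp (hbt.neg.mul tendsto_const_nhds)
  have lim2 : Filter.Tendsto (fun δ => ((Real.pi : ℂ) / b δ) ^ (Module.finrank ℝ V / 2 : ℂ) *
        ∫ y, (𝓕⁻ η) y * Complex.exp (-Real.pi ^ 2 * ‖x + y‖ ^ 2 / b δ))
      (nhdsWithin 0 (Set.Ioi 0)) (nhds (((Real.pi : ℂ) / b 0) ^ (Module.finrank ℝ V / 2 : ℂ) *
        ∫ y, (𝓕⁻ η) y * Complex.exp (-Real.pi ^ 2 * ‖x + y‖ ^ 2 / b 0))) := by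
    refine Filter.Tendsto.mul ?_ ?_
    -- The complex power is continuous at π/b(0) = -is because this is purely imaginary and nonzero,
    -- hence off the branch cut.
    · refine (Filter.Tendsto.div tendsto_const_nhds hbt hb0).cpow tendsto_const_nhds ?_
      rw [hpb, Complex.mem_slitPlane_iff]
      right; simpa using hs0
    refine tendsto_integral_filter_of_dominated_convergence (fun ξ => ‖(𝓕⁻ η) ξ‖) ?_ ?_
      (𝓕⁻ η).integrable.norm ?_
    · refine .of_forall fun δ => Continuous.aestronglyMeasurable ?_
      have := (𝓕⁻ η).continuous
      fun_prop
    · filter_upwards [hpos] with δ hδ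
      refine .of_forall fun ξ => ?_
      rw [norm_mul, Complex.norm_exp]
      refine mul_le_of_le_one_right (norm_nonneg _) (Real.exp_le_one_iff.2 ?_)
      have : (-(Real.pi : ℂ) ^ 2 * (‖x + ξ‖ : ℂ) ^ 2 / b δ).re
          = -(Real.pi ^ 2 * ‖x + ξ‖ ^ 2) * (δ / Complex.normSq (b δ)) := by
        rw [div_eq_mul_inv, show -(Real.pi : ℂ) ^ 2 * (‖x + ξ‖ : ℂ) ^ 2
          = ((-(Real.pi ^ 2 * ‖x + ξ‖ ^ 2) : ℝ) : ℂ) by push_cast; ring, Complex.re_ofReal_mul,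
          Complex.inv_re, hbre]
      rw [this]
      have : 0 ≤ Real.pi ^ 2 * ‖x + ξ‖ ^ 2 * (δ / Complex.normSq (b δ)) := by
        have := Complex.normSq_nonneg (b δ)
        positivity
      linarith
    · refine .of_forall fun ξ => ?_
      refine Filter.Tendsto.mul tendsto_const_nhds ?_
      exact (Complex.continuous_exp.tendsto _).comp
        (Filter.Tendsto.div tendsto_const_nhds hbt hb0)
  have heq := tendsto_nhds_unique (lim1.congr' (by
    filter_upwards [hpos] with δ hδ
    exact fourier_gaussian_mul_schwartz (by rw [hbre]; exact hδ) η x)) lim2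
  have e1 : (fun ξ : V => Complex.exp ((-(Real.pi * s * ‖ξ‖ ^ 2) : ℝ) * Complex.I) * η ξ)
      = fun ξ : V => Complex.exp (-b 0 * ‖ξ‖ ^ 2) * η ξ := by
    ext ξ
    congr 2
    simp only [hb]; push_cast; ring
  rw [e1, heq, norm_mul]
  have e2 : ‖((Real.pi : ℂ) / b 0) ^ (Module.finrank ℝ V / 2 : ℂ)‖ = 1 := by
    have hn : ‖(-s * Complex.I : ℂ)‖ = 1 := by
      have : |s| = 1 := by
        rw [← sq_eq_sq₀ (abs_nonneg _) zero_le_one, sq_abs, hs]; norm_num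
      simp [this]
    have him : (Module.finrank ℝ V / 2 : ℂ).im = 0 := by
      rw [show (Module.finrank ℝ V / 2 : ℂ) = ((Module.finrank ℝ V / 2 : ℝ) : ℂ) by push_cast; rfl]
      exact Complex.ofReal_im _
    rw [hpb, Complex.norm_cpow_of_ne_zero (by simpa using hs0), hn, him]
    simp
  rw [e2, one_mul]
  have e3 : ∫ y, (𝓕⁻ η) y * Complex.exp (-Real.pi ^ 2 * ‖x + y‖ ^ 2 / b 0)
      = Complex.exp ((Real.pi * s * ‖x‖ ^ 2 : ℝ) * Complex.I) *
        𝓕 (fun y : V => Complex.exp ((Real.pi * s * ‖y‖ ^ 2 : ℝ) * Complex.I) * (𝓕⁻ η) y)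
          (-s • x) := by
    rw [Real.fourier_eq', ← integral_const_mul]
    refine integral_congr_ae (.of_forall fun y => ?_)
    simp only [smul_eq_mul]
    have e4 : -(Real.pi : ℂ) ^ 2 * (‖x + y‖ : ℂ) ^ 2 / b 0
        = (Real.pi * s * ‖x + y‖ ^ 2 : ℝ) * Complex.I := by
      calc _ = (-Real.pi * (‖x + y‖ : ℂ) ^ 2) * (Real.pi / b 0) := by ring
        _ = _ := by rw [hpb]; push_cast; ring
    have e5 : ‖x + y‖ ^ 2 = ‖x‖ ^ 2 + 2 * inner ℝ y x + ‖y‖ ^ 2 := by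
      rw [real_inner_comm]; exact norm_add_sq_real x y
    rw [e4, e5, inner_smul_right]
    have e6 : ∀ a b c d z : ℂ, d = a + b + c → z * Complex.exp d =
        Complex.exp a * (Complex.exp b * (Complex.exp c * z)) := by
      rintro a b c d z rfl
      rw [Complex.exp_add, Complex.exp_add]; ring
    apply e6
    push_cast; ring
  rw [e3, norm_mul, Complex.norm_exp_ofReal_mul_I, one_mul]

lemma eLpNorm_comp_neg {f : V → ℂ} (p : ℝ≥0∞) : eLpNorm (fun x => f (-x)) p = eLpNorm f p := by
  have h := (MeasurableEquiv.neg V).measurableEmbedding.eLpNorm_map_measure (g := f) (p := p)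
    (μ := (volume : Measure V))
  have h2 : Measure.map (MeasurableEquiv.neg V) (volume : Measure V) = volume :=
    Measure.map_neg_eq_self _
  rw [h2] at h
  exact h.symm

/-- The dispersive estimate for the free Schrödinger group at unit time. -/
theorem eLpNorm_fourier_chirp_le {r p : ℝ} (hr : 2 < r) (hpr : p.HolderConjugate r) {s : ℝ}
    (hs : s ^ 2 = 1) (η : SchwartzMap V ℂ) :
    eLpNorm (𝓕 fun ξ : V => Complex.exp ((-(Real.pi * s * ‖ξ‖ ^ 2) : ℝ) * Complex.I) * η ξ)
      (ENNReal.ofReal r) ≤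
      ENNReal.ofReal (hyConst r) ^ (1 / r) * eLpNorm (𝓕 η : SchwartzMap V ℂ) (ENNReal.ofReal p) := by
  set k : V → ℂ := fun y => Complex.exp ((Real.pi * s * ‖y‖ ^ 2 : ℝ) * Complex.I) * (𝓕⁻ η) y with hk
  have hkn : ∀ y, ‖k y‖ = ‖(𝓕⁻ η) y‖ := fun y => by
    simp only [hk, norm_mul, Complex.norm_exp_ofReal_mul_I, one_mul]
  have hki : Integrable k := integrable_exp_I_mul_schwartz _ (by fun_prop)
  have hk2 : MemLp k 2 := ((𝓕⁻ η).memLp 2).congr_norm hki.1 (.of_forall fun y => (hkn y).symm)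
  have h1 : eLpNorm (𝓕 fun ξ : V => Complex.exp ((-(Real.pi * s * ‖ξ‖ ^ 2) : ℝ) * Complex.I) * η ξ)
      (ENNReal.ofReal r) = eLpNorm (fun x => 𝓕 k (-s • x)) (ENNReal.ofReal r) :=
    eLpNorm_congr_norm_ae (.of_forall fun x => fourier_chirp_mul_schwartz hs η x)
  have h2 : eLpNorm (fun x => 𝓕 k (-s • x)) (ENNReal.ofReal r) = eLpNorm (𝓕 k) (ENNReal.ofReal r) := by
    rcases sq_eq_one_iff.1 hs with rfl | rfl
    · simpa using eLpNorm_comp_neg (f := 𝓕 k) _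
    · simp
  have h3 : eLpNorm k (ENNReal.ofReal p) = eLpNorm (𝓕 η : SchwartzMap V ℂ) (ENNReal.ofReal p) := by
    rw [eLpNorm_congr_norm_ae (.of_forall hkn), ← eLpNorm_comp_neg (f := (𝓕 η : SchwartzMap V ℂ))]
    rfl
  rw [h1, h2, ← h3]
  exact eLpNorm_fourier_le hr hpr hki hk2

lemma eLpNorm_comp_equiv (L : V ≃L[ℝ] V) (f : V → ℂ) {p : ℝ} (hp : 0 < p) :
    eLpNorm (fun x => f (L x)) (ENNReal.ofReal p) =
      ENNReal.ofReal (|LinearMap.det (L : V →ₗ[ℝ] V)| ^ (-(1 / p))) *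
        eLpNorm f (ENNReal.ofReal p) := by
  have hd : LinearMap.det (L : V →ₗ[ℝ] V) ≠ 0 := (LinearEquiv.isUnit_det' L.toLinearEquiv).ne_zero
  have h := L.toHomeomorph.measurableEmbedding.eLpNorm_map_measure (g := f)
    (p := ENNReal.ofReal p) (μ := (volume : Measure V))
  have h2 : Measure.map L.toHomeomorph (volume : Measure V)
      = ENNReal.ofReal |(LinearMap.det (L : V →ₗ[ℝ] V))⁻¹| • volume :=
    Measure.map_linearMap_addHaar_eq_smul_addHaar volume hd
  rw [h2, eLpNorm_smul_measure_of_ne_top (by simp)] at h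
  refine h.symm.trans ?_
  rw [smul_eq_mul, ENNReal.toReal_div, ENNReal.toReal_ofReal hp.le, ENNReal.toReal_one, ENNReal.ofReal_rpow_of_pos (by positivity), abs_inv,
    Real.inv_rpow (abs_nonneg _), Real.rpow_neg (abs_nonneg _)]

lemma fourier_comp_equiv (L : V ≃L[ℝ] V) (f : V → ℂ) (x : V) :
    𝓕 (fun ξ => f (L ξ)) x = ((|LinearMap.det (L : V →ₗ[ℝ] V)|⁻¹ : ℝ) : ℂ) *
      𝓕 f (ContinuousLinearMap.adjoint (L.symm : V →L[ℝ] V) x) := by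
  have hd : LinearMap.det (L : V →ₗ[ℝ] V) ≠ 0 := (LinearEquiv.isUnit_det' L.toLinearEquiv).ne_zero
  have h2 : Measure.map L.toHomeomorph (volume : Measure V)
      = ENNReal.ofReal |(LinearMap.det (L : V →ₗ[ℝ] V))⁻¹| • volume :=
    Measure.map_linearMap_addHaar_eq_smul_addHaar volume hd
  set G : V → ℂ := fun ζ =>
    Complex.exp (((-2 * Real.pi * inner ℝ (L.symm ζ) x : ℝ) : ℂ) * Complex.I) • f ζ with hG
  have h := L.toHomeomorph.measurableEmbedding.integral_map (μ := (volume : Measure V)) G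
  rw [h2, integral_smul_measure, ENNReal.toReal_ofReal (abs_nonneg _), abs_inv] at h
  rw [Real.fourier_eq', Real.fourier_eq']
  have e1 : ∀ ξ, G (L.toHomeomorph ξ)
      = Complex.exp (((-2 * Real.pi * inner ℝ ξ x : ℝ) : ℂ) * Complex.I) • f (L ξ) := by
    intro ξ
    simp [hG]
  simp_rw [e1] at h
  rw [← h, Complex.real_smul]
  congr 1
  refine integral_congr_ae (.of_forall fun ζ => ?_)
  simp only [hG]
  rw [ContinuousLinearMap.adjoint_inner_right]
  rfl

lemma eLpNorm_fourier_comp_equiv (L : V ≃L[ℝ] V) (f : V → ℂ) {p : ℝ} (hp : 0 < p) :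
    eLpNorm (𝓕 fun ξ => f (L ξ)) (ENNReal.ofReal p) =
      ENNReal.ofReal (|LinearMap.det (L : V →ₗ[ℝ] V)| ^ (1 / p - 1)) *
        eLpNorm (𝓕 f) (ENNReal.ofReal p) := by
  have hd : LinearMap.det (L : V →ₗ[ℝ] V) ≠ 0 := (LinearEquiv.isUnit_det' L.toLinearEquiv).ne_zero
  have hds : LinearMap.det ((L.symm : V →L[ℝ] V) : V →ₗ[ℝ] V)
      = (LinearMap.det (L : V →ₗ[ℝ] V))⁻¹ := LinearEquiv.det_coe_symm L.toLinearEquiv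
  set A : V →L[ℝ] V := ContinuousLinearMap.adjoint (L.symm : V →L[ℝ] V) with hA
  have hdA : LinearMap.det (A : V →ₗ[ℝ] V) = (LinearMap.det (L : V →ₗ[ℝ] V))⁻¹ := by
    rw [hA, det_adjoint, hds]
  let A' : V ≃L[ℝ] V := (LinearEquiv.ofIsUnitDet (f := (A : V →ₗ[ℝ] V))
    (v := Module.finBasis ℝ V) (v' := Module.finBasis ℝ V) (by
      rw [LinearMap.det_toMatrix, hdA]
      exact (inv_ne_zero hd).isUnit)).toContinuousLinearEquiv
  have hA' : ∀ x, A' x = A x := fun x => rfl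
  have hdA' : LinearMap.det (A' : V →ₗ[ℝ] V) = (LinearMap.det (L : V →ₗ[ℝ] V))⁻¹ := by
    rw [← hdA]; rfl
  have h1 : (𝓕 fun ξ => f (L ξ)) = (((|LinearMap.det (L : V →ₗ[ℝ] V)|⁻¹ : ℝ) : ℂ)) •
      fun x => 𝓕 f (A' x) := by
    ext x
    rw [fourier_comp_equiv]
    rfl
  rw [h1, eLpNorm_const_smul, eLpNorm_comp_equiv A' _ hp, hdA', ← mul_assoc]
  congr 1
  have habs : 0 < |LinearMap.det (L : V →ₗ[ℝ] V)| := abs_pos.2 hd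
  rw [← ofReal_norm, Complex.norm_real, Real.norm_of_nonneg (by positivity),
    ← ENNReal.ofReal_mul (by positivity), abs_inv, Real.inv_rpow habs.le, ← Real.rpow_neg habs.le,
    neg_neg, Real.rpow_sub habs, Real.rpow_one]
  congr 1
  ring

/-- The dispersive estimate for a Schrödinger propagator with a nondegenerate quadratic symbol,
followed by a linear change of variables. -/
theorem eLpNorm_fourier_quadratic_le {r p : ℝ} (hr : 2 < r) (hpr : p.HolderConjugate r) {s : ℝ}
    (hs : s ^ 2 = 1) (R E : V ≃L[ℝ] V) (η : SchwartzMap V ℂ) :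
    eLpNorm (𝓕 fun ξ : V => Complex.exp ((-(Real.pi * s * ‖R ξ‖ ^ 2) : ℝ) * Complex.I) * η (E ξ))
      (ENNReal.ofReal r) ≤
      ENNReal.ofReal (hyConst r) ^ (1 / r) *
        ENNReal.ofReal (|LinearMap.det (R : V →ₗ[ℝ] V)| ^ (-(1 - 2 / r)) *
          |LinearMap.det (E : V →ₗ[ℝ] V)| ^ (-(1 / r))) *
        eLpNorm (𝓕 η : SchwartzMap V ℂ) (ENNReal.ofReal p) := by
  have hp := hpr.pos
  have hr0 : 0 < r := by linarith
  have hinv : p⁻¹ + r⁻¹ = 1 := hpr.inv_add_inv_eq_one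
  have hdR : 0 < |LinearMap.det (R : V →ₗ[ℝ] V)| :=
    abs_pos.2 (LinearEquiv.isUnit_det' R.toLinearEquiv).ne_zero
  have hdE : 0 < |LinearMap.det (E : V →ₗ[ℝ] V)| :=
    abs_pos.2 (LinearEquiv.isUnit_det' E.toLinearEquiv).ne_zero
  -- Substituting ζ = Rξ turns the symbol into the standard chirp and the profile into η∘E∘R⁻¹. The
  -- Jacobian powers 1/r - 1 of R and -1/r of L then combine into the stated powers of the two
  -- determinants.
  set L : V ≃L[ℝ] V := R.symm.trans E with hL
  have hdL : LinearMap.det (L : V →ₗ[ℝ] V)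
      = LinearMap.det (E : V →ₗ[ℝ] V) * (LinearMap.det (R : V →ₗ[ℝ] V))⁻¹ := by
    have : (L : V →ₗ[ℝ] V) = (E : V →ₗ[ℝ] V) ∘ₗ (R.symm : V →ₗ[ℝ] V) := rfl
    rw [this, LinearMap.det_comp]
    congr 1
    exact LinearEquiv.det_coe_symm R.toLinearEquiv
  let η' : SchwartzMap V ℂ := SchwartzMap.compCLMOfContinuousLinearEquiv ℂ L η
  have hη' : ∀ ζ, η' ζ = η (L ζ) := fun ζ => rfl
  have e1 : (fun ξ : V => Complex.exp ((-(Real.pi * s * ‖R ξ‖ ^ 2) : ℝ) * Complex.I) * η (E ξ))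
      = fun ξ : V => (fun ζ => Complex.exp ((-(Real.pi * s * ‖ζ‖ ^ 2) : ℝ) * Complex.I) * η' ζ)
          (R ξ) := by
    ext ξ
    simp only [hη', hL, ContinuousLinearEquiv.trans_apply, ContinuousLinearEquiv.symm_apply_apply]
  have e2 : eLpNorm (𝓕 η' : SchwartzMap V ℂ) (ENNReal.ofReal p)
      = ENNReal.ofReal (|LinearMap.det (L : V →ₗ[ℝ] V)| ^ (1 / p - 1)) *
        eLpNorm (𝓕 η : SchwartzMap V ℂ) (ENNReal.ofReal p) := eLpNorm_fourier_comp_equiv L η hp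
  rw [e1, eLpNorm_fourier_comp_equiv R
    (fun ζ => Complex.exp ((-(Real.pi * s * ‖ζ‖ ^ 2) : ℝ) * Complex.I) * η' ζ) hr0]
  refine (mul_le_mul_right (eLpNorm_fourier_chirp_le hr hpr hs η') _).trans (le_of_eq ?_)
  rw [e2, ← mul_assoc, ← mul_assoc]
  congr 1
  rw [mul_comm (ENNReal.ofReal _) (ENNReal.ofReal (hyConst r) ^ (1 / r)), mul_assoc,
    ← ENNReal.ofReal_mul (by positivity)]
  congr 2
  have e3 : 1 / p - 1 = -(1 / r) := by rw [one_div, one_div]; linarith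
  rw [hdL, abs_mul, abs_inv, e3, Real.mul_rpow hdE.le (by positivity), Real.inv_rpow hdR.le,
    Real.rpow_neg hdR.le (1 / r), inv_inv, mul_left_comm, mul_comm, ← Real.rpow_add hdR]
  congr 2
  ring

end Dispersive

/-! ### Duality and countable norming families -/

lemma enorm_integral_mul_le {α : Type*} [MeasurableSpace α] {μ : Measure α} {p q : ℝ}
    (hpq : p.HolderConjugate q) {f g : α → ℂ} (hf : AEStronglyMeasurable f μ)
    (hg : AEStronglyMeasurable g μ) :
    ‖∫ x, f x * g x ∂μ‖ₑ ≤ eLpNorm f (ENNReal.ofReal p) μ * eLpNorm g (ENNReal.ofReal q) μ := by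
  have hp := hpq.pos
  have hq := hpq.symm.pos
  rw [eLpNorm_eq_lintegral_rpow_enorm_toReal (by simpa using hp) (by simp),
    eLpNorm_eq_lintegral_rpow_enorm_toReal (by simpa using hq) (by simp),
    ENNReal.toReal_ofReal hp.le, ENNReal.toReal_ofReal hq.le]
  refine (enorm_integral_le_lintegral_enorm _).trans ?_
  simp_rw [enorm_mul]
  exact ENNReal.lintegral_mul_le_Lp_mul_Lq μ hpq hf.enorm hg.enorm

lemma enorm_integral_mul_le_two {α : Type*} [MeasurableSpace α] {μ : Measure α}
    {f g : α → ℂ} (hf : AEStronglyMeasurable f μ) (hg : AEStronglyMeasurable g μ) :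
    ‖∫ x, f x * g x ∂μ‖ₑ ≤ eLpNorm f 2 μ * eLpNorm g 2 μ := by
  simpa using enorm_integral_mul_le (p := 2) (q := 2) (by constructor <;> norm_num) hf hg

section Norming

variable {V : Type*} [NormedAddCommGroup V] [InnerProductSpace ℝ V] [FiniteDimensional ℝ V]
  [MeasurableSpace V] [BorelSpace V]

lemma integral_mul_eq_inner {f : V → ℂ} (hf : MemLp f 2) (x : Lp ℂ 2 (volume : Measure V)) :
    ∫ v, f v * x v = inner ℂ (hf.star.toLp (star f)) x := by
  rw [L2.inner_def]
  refine integral_congr_ae ?_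
  filter_upwards [hf.star.coeFn_toLp] with v hv
  rw [hv]
  simp [mul_comm]

/-- The Schwartz functions in the L^p unit ball form a subset of the separable space L², hence have
a countable L²-dense subfamily. Density in L² is enough because f ∈ L² makes the pairing
L²-continuous. -/
lemma exists_countable_schwartz_dense (p : ℝ≥0∞) :
    ∃ e : ℕ → SchwartzMap V ℂ, (∀ j, eLpNorm (e j) p ≤ 1) ∧
      ∀ f : V → ℂ, MemLp f 2 → ∀ g : SchwartzMap V ℂ, eLpNorm g p ≤ 1 →
        ‖∫ x, f x * g x‖ₑ ≤ ⨆ j, ‖∫ x, f x * e j x‖ₑ := by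
  have : Fact ((2 : ℝ≥0∞) ≠ ⊤) := ⟨by norm_num⟩
  let S : Set (Lp ℂ 2 (volume : Measure V)) :=
    {x | ∃ g : SchwartzMap V ℂ, eLpNorm g p ≤ 1 ∧ g.toLp 2 = x}
  have : Nonempty S := ⟨⟨_, 0, by simp, rfl⟩⟩
  obtain ⟨d, hd⟩ := TopologicalSpace.exists_dense_seq S
  choose e he1 he2 using fun j => (d j).2
  refine ⟨e, he1, fun f hf g hg => ?_⟩
  have key : ∀ h : SchwartzMap V ℂ, ∫ x, f x * h x = inner ℂ (hf.star.toLp (star f)) (h.toLp 2) := by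
    intro h
    rw [← integral_mul_eq_inner hf]
    refine integral_congr_ae ?_
    filter_upwards [h.coeFn_toLp 2] with v hv
    rw [hv]
  set N := ⨆ j, ‖∫ x, f x * e j x‖ₑ with hN
  have hcl : IsClosed {x : S | ‖(inner ℂ (hf.star.toLp (star f)) (x : Lp ℂ 2 (volume : Measure V)) : ℂ)‖ₑ ≤ N} :=
    isClosed_le (by fun_prop) continuous_const
  have hall : ∀ x : S, ‖(inner ℂ (hf.star.toLp (star f)) (x : Lp ℂ 2 (volume : Measure V)) : ℂ)‖ₑ ≤ N := by
    intro x
    refine hd.induction_on (p := fun x : S => ‖(inner ℂ (hf.star.toLp (star f))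
      (x : Lp ℂ 2 (volume : Measure V)) : ℂ)‖ₑ ≤ N) x hcl fun j => ?_
    rw [← he2 j, ← key]
    exact le_iSup (fun j => ‖∫ x, f x * e j x‖ₑ) j
  rw [key]
  exact hall ⟨_, g, hg, rfl⟩

lemma eLpNorm_schwartz_smul (c : ℂ) (g : SchwartzMap V ℂ) (p : ℝ≥0∞) :
    eLpNorm (c • g) p = ‖c‖ₑ * eLpNorm g p := by
  rw [← eLpNorm_const_smul]
  exact eLpNorm_congr_ae (.of_forall fun x => rfl)

lemma integral_mul_schwartz_smul (f : V → ℂ) (c : ℂ) (g : SchwartzMap V ℂ) :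
    ∫ x, f x * (c • g) x = c * ∫ x, f x * g x := by
  rw [← integral_const_mul]
  refine integral_congr_ae (.of_forall fun x => ?_)
  simp only [smul_apply, smul_eq_mul]
  ring

lemma enorm_integral_mul_schwartz_le {p : ℝ≥0∞} (hp0 : p ≠ 0) {f : V → ℂ} {N : ℝ≥0∞}
    (h : ∀ g : SchwartzMap V ℂ, eLpNorm g p ≤ 1 → ‖∫ x, f x * g x‖ₑ ≤ N)
    (g : SchwartzMap V ℂ) : ‖∫ x, f x * g x‖ₑ ≤ N * eLpNorm g p := by
  have hat : eLpNorm g p ≠ ⊤ := (g.eLpNorm_lt_top p volume).ne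
  rcases eq_or_ne (eLpNorm g p) 0 with h0 | h0
  · rw [eLpNorm_eq_zero_iff g.continuous.aestronglyMeasurable hp0] at h0
    rw [integral_congr_ae (g := fun _ => 0)]
    · simp
    · filter_upwards [h0] with x hx
      simp [hx]
  have h3 := eLpNorm_schwartz_smul (p := p) (g := g)
  generalize eLpNorm g p = a at h0 hat h3 ⊢
  have hpos : 0 < a.toReal := ENNReal.toReal_pos h0 hat
  obtain ⟨c, e1⟩ : ∃ c : ℂ, ‖c‖ₑ = a⁻¹ := ⟨((a.toReal⁻¹ : ℝ) : ℂ), by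
    rw [← ofReal_norm, Complex.norm_real, Real.norm_of_nonneg (by positivity),
      ENNReal.ofReal_inv_of_pos hpos, ENNReal.ofReal_toReal hat]⟩
  have h1 := h (c • g) (by rw [h3, e1, ENNReal.inv_mul_cancel h0 hat])
  rw [integral_mul_schwartz_smul, enorm_mul, e1] at h1
  calc _ = a * (a⁻¹ * ‖∫ x, f x * g x‖ₑ) := by
        rw [← mul_assoc, ENNReal.mul_inv_cancel h0 hat, one_mul]
    _ ≤ a * N := by gcongr
    _ = _ := mul_comm _ _

/-- The approximants share one bounded support, so that their L² convergence also yields L^p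
convergence for p < 2. Multiplying by a bump equal to 1 on the support of g only decreases the
distance to g. -/
lemma exists_schwartz_tendsto {g : V → ℂ} (hg : MemLp g 2) {k : ℝ} (hk : 0 < k)
    (hsupp : ∀ x, x ∉ Metric.closedBall (0 : V) k → g x = 0) :
    ∃ e : ℕ → SchwartzMap V ℂ, (∀ n x, x ∉ Metric.closedBall (0 : V) (k + 1) → e n x = 0) ∧
      Filter.Tendsto (fun n => eLpNorm (⇑(e n) - g) 2) Filter.atTop (nhds 0) := by
  have hdense := SchwartzMap.denseRange_toLpCLM (E := V) (F := ℂ) (p := 2)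
    (μ := (volume : Measure V)) (by norm_num)
  obtain ⟨y, hy, hyt⟩ := mem_closure_iff_seq_limit.1 (hdense (hg.toLp g))
  choose h hh using hy
  let χ : ContDiffBump (0 : V) := ⟨k, k + 1, hk, by linarith⟩
  have hχd : ContDiff ℝ ∞ fun x => (χ x : ℂ) := Complex.ofRealCLM.contDiff.comp χ.contDiff
  have hχs : HasCompactSupport fun x => (χ x : ℂ) :=
    χ.hasCompactSupport.comp_left (g := Complex.ofReal) (by simp)
  have hχt := hχs.hasTemperateGrowth hχd
  obtain ⟨T, hT⟩ : ∃ T : SchwartzMap V ℂ → SchwartzMap V ℂ, ∀ h x, T h x = (χ x : ℂ) * h x :=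
    ⟨SchwartzMap.smulLeftCLM ℂ (fun x => (χ x : ℂ)), fun h x => by
      rw [SchwartzMap.smulLeftCLM_apply_apply hχt, smul_eq_mul]⟩
  refine ⟨fun n => T (h n), fun n x hx => ?_, ?_⟩
  · rw [hT, χ.zero_of_le_dist]
    · simp
    · rw [Metric.mem_closedBall, not_le] at hx
      exact hx.le
  · have h2 : Filter.Tendsto (fun n => eLpNorm (⇑(h n) - g) 2) Filter.atTop (nhds 0) := by
      rw [Lp.tendsto_Lp_iff_tendsto_eLpNorm'] at hyt
      refine hyt.congr fun n => ?_
      refine eLpNorm_congr_ae ?_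
      rw [← hh n, SchwartzMap.toLpCLM_apply]
      exact ((h n).coeFn_toLp 2 volume).sub hg.coeFn_toLp
    refine tendsto_of_tendsto_of_tendsto_of_le_of_le tendsto_const_nhds h2 (fun _ => zero_le) fun n => ?_
    refine eLpNorm_mono fun x => ?_
    rw [Pi.sub_apply, Pi.sub_apply, hT]
    by_cases hx : x ∈ Metric.closedBall (0 : V) k
    · rw [χ.one_of_mem_closedBall hx, Complex.ofReal_one, one_mul]
    · rw [hsupp x hx, sub_zero, sub_zero, norm_mul, Complex.norm_real,
        Real.norm_of_nonneg χ.nonneg]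
      exact mul_le_of_le_one_left (norm_nonneg _) χ.le_one

/-- Passes from Schwartz functions to the rough test functions used in the converse of Hölder's
inequality: the left side converges by L² duality, and the right side because L² controls L^p on a
ball. -/
lemma enorm_integral_mul_le_of_schwartz {p : ℝ} (hp : 1 < p) (hp2 : p < 2) {f : V → ℂ}
    (hf : MemLp f 2) {N : ℝ≥0∞} (hN : N ≠ ⊤)
    (h : ∀ g : SchwartzMap V ℂ, ‖∫ x, f x * g x‖ₑ ≤ N * eLpNorm g (ENNReal.ofReal p))
    {g : V → ℂ} (hg : MemLp g 2) {k : ℝ} (hk : 0 < k)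
    (hsupp : ∀ x, x ∉ Metric.closedBall (0 : V) k → g x = 0) :
    ‖∫ x, f x * g x‖ₑ ≤ N * eLpNorm g (ENNReal.ofReal p) := by
  have hp0 : 0 < p := by linarith
  obtain ⟨e, hes, het⟩ := exists_schwartz_tendsto hg hk hsupp
  set B := Metric.closedBall (0 : V) (k + 1) with hB
  set c : ℝ≥0∞ := volume B ^ (1 / p - 1 / 2) with hc
  have hct : c ≠ ⊤ := ENNReal.rpow_ne_top_of_nonneg
    (by rw [sub_nonneg]; exact one_div_le_one_div_of_le hp0 hp2.le) measure_closedBall_lt_top.ne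
  have hpn : ∀ n, eLpNorm (⇑(e n) - g) (ENNReal.ofReal p) ≤ eLpNorm (⇑(e n) - g) 2 * c := by
    intro n
    have hs : Function.support (⇑(e n) - g) ⊆ B := by
      intro x hx
      by_contra hxB
      refine hx ?_
      have : x ∉ Metric.closedBall (0 : V) k := fun h' =>
        hxB (Metric.closedBall_subset_closedBall (by linarith) h')
      simp [hes n x hxB, hsupp x this]
    have hm : AEStronglyMeasurable (⇑(e n) - g) (volume.restrict B) :=
      ((e n).continuous.aestronglyMeasurable.sub hg.1).restrict
    have := eLpNorm_le_eLpNorm_mul_rpow_measure_univ (p := ENNReal.ofReal p) (q := 2)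
      (by rw [← ENNReal.ofReal_ofNat]; exact ENNReal.ofReal_le_ofReal hp2.le) hm
    rw [eLpNorm_restrict_eq_of_support_subset hs, eLpNorm_restrict_eq_of_support_subset hs] at this
    simpa [hc, ENNReal.toReal_ofReal hp0.le] using this
  have hle : ∀ n, ‖∫ x, f x * g x‖ₑ ≤ eLpNorm f 2 * eLpNorm (⇑(e n) - g) 2 +
      N * (eLpNorm g (ENNReal.ofReal p) + eLpNorm (⇑(e n) - g) 2 * c) := by
    intro n
    have h1 : ∫ x, f x * g x = (∫ x, f x * e n x) - ∫ x, f x * (⇑(e n) - g) x := by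
      rw [← integral_sub]
      · refine integral_congr_ae (.of_forall fun x => ?_)
        simp only [Pi.sub_apply]; ring
      · exact hf.integrable_mul ((e n).memLp 2)
      · exact hf.integrable_mul (((e n).memLp 2).sub hg)
    rw [h1, add_comm]
    refine (enorm_sub_le).trans (add_le_add ((h (e n)).trans ?_) ?_)
    · gcongr
      have : ⇑(e n) = g + (⇑(e n) - g) := by abel
      rw [this]
      refine (eLpNorm_add_le hg.1 ((e n).continuous.aestronglyMeasurable.sub hg.1) ?_).trans ?_
      · rw [← ENNReal.ofReal_one]; exact ENNReal.ofReal_le_ofReal hp.le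
      · gcongr
        simpa using hpn n
    · exact enorm_integral_mul_le_two hf.1 ((e n).continuous.aestronglyMeasurable.sub hg.1)
  have hlim : Filter.Tendsto (fun n => eLpNorm f 2 * eLpNorm (⇑(e n) - g) 2 +
      N * (eLpNorm g (ENNReal.ofReal p) + eLpNorm (⇑(e n) - g) 2 * c)) Filter.atTop
      (nhds (eLpNorm f 2 * 0 + N * (eLpNorm g (ENNReal.ofReal p) + 0 * c))) := by
    refine Filter.Tendsto.add (ENNReal.Tendsto.const_mul het (Or.inr hf.eLpNorm_ne_top))
      (ENNReal.Tendsto.const_mul (tendsto_const_nhds.add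
        (ENNReal.Tendsto.mul_const het (Or.inr hct))) (Or.inr hN))
  simpa using ge_of_tendsto' hlim hle

/-- Converse of Hölder: test against a truncation of |f|^{r-2} times the conjugate of f. Membership
of f in L^r is a conclusion here, so the truncation must keep every quantity finite until the power
X^{1/p} has been divided out. -/
lemma eLpNorm_le_of_schwartz {r p : ℝ} (hr : 2 < r) (hpr : p.HolderConjugate r) {f : V → ℂ}
    (hf : MemLp f 2) {N : ℝ≥0∞}
    (h : ∀ g : SchwartzMap V ℂ, ‖∫ x, f x * g x‖ₑ ≤ N * eLpNorm g (ENNReal.ofReal p)) :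
    eLpNorm f (ENNReal.ofReal r) ≤ N := by
  have hp := hpr.pos
  have hp1 := hpr.lt
  have hr0 : 0 < r := by linarith
  have hpr1 : p * r = p + r := hpr.mul_eq_add
  have hp2 : p < 2 := by nlinarith
  wlog hfm : StronglyMeasurable f generalizing f
  · rw [eLpNorm_congr_ae hf.1.ae_eq_mk]
    refine this ((memLp_congr_ae hf.1.ae_eq_mk).1 hf) (fun g => ?_) hf.1.stronglyMeasurable_mk
    rw [← integral_congr_ae (f := fun x => f x * g x)]
    · exact h g
    · filter_upwards [hf.1.ae_eq_mk] with x hx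
      rw [← hx]
  rcases eq_or_ne N ⊤ with rfl | hN
  · exact le_top
  -- The radius k + 1 is positive even for k = 0, as the approximation by Schwartz functions
  -- requires.
  set A : ℕ → Set V := fun k => Metric.closedBall 0 (k + 1) ∩ {x | ‖f x‖ ≤ k} with hA
  have hAm : ∀ k, MeasurableSet (A k) := fun k => measurableSet_closedBall.inter
    (measurableSet_le hfm.norm.measurable measurable_const)
  have hAk : ∀ k, ∫⁻ x in A k, ‖f x‖ₑ ^ r ≤ N ^ r := by
    intro k
    set X := ∫⁻ x in A k, ‖f x‖ₑ ^ r with hX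
    have hXt : X ≠ ⊤ := by
      have : X ≤ ∫⁻ x in A k, (k : ℝ≥0∞) ^ r := by
        refine setLIntegral_mono' (hAm k) fun x hx => ?_
        gcongr
        rw [← ofReal_norm, ← ENNReal.ofReal_natCast]
        exact ENNReal.ofReal_le_ofReal hx.2
      refine (this.trans_lt ?_).ne
      rw [setLIntegral_const]
      exact ENNReal.mul_lt_top (ENNReal.rpow_lt_top_of_nonneg hr0.le (by simp))
        ((measure_mono Set.inter_subset_left).trans_lt measure_closedBall_lt_top)
    let g : V → ℂ := (A k).indicator fun x => ((‖f x‖ ^ (r - 2) : ℝ) : ℂ) * star (f x)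
    have hgn : ∀ x, ‖g x‖ = (A k).indicator (fun x => ‖f x‖ ^ (r - 1)) x := by
      intro x
      by_cases hx : x ∈ A k
      · simp only [g, Set.indicator_of_mem hx, norm_mul, Complex.norm_real, norm_star]
        rw [Real.norm_of_nonneg (by positivity)]
        rcases eq_or_ne (‖f x‖) 0 with h0 | h0
        · rw [h0, Real.zero_rpow (by linarith : r - 1 ≠ 0), mul_zero]
        · nth_rewrite 2 [← Real.rpow_one ‖f x‖]
          rw [← Real.rpow_add (by positivity)]
          congr 1; ring
      · simp [g, hx]
    have hgm : StronglyMeasurable g := by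
      refine StronglyMeasurable.indicator (Measurable.stronglyMeasurable ?_) (hAm k)
      have h1 := hfm.norm.measurable
      have h2 : Measurable fun x => star (f x) := continuous_star.measurable.comp hfm.measurable
      fun_prop
    have hg : MemLp g 2 := by
      have hb : MemLp ((A k).indicator fun _ => (k : ℝ) ^ (r - 1)) 2 (volume : Measure V) :=
        memLp_indicator_const 2 (hAm k) _ (Or.inr
          ((measure_mono Set.inter_subset_left).trans_lt measure_closedBall_lt_top).ne)
      refine hb.mono hgm.aestronglyMeasurable (.of_forall fun x => ?_)
      rw [hgn]
      by_cases hx : x ∈ A k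
      · rw [Set.indicator_of_mem hx, Set.indicator_of_mem hx, Real.norm_of_nonneg (by positivity)]
        exact Real.rpow_le_rpow (norm_nonneg _) hx.2 (by linarith)
      · simp [hx]
    have hgs : ∀ x, x ∉ Metric.closedBall (0 : V) ((k : ℝ) + 1) → g x = 0 := fun x hx => by
      simp only [g]
      exact Set.indicator_of_notMem (fun h' => hx h'.1) _
    have key := enorm_integral_mul_le_of_schwartz hp1 hp2 hf hN h hg (by positivity) hgs
    have e1 : ∀ x, f x * g x = (((A k).indicator (fun x => ‖f x‖ ^ r) x : ℝ) : ℂ) := by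
      intro x
      by_cases hx : x ∈ A k
      · simp only [g, Set.indicator_of_mem hx]
        have h1 : f x * star (f x) = ((‖f x‖ ^ 2 : ℝ) : ℂ) := by
          have := Complex.mul_conj (f x)
          rw [Complex.normSq_eq_norm_sq] at this
          exact this
        rw [mul_left_comm, h1, ← Complex.ofReal_mul]
        congr 1
        rcases eq_or_ne (‖f x‖) 0 with h0 | h0
        · rw [h0, Real.zero_rpow hr0.ne']; simp
        · rw [← Real.rpow_natCast, ← Real.rpow_add (by positivity)]
          congr 1; push_cast; ring
      · simp [g, hx]
    have hnn : ∀ x, 0 ≤ (A k).indicator (fun x => ‖f x‖ ^ r) x := fun x =>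
      Set.indicator_nonneg (fun x _ => by positivity) x
    have e2 : ‖∫ x, f x * g x‖ₑ = X := by
      have hnm : AEStronglyMeasurable ((A k).indicator fun x => ‖f x‖ ^ r) volume :=
        ((hfm.norm.measurable.pow_const r).indicator (hAm k)).aestronglyMeasurable
      rw [integral_congr_ae (.of_forall e1), integral_complex_ofReal, ← ofReal_norm,
        Complex.norm_real, Real.norm_of_nonneg (integral_nonneg hnn),
        integral_eq_lintegral_of_nonneg_ae (.of_forall hnn) hnm, hX, ← lintegral_indicator (hAm k)]
      have e3 : ∀ x, ENNReal.ofReal ((A k).indicator (fun x => ‖f x‖ ^ r) x)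
          = (A k).indicator (fun x => ‖f x‖ₑ ^ r) x := by
        intro x
        by_cases hx : x ∈ A k
        · simp only [Set.indicator_of_mem hx]
          rw [← ENNReal.ofReal_rpow_of_nonneg (norm_nonneg _) hr0.le, ofReal_norm]
        · simp [hx]
      simp_rw [e3]
      refine ENNReal.ofReal_toReal ?_
      rw [lintegral_indicator (hAm k)]
      exact hXt
    have e4 : eLpNorm g (ENNReal.ofReal p) = X ^ (1 / p) := by
      rw [eLpNorm_eq_lintegral_rpow_enorm_toReal (by simpa using hp) (by simp),
        ENNReal.toReal_ofReal hp.le, hX, ← lintegral_indicator (hAm k)]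
      congr 1
      refine lintegral_congr fun x => ?_
      rw [← ofReal_norm, hgn]
      by_cases hx : x ∈ A k
      · simp only [Set.indicator_of_mem hx]
        rw [← ENNReal.ofReal_rpow_of_nonneg (norm_nonneg _) (by linarith), ofReal_norm,
          ← ENNReal.rpow_mul]
        congr 1; linarith
      · simp [hx, hp]
    rw [e2, e4] at key
    rcases eq_or_ne X 0 with h0 | h0
    · rw [h0]; exact zero_le
    have h3 : X = X ^ (1 / r) * X ^ (1 / p) := by
      rw [← ENNReal.rpow_add _ _ h0 hXt]
      nth_rewrite 1 [← ENNReal.rpow_one X]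
      congr 1
      rw [one_div, one_div, add_comm]
      exact hpr.inv_add_inv_eq_one.symm
    have h4 : X ^ (1 / r) ≤ N := by
      have hne0 : X ^ (1 / p) ≠ 0 := by simp [h0, hXt]
      have hnet : X ^ (1 / p) ≠ ⊤ := ENNReal.rpow_ne_top_of_nonneg (by positivity) hXt
      refine (ENNReal.mul_le_mul_iff_left hne0 hnet).1 ?_
      rw [← h3]; exact key
    calc X = (X ^ (1 / r)) ^ r := by
          rw [← ENNReal.rpow_mul, one_div_mul_cancel hr0.ne', ENNReal.rpow_one]
      _ ≤ N ^ r := by gcongr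
  have hAmono : Monotone A := by
    intro k l hkl x hx
    have : (k : ℝ) ≤ l := by exact_mod_cast hkl
    refine ⟨Metric.closedBall_subset_closedBall (by linarith) hx.1, ?_⟩
    have := hx.2
    simp only [Set.mem_ofPred_eq] at this ⊢
    linarith
  have hAU : ⋃ k, A k = Set.univ := by
    refine Set.eq_univ_of_forall fun x => Set.mem_iUnion.2 ?_
    obtain ⟨k, hk⟩ := exists_nat_ge (max ‖x‖ ‖f x‖)
    refine ⟨k, ?_, (le_max_right _ _).trans hk⟩
    rw [mem_closedBall_zero_iff]
    linarith [(le_max_left ‖x‖ ‖f x‖).trans hk]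
  have hfin : ∫⁻ x, ‖f x‖ₑ ^ r ≤ N ^ r := by
    rw [← setLIntegral_univ, ← hAU, setLIntegral_iUnion_of_directed _ hAmono.directed_le]
    exact iSup_le hAk
  rw [eLpNorm_eq_lintegral_rpow_enorm_toReal (by simpa using hr0) (by simp),
    ENNReal.toReal_ofReal hr0.le, one_div, ENNReal.rpow_inv_le_iff hr0]
  exact hfin

/-- A countable family of Schwartz functions that norms `L^r` on `L²`. -/
theorem exists_countable_norming {r p : ℝ} (hr : 2 < r) (hpr : p.HolderConjugate r) :
    ∃ e : ℕ → SchwartzMap V ℂ, (∀ j, eLpNorm (e j) (ENNReal.ofReal p) ≤ 1) ∧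
      ∀ f : V → ℂ, MemLp f 2 → eLpNorm f (ENNReal.ofReal r) ≤ ⨆ j, ‖∫ x, f x * e j x‖ₑ := by
  obtain ⟨e, he1, he⟩ := exists_countable_schwartz_dense (V := V) (ENNReal.ofReal p)
  exact ⟨e, he1, fun f hf => eLpNorm_le_of_schwartz hr hpr hf
    (enorm_integral_mul_schwartz_le (by simpa using hpr.pos) (he f hf))⟩

end Norming

/-! ### Compactly supported functions are dense in Schwartz space -/

section Cutoff

variable {V : Type*} [NormedAddCommGroup V] [InnerProductSpace ℝ V]

/-- Since θ vanishes on the unit ball, the rescaled function and its derivatives vanish unless ‖x‖ ≥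
n + 1. There 1 ≤ (1+‖x‖)/(n+1), so one more power of the polynomial weight buys the decay in n. -/
lemma norm_iteratedFDeriv_rescale_le {θ : V → ℂ} (hθ : θ.HasTemperateGrowth)
    (hθ0 : ∀ x ∈ Metric.ball (0 : V) 1, θ x = 0) (l : ℕ) :
    ∃ (k : ℕ) (C : ℝ), 0 ≤ C ∧ ∀ i ≤ l, ∀ (n : ℕ) (x : V),
      ‖iteratedFDeriv ℝ i (fun x => θ (((n : ℝ) + 1)⁻¹ • x)) x‖
        ≤ C * (1 + ‖x‖) ^ k * ((n : ℝ) + 1)⁻¹ := by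
  obtain ⟨k, C, hC, h⟩ := hθ.norm_iteratedFDeriv_le_uniform l
  refine ⟨k + 1, C, hC, fun i hi n x => ?_⟩
  have hθd : ContDiff ℝ i θ := hθ.1.of_le (by exact_mod_cast le_top)
  rw [iteratedFDeriv_comp_const_smul _ hθd]
  set a : ℝ := ((n : ℝ) + 1)⁻¹ with ha
  have ha0 : 0 < a := by positivity
  have ha1 : a ≤ 1 := inv_le_one_of_one_le₀ (by linarith [n.cast_nonneg (α := ℝ)])
  rw [norm_smul, norm_pow, Real.norm_of_nonneg ha0.le]
  rcases lt_or_ge (‖a • x‖) 1 with hx | hx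
  · have : iteratedFDeriv ℝ i θ (a • x) = 0 := by
      have he : θ =ᶠ[nhds (a • x)] fun _ => 0 := by
        filter_upwards [Metric.isOpen_ball.mem_nhds
          (show a • x ∈ Metric.ball (0 : V) 1 by simpa using hx)] with y hy using hθ0 y hy
      rw [(he.iteratedFDeriv ℝ i).eq_of_nhds]
      simp
    rw [this, norm_zero, mul_zero]
    positivity
  · rw [norm_smul, Real.norm_of_nonneg ha0.le] at hx
    have h1 : a * ‖x‖ ≤ ‖x‖ := mul_le_of_le_one_left (norm_nonneg _) ha1
    have h2 : ‖a • x‖ ≤ ‖x‖ := by rwa [norm_smul, Real.norm_of_nonneg ha0.le]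
    calc a ^ i * ‖iteratedFDeriv ℝ i θ (a • x)‖ ≤ 1 * (C * (1 + ‖x‖) ^ k) := by
          gcongr
          · exact pow_le_one₀ ha0.le ha1
          · exact (h i hi _).trans (by gcongr)
      _ ≤ C * (1 + ‖x‖) ^ k * ((1 + ‖x‖) * a) := by
          rw [one_mul]
          refine le_mul_of_one_le_right (by positivity) ?_
          nlinarith
      _ = _ := by ring

/-- Dilated cutoffs of f converge to it: by Leibniz every seminorm of the error is a sum of products
of derivatives of the rescaled θ = χ - 1, which are O(1/n) with polynomial weight, and derivatives
of f, which absorb that weight. -/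
lemma exists_hasCompactSupport_tendsto [FiniteDimensional ℝ V] (f : SchwartzMap V ℂ) :
    ∃ g : ℕ → SchwartzMap V ℂ, (∀ n, HasCompactSupport (g n)) ∧
      Filter.Tendsto g Filter.atTop (nhds f) := by
  let χ : ContDiffBump (0 : V) := ⟨1, 2, by norm_num, by norm_num⟩
  have hχd : ContDiff ℝ ∞ fun x => (χ x : ℂ) := Complex.ofRealCLM.contDiff.comp χ.contDiff
  have hχs : HasCompactSupport fun x => (χ x : ℂ) :=
    χ.hasCompactSupport.comp_left (g := Complex.ofReal) (by simp)
  have hχt := hχs.hasTemperateGrowth hχd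
  set θ : V → ℂ := fun x => (χ x : ℂ) - 1 with hθ
  have hθt : θ.HasTemperateGrowth := hχt.sub (.const 1)
  have hθ0 : ∀ x ∈ Metric.ball (0 : V) 1, θ x = 0 := fun x hx => by
    simp [hθ, χ.one_of_mem_closedBall (Metric.ball_subset_closedBall hx)]
  have hst : ∀ n : ℕ, (fun x : V => ((n : ℝ) + 1)⁻¹ • x).HasTemperateGrowth := fun n =>
    (((n : ℝ) + 1)⁻¹ • ContinuousLinearMap.id ℝ V).hasTemperateGrowth
  have hχn : ∀ n : ℕ, (fun x => (χ (((n : ℝ) + 1)⁻¹ • x) : ℂ)).HasTemperateGrowth :=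
    fun n => hχt.comp (hst n)
  have hθn : ∀ n : ℕ, (fun x => θ (((n : ℝ) + 1)⁻¹ • x)).HasTemperateGrowth :=
    fun n => hθt.comp (hst n)
  obtain ⟨g, hg⟩ : ∃ g : ℕ → SchwartzMap V ℂ,
      ∀ n x, g n x = (χ (((n : ℝ) + 1)⁻¹ • x) : ℂ) * f x :=
    ⟨fun n => SchwartzMap.smulLeftCLM ℂ (fun x => (χ (((n : ℝ) + 1)⁻¹ • x) : ℂ)) f, fun n x => by
      rw [SchwartzMap.smulLeftCLM_apply_apply (hχn n), smul_eq_mul]⟩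
  refine ⟨g, fun n => ?_, ?_⟩
  · have h1 : HasCompactSupport fun x => (χ (((n : ℝ) + 1)⁻¹ • x) : ℂ) :=
      hχs.comp_homeomorph (Homeomorph.smulOfNeZero ((n : ℝ) + 1)⁻¹ (by positivity))
    have h2 : ⇑(g n) = fun x => (χ (((n : ℝ) + 1)⁻¹ • x) : ℂ) * f x := funext (hg n)
    rw [h2]
    exact h1.mul_right
  · rw [(schwartz_withSeminorms ℝ V ℂ).tendsto_nhds]
    rintro ⟨k, l⟩ ε hε
    obtain ⟨k', C, hC, hθb⟩ := norm_iteratedFDeriv_rescale_le hθt hθ0 l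
    set S : ℝ := 2 ^ (k + k') * ((Finset.Iic (k + k', l)).sup (schwartzSeminormFamily ℝ V ℂ)) f
    have hS0 : 0 ≤ S := by positivity
    have hS : ∀ j ≤ l, ∀ x, (1 + ‖x‖) ^ (k + k') * ‖iteratedFDeriv ℝ j f x‖ ≤ S := fun j hj x =>
      SchwartzMap.one_add_le_sup_seminorm_apply (𝕜 := ℝ) (m := (k + k', l)) le_rfl hj f x
    have hbound : ∀ n : ℕ, SchwartzMap.seminorm ℝ k l (g n - f)
        ≤ 2 ^ l * C * S * ((n : ℝ) + 1)⁻¹ := by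
      intro n
      refine SchwartzMap.seminorm_le_bound ℝ k l _ (by positivity) fun x => ?_
      have h1 : ⇑(g n - f) = fun x => θ (((n : ℝ) + 1)⁻¹ • x) * f x := by
        ext x
        rw [sub_apply, hg, hθ]
        ring
      rw [h1]
      have h2 := norm_iteratedFDeriv_mul_le (𝕜 := ℝ) (hθn n).1 (f.smooth ⊤) x (n := l)
        (by exact_mod_cast le_top)
      calc _ ≤ ‖x‖ ^ k * ∑ i ∈ Finset.range (l + 1), (l.choose i : ℝ) *
            ‖iteratedFDeriv ℝ i (fun x => θ (((n : ℝ) + 1)⁻¹ • x)) x‖ *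
              ‖iteratedFDeriv ℝ (l - i) f x‖ := by gcongr
        _ = ∑ i ∈ Finset.range (l + 1), ‖x‖ ^ k * ((l.choose i : ℝ) *
            ‖iteratedFDeriv ℝ i (fun x => θ (((n : ℝ) + 1)⁻¹ • x)) x‖ *
              ‖iteratedFDeriv ℝ (l - i) f x‖) := Finset.mul_sum _ _ _
        _ ≤ ∑ i ∈ Finset.range (l + 1), (l.choose i : ℝ) * (C * S * ((n : ℝ) + 1)⁻¹) := by
          refine Finset.sum_le_sum fun i hi => ?_
          have hi' : i ≤ l := Nat.lt_succ_iff.1 (Finset.mem_range.1 hi)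
          calc _ ≤ (1 + ‖x‖) ^ k * ((l.choose i : ℝ) * (C * (1 + ‖x‖) ^ k' * ((n : ℝ) + 1)⁻¹) *
                ‖iteratedFDeriv ℝ (l - i) f x‖) := by
                gcongr
                · linarith
                · exact hθb i hi' n x
            _ = (l.choose i : ℝ) * (C * ((1 + ‖x‖) ^ (k + k') * ‖iteratedFDeriv ℝ (l - i) f x‖)
                  * ((n : ℝ) + 1)⁻¹) := by rw [pow_add]; ring
            _ ≤ _ := by gcongr; exact hS _ (Nat.sub_le _ _) x
        _ = 2 ^ l * C * S * ((n : ℝ) + 1)⁻¹ := by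
          rw [← Finset.sum_mul, ← Nat.cast_sum, Nat.sum_range_choose]
          push_cast
          ring
    have hlim : Filter.Tendsto (fun n : ℕ => 2 ^ l * C * S * ((n : ℝ) + 1)⁻¹) Filter.atTop
        (nhds (2 ^ l * C * S * 0)) := by
      refine Filter.Tendsto.const_mul _ ?_
      simpa using tendsto_one_div_add_atTop_nhds_zero_nat (𝕜 := ℝ)
    rw [mul_zero] at hlim
    filter_upwards [hlim.eventually_lt_const hε] with n hn
    exact (hbound n).trans_lt hn

end Cutoff

/-! ### The transposed operator on Schwartz functions -/

section Transpose

variable {ι : Type} [Fintype ι]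

/-- `ψ ↦ i tr(Q∇²ψ) - div(ψ Bx)` as an operator on Schwartz functions. -/
noncomputable def transposeCLM [DecidableEq ι] (Q B : Matrix ι ι ℝ) :
    SchwartzMap (EuclideanSpace ℝ ι) ℂ →L[ℂ] SchwartzMap (EuclideanSpace ℝ ι) ℂ :=
  Complex.I • (∑ i, ∑ j, (Q i j : ℂ) •
      (lineDerivOpCLM ℂ (SchwartzMap (EuclideanSpace ℝ ι) ℂ) (EuclideanSpace.single j (1 : ℝ)) ∘L
        lineDerivOpCLM ℂ (SchwartzMap (EuclideanSpace ℝ ι) ℂ) (EuclideanSpace.single i (1 : ℝ)))) -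
    (∑ i, SchwartzMap.smulLeftCLM ℂ (fun x : EuclideanSpace ℝ ι => ((∑ j, B i j * x j : ℝ) : ℂ)) ∘L
        lineDerivOpCLM ℂ (SchwartzMap (EuclideanSpace ℝ ι) ℂ) (EuclideanSpace.single i (1 : ℝ)) +
      (B.trace : ℂ) • ContinuousLinearMap.id ℂ _)

lemma hasTemperateGrowth_rowSum (b : ι → ℝ) :
    (fun x : EuclideanSpace ℝ ι => ((∑ j, b j * x j : ℝ) : ℂ)).HasTemperateGrowth := by
  have : (fun x : EuclideanSpace ℝ ι => ((∑ j, b j * x j : ℝ) : ℂ)) =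
      ⇑(Complex.ofRealCLM ∘L ∑ j, b j • (EuclideanSpace.proj j : EuclideanSpace ℝ ι →L[ℝ] ℝ)) := by
    ext x
    simp
  rw [this]
  exact ContinuousLinearMap.hasTemperateGrowth _

lemma transposeCLM_apply [DecidableEq ι] (Q B : Matrix ι ι ℝ) (ψ : SchwartzMap (EuclideanSpace ℝ ι) ℂ)
    (x : EuclideanSpace ℝ ι) : transposeCLM Q B ψ x = transposeOp Q B ψ x := by
  have h1 : ∀ (i : ι) (ψ : SchwartzMap (EuclideanSpace ℝ ι) ℂ), partialDeriv i ψ =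
      ⇑(∂_{EuclideanSpace.single i (1 : ℝ)} ψ : SchwartzMap (EuclideanSpace ℝ ι) ℂ) := by
    intro i ψ
    ext y
    rw [SchwartzMap.lineDerivOp_apply_eq_fderiv]
    rfl
  rw [transposeOp, trHess, driftTerm]
  simp only [h1]
  rw [transposeCLM]
  simp only [sub_apply, add_apply, smul_apply, sum_apply,
    ContinuousLinearMap.comp_apply, lineDerivOpCLM_apply, ContinuousLinearMap.id_apply, smul_eq_mul,
    SchwartzMap.smulLeftCLM_apply_apply (hasTemperateGrowth_rowSum _)]

end Transpose

/-! ### Space-time pairings with Schwartz functions -/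

section Pairing

variable {V : Type*} [NormedAddCommGroup V] [InnerProductSpace ℝ V] [FiniteDimensional ℝ V]
  [MeasurableSpace V] [BorelSpace V]

lemma aemeasurable_eLpNorm_slice {μ : Measure ℝ} {F : ℝ → V → ℂ}
    (hF : AEStronglyMeasurable (Function.uncurry F) (μ.prod volume)) {p : ℝ} (hp : 0 < p) :
    AEMeasurable (fun s => eLpNorm (F s) (ENNReal.ofReal p)) μ := by
  have : ∀ s, eLpNorm (F s) (ENNReal.ofReal p) = (∫⁻ x, ‖F s x‖ₑ ^ p) ^ (1 / p) := fun s => by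
    rw [eLpNorm_eq_lintegral_rpow_enorm_toReal (by simpa using hp) (by simp),
      ENNReal.toReal_ofReal hp.le]
  simp_rw [this]
  exact ((hF.enorm.pow_const p).lintegral_prod_right').pow_const _

lemma norm_integral_mul_schwartz_le {p r : ℝ} (hpr : p.HolderConjugate r) {f : V → ℂ}
    (hf : MemLp f (ENNReal.ofReal p)) (ψ : SchwartzMap V ℂ) :
    ‖∫ x, f x * ψ x‖ ≤ (eLpNorm f (ENNReal.ofReal p)).toReal *
      (eLpNorm ψ (ENNReal.ofReal r)).toReal := by
  rw [← ENNReal.toReal_mul, ← toReal_enorm]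
  exact ENNReal.toReal_mono (ENNReal.mul_ne_top hf.eLpNorm_ne_top
    (ψ.eLpNorm_lt_top (ENNReal.ofReal r) volume).ne)
    (enorm_integral_mul_le hpr hf.1 ψ.continuous.aestronglyMeasurable)

lemma norm_integral_mul_schwartz_le_two {f : V → ℂ} (hf : MemLp f 2) (ψ : SchwartzMap V ℂ) :
    ‖∫ x, f x * ψ x‖ ≤ (eLpNorm f 2).toReal * (eLpNorm ψ 2).toReal := by
  simpa using norm_integral_mul_schwartz_le (p := 2) (r := 2) (by constructor <;> norm_num)
    (by simpa using hf) ψ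

lemma integrable_mul_schwartz {p r : ℝ} (hpr : p.HolderConjugate r) {f : V → ℂ}
    (hf : MemLp f (ENNReal.ofReal p)) (ψ : SchwartzMap V ℂ) :
    Integrable fun x => f x * ψ x := by
  have := hpr.ennrealOfReal
  exact hf.integrable_mul (ψ.memLp (ENNReal.ofReal r) volume)

lemma tendsto_eLpNorm_schwartz {r : ℝ≥0∞} (hr : 1 ≤ r) {g : ℕ → SchwartzMap V ℂ}
    {ψ : SchwartzMap V ℂ} (h : Filter.Tendsto g Filter.atTop (nhds ψ)) :
    Filter.Tendsto (fun n => (eLpNorm (g n) r).toReal) Filter.atTop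
      (nhds (eLpNorm ψ r).toReal) := by
  have : Fact (1 ≤ r) := ⟨hr⟩
  have h1 := ((SchwartzMap.continuous_toLp (E := V) (F := ℂ) (p := r) (μ := volume)).norm.tendsto
    ψ).comp h
  simpa only [Function.comp_def, SchwartzMap.norm_toLp] using h1

lemma tendsto_integral_mul_schwartz {p r : ℝ} (hpr : p.HolderConjugate r) {f : V → ℂ}
    (hf : MemLp f (ENNReal.ofReal p)) {g : ℕ → SchwartzMap V ℂ}
    {ψ : SchwartzMap V ℂ} (h : Filter.Tendsto g Filter.atTop (nhds ψ)) :
    Filter.Tendsto (fun n => ∫ x, f x * g n x) Filter.atTop (nhds (∫ x, f x * ψ x)) := by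
  rw [tendsto_iff_norm_sub_tendsto_zero]
  have h0 : Filter.Tendsto (fun n => g n - ψ) Filter.atTop (nhds 0) := by
    simpa using h.sub_const ψ
  have h1 := (tendsto_eLpNorm_schwartz (r := ENNReal.ofReal r)
    (by simpa using hpr.symm.lt.le) h0).const_mul (eLpNorm f (ENNReal.ofReal p)).toReal
  have h2 : (eLpNorm (0 : SchwartzMap V ℂ) (ENNReal.ofReal r)).toReal = 0 := by
    have : ⇑(0 : SchwartzMap V ℂ) = 0 := rfl
    rw [this, eLpNorm_zero, ENNReal.toReal_zero]
  rw [h2, mul_zero] at h1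
  refine squeeze_zero (fun _ => norm_nonneg _) (fun n => ?_) h1
  rw [← integral_sub (integrable_mul_schwartz hpr hf _) (integrable_mul_schwartz hpr hf _)]
  refine le_trans (le_of_eq ?_) (norm_integral_mul_schwartz_le hpr hf (g n - ψ))
  congr 1
  refine integral_congr_ae (.of_forall fun x => ?_)
  simp only [sub_apply]
  ring

lemma aestronglyMeasurable_integral_mul {μ : Measure ℝ} [SFinite μ] {u : ℝ → V → ℂ}
    (hu : AEStronglyMeasurable (Function.uncurry u) (μ.prod volume)) (ψ : SchwartzMap V ℂ) :
    AEStronglyMeasurable (fun s => ∫ x, u s x * ψ x) μ := by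
  have h1 : AEStronglyMeasurable (fun z : ℝ × V => Function.uncurry u z * ψ z.2)
      (μ.prod volume) :=
    hu.mul (ψ.continuous.comp continuous_snd).aestronglyMeasurable
  exact h1.integral_prod_right'

lemma memLp_slice {μ : Measure ℝ} [SFinite μ] {F : ℝ → V → ℂ}
    (hF : AEStronglyMeasurable (Function.uncurry F) (μ.prod volume)) {p : ℝ} (hp : 0 < p)
    (hG : ∫⁻ s, eLpNorm (F s) (ENNReal.ofReal p) ∂μ ≠ ⊤) :
    ∀ᵐ s ∂μ, MemLp (F s) (ENNReal.ofReal p) := by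
  filter_upwards [hF.prodMk_left, ae_lt_top' (aemeasurable_eLpNorm_slice hF hp) hG] with s h1 h2
    using ⟨h1, h2⟩

lemma integrable_integral_mul {μ : Measure ℝ} [SFinite μ] {p r : ℝ} (hpr : p.HolderConjugate r)
    {F : ℝ → V → ℂ}
    (hF : AEStronglyMeasurable (Function.uncurry F) (μ.prod volume))
    (hG : ∫⁻ s, eLpNorm (F s) (ENNReal.ofReal p) ∂μ ≠ ⊤) (ψ : SchwartzMap V ℂ) :
    Integrable (fun s => ∫ x, F s x * ψ x) μ := by
  refine Integrable.mono' ((integrable_toReal_of_lintegral_ne_top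
    (aemeasurable_eLpNorm_slice hF hpr.pos) hG).mul_const (eLpNorm ψ (ENNReal.ofReal r)).toReal)
    (aestronglyMeasurable_integral_mul hF ψ) ?_
  filter_upwards [memLp_slice hF hpr.pos hG] with s hs
  exact norm_integral_mul_schwartz_le hpr hs ψ

lemma integrable_integral_mul_two {μ : Measure ℝ} [IsFiniteMeasure μ] {u : ℝ → V → ℂ}
    (hu : AEStronglyMeasurable (Function.uncurry u) (μ.prod volume)) {M : ℝ≥0}
    (hM : ∀ᵐ s ∂μ, eLpNorm (u s) 2 ≤ M) (ψ : SchwartzMap V ℂ) :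
    Integrable (fun s => ∫ x, u s x * ψ x) μ := by
  have h : ∫⁻ s, eLpNorm (u s) (ENNReal.ofReal 2) ∂μ ≠ ⊤ := by
    refine ((lintegral_mono_ae (g := fun _ => (M : ℝ≥0∞)) ?_).trans_lt ?_).ne
    · simpa using hM
    · rw [lintegral_const]
      exact ENNReal.mul_lt_top (by simp) (measure_lt_top _ _)
  exact integrable_integral_mul (p := 2) (r := 2) (by constructor <;> norm_num) hu h ψ

/-- Passage to the limit in the time-integrated weak formulation. -/
lemma tendsto_intervalIntegral_pairing {p r : ℝ} (hpr : p.HolderConjugate r) {a b : ℝ}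
    {F u : ℝ → V → ℂ}
    (hu : AEStronglyMeasurable (Function.uncurry u) ((volume.restrict (Set.uIoc a b)).prod volume))
    (hF : AEStronglyMeasurable (Function.uncurry F) ((volume.restrict (Set.uIoc a b)).prod volume))
    {M : ℝ≥0} (hM : ∀ s ∈ Set.uIoc a b, MemLp (u s) 2 ∧ eLpNorm (u s) 2 ≤ M)
    (hG : ∫⁻ s in Set.uIoc a b, eLpNorm (F s) (ENNReal.ofReal p) ≠ ⊤)
    {g h : ℕ → SchwartzMap V ℂ} {ψ ξ : SchwartzMap V ℂ}
    (hg : Filter.Tendsto g Filter.atTop (nhds ψ)) (hh : Filter.Tendsto h Filter.atTop (nhds ξ)) :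
    Filter.Tendsto (fun n => ∫ s in a..b, ((∫ x, u s x * h n x) + ∫ x, F s x * g n x))
      Filter.atTop (nhds (∫ s in a..b, ((∫ x, u s x * ξ x) + ∫ x, F s x * ψ x))) := by
  obtain ⟨Cg, hCg⟩ := (tendsto_eLpNorm_schwartz (r := ENNReal.ofReal r)
    (by simpa using hpr.symm.lt.le) hg).bddAbove_range
  obtain ⟨Ch, hCh⟩ := (tendsto_eLpNorm_schwartz (r := 2) (by norm_num) hh).bddAbove_range
  have hFm := (ae_restrict_iff' measurableSet_uIoc).1 (memLp_slice hF hpr.pos hG)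
  refine intervalIntegral.tendsto_integral_filter_of_dominated_convergence
    (fun s => M * Ch + (eLpNorm (F s) (ENNReal.ofReal p)).toReal * Cg) (.of_forall fun n => ?_)
    (.of_forall fun n => ?_) ?_ ?_
  · exact (aestronglyMeasurable_integral_mul hu _).add (aestronglyMeasurable_integral_mul hF _)
  · filter_upwards [hFm] with s hs hsab
    refine (norm_add_le _ _).trans (add_le_add ?_ ?_)
    · refine (norm_integral_mul_schwartz_le_two (hM s hsab).1 _).trans ?_
      gcongr
      · exact ENNReal.toReal_le_of_le_ofReal M.2 (by simpa using (hM s hsab).2)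
      · exact hCh ⟨n, rfl⟩
    · refine (norm_integral_mul_schwartz_le hpr (hs hsab) _).trans ?_
      gcongr
      exact hCg ⟨n, rfl⟩
  · refine intervalIntegrable_const.add (IntervalIntegrable.mul_const ?_ _)
    rw [intervalIntegrable_iff]
    exact integrable_toReal_of_lintegral_ne_top (aemeasurable_eLpNorm_slice hF hpr.pos) hG
  · filter_upwards [hFm] with s hs hsab
    exact (tendsto_integral_mul_schwartz (p := 2) (r := 2) (by constructor <;> norm_num)
      (by simpa using (hM s hsab).1) hh).add (tendsto_integral_mul_schwartz hpr (hs hsab) hg)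

end Pairing

/-! ### Weak formulation against Schwartz functions, and an abstract Duhamel inequality -/

section Weak

variable {ι : Type} [Fintype ι] [DecidableEq ι]

/-- Evolved test functions are Schwartz but in general not compactly supported, so the weak
formulation has to be extended. Approximation in the Schwartz topology works because `transposeCLM`
is continuous there. -/
lemma weak_equation_schwartz {Q B : Matrix ι ι ℝ} {φ : EuclideanSpace ℝ ι → ℂ}
    {F u : ℝ → EuclideanSpace ℝ ι → ℂ} {p r : ℝ} (hpr : p.HolderConjugate r) {t : ℝ}
    (hu : AEStronglyMeasurable (Function.uncurry u) ((volume.restrict (Set.uIoc 0 t)).prod volume))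
    (hF : AEStronglyMeasurable (Function.uncurry F) ((volume.restrict (Set.uIoc 0 t)).prod volume))
    {M : ℝ≥0} (hM : ∀ s ∈ Set.uIoc 0 t, MemLp (u s) 2 ∧ eLpNorm (u s) 2 ≤ M)
    (hG : ∫⁻ s in Set.uIoc 0 t, eLpNorm (F s) (ENNReal.ofReal p) ≠ ⊤)
    (hφ : MemLp φ 2) (hut : MemLp (u t) 2)
    (heq : ∀ ψ : EuclideanSpace ℝ ι → ℂ, ContDiff ℝ ∞ ψ → HasCompactSupport ψ →
      ∫ x, u t x * ψ x = (∫ x, φ x * ψ x) +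
        ∫ s in (0 : ℝ)..t, ((∫ x, u s x * transposeOp Q B ψ x) + ∫ x, F s x * ψ x))
    (ψ : SchwartzMap (EuclideanSpace ℝ ι) ℂ) :
    ∫ x, u t x * ψ x = (∫ x, φ x * ψ x) +
        ∫ s in (0 : ℝ)..t, ((∫ x, u s x * transposeCLM Q B ψ x) + ∫ x, F s x * ψ x) := by
  obtain ⟨g, hgs, hg⟩ := exists_hasCompactSupport_tendsto ψ
  have h22 : (2 : ℝ).HolderConjugate 2 := by constructor <;> norm_num
  have h1 := tendsto_integral_mul_schwartz h22 (by simpa using hut) hg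
  have h2 := (tendsto_integral_mul_schwartz h22 (by simpa using hφ) hg).add
    (tendsto_intervalIntegral_pairing hpr hu hF hM hG hg
      (((transposeCLM Q B).continuous.tendsto ψ).comp hg))
  refine tendsto_nhds_unique h1 (h2.congr fun n => ?_)
  rw [heq (g n) ((g n).smooth ⊤) (hgs n)]
  simp only [Function.comp_apply, transposeCLM_apply]

end Weak

/-- Sum the increments over n + 1 equal steps: the main terms telescope, while the errors add up to
K · (mesh) · (m t - m 0), which tends to 0. Allowing the increment of m in the error accommodates a
forcing that is merely integrable in time. -/
lemma norm_sub_le_of_increment_le {k : ℝ → ℂ} {b m : ℝ → ℝ} {K t : ℝ} (ht : 0 ≤ t)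
    (h : ∀ s ∈ Set.Icc 0 t, ∀ s' ∈ Set.Icc 0 t, s ≤ s' →
      ‖k s' - k s‖ ≤ (b s' - b s) + K * (s' - s) * (m s' - m s)) :
    ‖k t - k 0‖ ≤ b t - b 0 := by
  have hn : ∀ n : ℕ, ‖k t - k 0‖ ≤ (b t - b 0) + K * t * (m t - m 0) * (1 / ((n : ℝ) + 1)) := by
    intro n
    set N : ℝ := (n : ℝ) + 1 with hN
    have hN0 : 0 < N := by positivity
    set x : ℕ → ℝ := fun i => t * (i / N) with hx
    have hx0 : x 0 = 0 := by simp [hx]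
    have hxn : x (n + 1) = t := by
      simp only [hx]; push_cast; rw [← hN, div_self hN0.ne', mul_one]
    have hxmem : ∀ i ≤ n + 1, x i ∈ Set.Icc 0 t := by
      intro i hi
      have : (i : ℝ) / N ≤ 1 := by
        rw [div_le_one hN0, hN]; exact_mod_cast hi
      exact ⟨by simp only [hx]; positivity, mul_le_of_le_one_right ht this⟩
    have hstep : ∀ i, x (i + 1) - x i = t / N := by
      intro i; simp only [hx]; push_cast; ring
    have e : ∀ f : ℝ → ℝ, f t - f 0 = ∑ i ∈ Finset.range (n + 1), (f (x (i + 1)) - f (x i)) := by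
      intro f
      rw [Finset.sum_range_sub (fun i => f (x i)), hxn, hx0]
    have ek : k t - k 0 = ∑ i ∈ Finset.range (n + 1), (k (x (i + 1)) - k (x i)) := by
      rw [Finset.sum_range_sub (fun i => k (x i)), hxn, hx0]
    rw [ek, e b, e m]
    calc _ ≤ ∑ i ∈ Finset.range (n + 1), ((b (x (i + 1)) - b (x i)) +
          K * (t / N) * (m (x (i + 1)) - m (x i))) := by
          refine norm_sum_le_of_le _ fun i hi => ?_
          have hi' := Finset.mem_range.1 hi
          have := h (x i) (hxmem i (by omega)) (x (i + 1)) (hxmem _ (by omega))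
            (by have := hstep i; have : 0 ≤ t / N := by positivity
                linarith)
          rwa [hstep] at this
      _ = _ := by
          rw [Finset.sum_add_distrib, ← Finset.mul_sum]
          congr 1
          field_simp
  have hlim : Filter.Tendsto (fun n : ℕ => (b t - b 0) + K * t * (m t - m 0) *
      (1 / ((n : ℝ) + 1))) Filter.atTop (nhds ((b t - b 0) + K * t * (m t - m 0) * 0)) :=
    tendsto_const_nhds.add (tendsto_one_div_add_atTop_nhds_zero_nat.const_mul _)
  simpa using ge_of_tendsto' hlim hn

/-- A Duhamel inequality for a family `U` of functionals which solves `U' = U ∘ T + f` weakly,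
tested against a curve `Ψ` solving the adjoint equation `Ψ' = -TΨ`. -/
theorem norm_pairing_sub_le {X : Type*} [AddCommGroup X] [Module ℝ X] {T : X → X}
    {U f : ℝ → X → ℂ} {N₂ N : X → ℝ} {g : ℝ → ℝ} {M C t : ℝ} {Ψ : ℝ → X} (ht : 0 ≤ t)
    (hM : 0 ≤ M) (hC : 0 ≤ C) (hg0 : ∀ s, 0 ≤ g s) (hg : IntervalIntegrable g volume 0 t)
    (hlin : ∀ s ∈ Set.Icc 0 t, ∀ (x y z : X) (c : ℝ),
      U s (x - y + c • z) = U s x - U s y + c * U s z)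
    (hU : ∀ s ∈ Set.Icc 0 t, ∀ x, ‖U s x‖ ≤ M * N₂ x)
    (hf : ∀ᵐ s, s ∈ Set.Ioc 0 t → ∀ x, ‖f s x‖ ≤ g s * N x)
    (hUi : ∀ x, IntervalIntegrable (fun s => U s x) volume 0 t)
    (hfi : ∀ x, IntervalIntegrable (fun s => f s x) volume 0 t)
    (heq : ∀ s ∈ Set.Icc 0 t, ∀ s' ∈ Set.Icc 0 t, s ≤ s' → ∀ x,
      U s' x - U s x = ∫ σ in s..s', (U σ (T x) + f σ x))
    (hΨ₂ : ∀ s ∈ Set.Icc 0 t, ∀ s' ∈ Set.Icc 0 t, s ≤ s' →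
      N₂ (Ψ s' - Ψ s + (s' - s) • T (Ψ s')) ≤ C * (s' - s) ^ 2)
    (hΨ : ∀ s ∈ Set.Icc 0 t, ∀ s' ∈ Set.Icc 0 t, s ≤ s' →
      N (Ψ s') ≤ N (Ψ s) + C * (s' - s))
    (hΨc : ContinuousOn (fun s => N (Ψ s)) (Set.Icc 0 t))
    (hT₂ : ∀ s ∈ Set.Icc 0 t, N₂ (T (T (Ψ s))) ≤ C)
    (hT : ∀ s ∈ Set.Icc 0 t, N (T (Ψ s)) ≤ C) :
    ‖U t (Ψ t) - U 0 (Ψ 0)‖ ≤ ∫ s in (0 : ℝ)..t, g s * N (Ψ s) := by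
  set β : ℝ → ℝ := fun s => N (Ψ s) with hβ
  have hgβ : IntervalIntegrable (fun s => g s * β s) volume 0 t := by
    refine hg.mul_continuousOn ?_
    rwa [Set.uIcc_of_le ht]
  have h0t : (0 : ℝ) ∈ Set.Icc 0 t := ⟨le_rfl, ht⟩
  have h1g : IntervalIntegrable (fun s => 1 + g s) volume 0 t := intervalIntegrable_const.add hg
  have sub : ∀ {h : ℝ → ℝ}, IntervalIntegrable h volume 0 t → ∀ s ∈ Set.Icc 0 t, ∀ s' ∈ Set.Icc 0 t,
      IntervalIntegrable h volume s s' := fun hh s hs s' hs' =>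
    hh.mono_set (by rw [Set.uIcc_of_le ht]; exact Set.uIcc_subset_Icc hs hs')
  have subc : ∀ {h : ℝ → ℂ}, IntervalIntegrable h volume 0 t → ∀ s ∈ Set.Icc 0 t, ∀ s' ∈ Set.Icc 0 t,
      IntervalIntegrable h volume s s' := fun hh s hs s' hs' =>
    hh.mono_set (by rw [Set.uIcc_of_le ht]; exact Set.uIcc_subset_Icc hs hs')
  -- The increments of this function dominate both the elapsed time and the integral of g, so one
  -- quantity measures all the errors.
  set m : ℝ → ℝ := fun x => ∫ s in (0 : ℝ)..x, (1 + g s) with hm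
  have hmsub : ∀ s ∈ Set.Icc 0 t, ∀ s' ∈ Set.Icc 0 t, m s' - m s = ∫ σ in s..s', (1 + g σ) :=
    fun s hs s' hs' => intervalIntegral.integral_interval_sub_left (sub h1g _ h0t _ hs')
      (sub h1g _ h0t _ hs)
  have hmle : ∀ s ∈ Set.Icc 0 t, ∀ s' ∈ Set.Icc 0 t, s ≤ s' → s' - s ≤ m s' - m s := by
    intro s hs s' hs' hss
    rw [hmsub s hs s' hs']
    calc s' - s = ∫ _ in s..s', (1 : ℝ) := by simp
      _ ≤ _ := intervalIntegral.integral_mono_on hss intervalIntegrable_const (sub h1g _ hs _ hs')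
        fun x _ => by linarith [hg0 x]
  have hgle : ∀ s ∈ Set.Icc 0 t, ∀ s' ∈ Set.Icc 0 t, s ≤ s' → ∫ σ in s..s', g σ ≤ m s' - m s := by
    intro s hs s' hs' hss
    rw [hmsub s hs s' hs']
    exact intervalIntegral.integral_mono_on hss (sub hg _ hs _ hs') (sub h1g _ hs _ hs')
        fun x _ => by linarith
  have hfab : ∀ s ∈ Set.Icc 0 t, ∀ s' ∈ Set.Icc 0 t, ∀ᵐ σ, σ ∈ Set.Ioc s s' →
      ∀ x, ‖f σ x‖ ≤ g σ * N x := by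
    intro s hs s' hs'
    filter_upwards [hf] with σ hσ hmem
    exact hσ ⟨hs.1.trans_lt hmem.1, hmem.2.trans hs'.2⟩
  refine (norm_sub_le_of_increment_le (k := fun s => U s (Ψ s))
    (b := fun x => ∫ s in (0 : ℝ)..x, g s * β s) (m := m) (K := (M + 1) * C + M * C + C) ht ?_).trans
    (by simp [hβ])
  intro s hs s' hs' hss
  have hδ : 0 ≤ s' - s := by linarith
  set Δ := m s' - m s with hΔ
  have hΔ0 : s' - s ≤ Δ := hmle s hs s' hs' hss
  rw [intervalIntegral.integral_interval_sub_left (sub hgβ _ h0t _ hs') (sub hgβ _ h0t _ hs)]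
  -- Using the equation a second time, tested against TΨ(s'), controls the change of U over the
  -- step; this is where bounds on T(TΨ) and on N(TΨ) are needed.
  have t1 : ‖∫ σ in s..s', (U σ (T (Ψ s')) - U s (T (Ψ s')))‖ ≤ (M + 1) * C * Δ * |s' - s| := by
    refine intervalIntegral.norm_integral_le_of_norm_le_const fun σ hσ => ?_
    rw [Set.uIoc_of_le hss] at hσ
    have hσI : σ ∈ Set.Icc 0 t := ⟨hs.1.trans hσ.1.le, hσ.2.trans hs'.2⟩
    rw [heq s hs σ hσI hσ.1.le]
    have : ‖∫ σ in s..σ, (U σ (T (T (Ψ s'))) + f σ (T (Ψ s')))‖ ≤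
        ∫ x in s..σ, (M + 1) * C * (1 + g x) := by
      refine intervalIntegral.norm_integral_le_of_norm_le hσ.1.le ?_
        ((sub h1g _ hs _ hσI).const_mul _)
      filter_upwards [hfab s hs σ hσI] with x hx hxm
      have hxI : x ∈ Set.Icc 0 t := ⟨hs.1.trans hxm.1.le, hxm.2.trans hσI.2⟩
      calc _ ≤ M * C + g x * C := by
            refine (norm_add_le _ _).trans (add_le_add ?_ ?_)
            · exact (hU x hxI _).trans (by gcongr; exact hT₂ s' hs')
            · exact (hx hxm _).trans (mul_le_mul_of_nonneg_left (hT s' hs') (hg0 x))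
        _ ≤ (M + 1) * C * (1 + g x) := by
            have := hg0 x
            have h1 : 0 ≤ M * C * g x := by positivity
            nlinarith
    refine this.trans ?_
    rw [intervalIntegral.integral_const_mul, ← hmsub s hs σ hσI]
    gcongr
    rw [hΔ]
    have := hmle σ hσI s' hs' hσ.2
    linarith [hσ.2]
  have t2 : ‖U s (Ψ s' - Ψ s + (s' - s) • T (Ψ s'))‖ ≤ M * C * ((s' - s) * Δ) := by
    refine (hU s hs _).trans ?_
    rw [mul_assoc]
    refine mul_le_mul_of_nonneg_left ((hΨ₂ s hs s' hs' hss).trans ?_) hM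
    rw [sq]
    gcongr
  have t3 : ‖∫ σ in s..s', f σ (Ψ s')‖ ≤ (∫ σ in s..s', g σ * β σ) + C * (s' - s) * Δ := by
    have : ‖∫ σ in s..s', f σ (Ψ s')‖ ≤ ∫ σ in s..s', (g σ * β σ + C * (s' - s) * g σ) := by
      refine intervalIntegral.norm_integral_le_of_norm_le hss ?_
        ((sub hgβ _ hs _ hs').add ((sub hg _ hs _ hs').const_mul _))
      filter_upwards [hfab s hs s' hs'] with x hx hxm
      have hxI : x ∈ Set.Icc 0 t := ⟨hs.1.trans hxm.1.le, hxm.2.trans hs'.2⟩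
      have h1 := hΨ x hxI s' hs' hxm.2
      have h2 : C * (s' - x) ≤ C * (s' - s) := by gcongr; exact hxm.1.le
      calc _ ≤ g x * N (Ψ s') := hx hxm _
        _ ≤ g x * (β x + C * (s' - s)) := mul_le_mul_of_nonneg_left (by simp only [hβ]; linarith) (hg0 x)
        _ = _ := by ring
    refine this.trans ?_
    rw [intervalIntegral.integral_add (sub hgβ _ hs _ hs') ((sub hg _ hs _ hs').const_mul _),
      intervalIntegral.integral_const_mul]
    gcongr
    exact hgle s hs s' hs' hss
  -- The term U_s(TΨ(s'))(s'-s) is added and subtracted: the drift of U cancels the first-order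
  -- change of Ψ up to its Taylor remainder, and the forcing remains.
  have key : U s' (Ψ s') - U s (Ψ s) = (∫ σ in s..s', (U σ (T (Ψ s')) - U s (T (Ψ s')))) +
      U s (Ψ s' - Ψ s + (s' - s) • T (Ψ s')) + ∫ σ in s..s', f σ (Ψ s') := by
    rw [hlin s hs, intervalIntegral.integral_sub (subc (hUi _) _ hs _ hs') intervalIntegrable_const,
      intervalIntegral.integral_const]
    have := heq s hs s' hs' hss (Ψ s')
    rw [intervalIntegral.integral_add (subc (hUi _) _ hs _ hs') (subc (hfi _) _ hs _ hs')] at this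
    have h2 : U s' (Ψ s') = U s (Ψ s') + (U s' (Ψ s') - U s (Ψ s')) := by ring
    rw [h2, this]
    simp only [Complex.real_smul]
    push_cast
    ring
  rw [key]
  refine (norm_add₃_le).trans ?_
  rw [abs_of_nonneg hδ] at t1
  nlinarith [t1, t2, t3]

/-! ### The linear flow and the propagator on the Fourier side -/

lemma hasTemperateGrowth_cexp_mul_I :
    (fun s : ℝ => Complex.exp (s * Complex.I)).HasTemperateGrowth := by
  have hd : ∀ s : ℝ, HasDerivAt (fun s : ℝ => Complex.exp (s * Complex.I))
      (Complex.I * Complex.exp (s * Complex.I)) s := by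
    intro s
    have h1 : HasDerivAt (fun s : ℝ => (s : ℂ) * Complex.I) (1 * Complex.I) s :=
      (Complex.ofRealCLM.hasDerivAt (x := s)).mul_const Complex.I
    have := h1.cexp
    rwa [one_mul, mul_comm] at this
  have hcd : ContDiff ℝ ∞ (fun s : ℝ => Complex.exp (s * Complex.I)) :=
    (Complex.ofRealCLM.contDiff.mul contDiff_const).cexp
  have hn : ∀ n : ℕ, iteratedDeriv n (fun s : ℝ => Complex.exp (s * Complex.I)) =
      fun s : ℝ => Complex.I ^ n * Complex.exp (s * Complex.I) := by
    intro n
    induction n with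
    | zero => simp
    | succ n ih =>
      rw [iteratedDeriv_succ, ih]
      ext s
      rw [((hd s).const_mul (Complex.I ^ n)).deriv, pow_succ, mul_assoc]
  refine ⟨hcd, fun n => ⟨0, 1, fun s => ?_⟩⟩
  rw [norm_iteratedFDeriv_eq_norm_iteratedDeriv, hn]
  simp [Complex.norm_exp_ofReal_mul_I]

section Flow

variable {V : Type*} [NormedAddCommGroup V] [InnerProductSpace ℝ V] [FiniteDimensional ℝ V]

lemma exp_smul_mul_exp_smul (A : V →L[ℝ] V) (s t : ℝ) :
    NormedSpace.exp (s • A) * NormedSpace.exp (t • A) = NormedSpace.exp ((s + t) • A) := by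
  let _ : NormedAlgebra ℚ (V →L[ℝ] V) := NormedAlgebra.restrictScalars ℚ ℝ _
  rw [add_smul, NormedSpace.exp_add_of_commute ((Commute.refl A).smul_left s |>.smul_right t)]

/-- The linear flow `e^{sA}`. -/
noncomputable def flow (A : V →L[ℝ] V) (s : ℝ) : V ≃L[ℝ] V :=
  ContinuousLinearEquiv.equivOfInverse (NormedSpace.exp (s • A)) (NormedSpace.exp ((-s) • A))
    (fun ξ => by
      rw [← mul_apply_eq_comp, exp_smul_mul_exp_smul]; simp)
    (fun ξ => by
      rw [← mul_apply_eq_comp, exp_smul_mul_exp_smul]; simp)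

lemma flow_apply (A : V →L[ℝ] V) (s : ℝ) (ξ : V) : flow A s ξ = NormedSpace.exp (s • A) ξ := rfl

lemma coe_flow (A : V →L[ℝ] V) (s : ℝ) : (flow A s : V →L[ℝ] V) = NormedSpace.exp (s • A) := rfl

lemma flow_add_apply (A : V →L[ℝ] V) (s t : ℝ) (ξ : V) :
    flow A (s + t) ξ = flow A s (flow A t ξ) := by
  simp only [flow_apply]
  rw [← mul_apply_eq_comp, exp_smul_mul_exp_smul]

@[simp] lemma flow_zero_apply (A : V →L[ℝ] V) (ξ : V) : flow A 0 ξ = ξ := by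
  simp [flow_apply]

lemma flow_neg_flow (A : V →L[ℝ] V) (s : ℝ) (ξ : V) : flow A (-s) (flow A s ξ) = ξ := by
  rw [← flow_add_apply]; simp

lemma hasDerivAt_flow (A : V →L[ℝ] V) (s : ℝ) (ξ : V) :
    HasDerivAt (fun s => flow A s ξ) (A (flow A s ξ)) s := by
  have h := hasDerivAt_exp_smul_const' (𝕂 := ℝ) A s
  exact ((ContinuousLinearMap.apply ℝ V ξ).hasFDerivAt.comp_hasDerivAt s h)

lemma continuous_exp_smul (A : V →L[ℝ] V) :
    Continuous fun s : ℝ => NormedSpace.exp (s • A) :=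
  continuous_iff_continuousAt.2 fun s => (hasDerivAt_exp_smul_const' (𝕂 := ℝ) A s).continuousAt

lemma continuous_flow (A : V →L[ℝ] V) (ξ : V) : Continuous fun s => flow A s ξ :=
  continuous_iff_continuousAt.2 fun s => (hasDerivAt_flow A s ξ).continuousAt

lemma exists_norm_flow_le (A : V →L[ℝ] V) (T : ℝ) :
    ∃ K : ℝ, 1 ≤ K ∧ ∀ s, |s| ≤ T → ∀ ξ, ‖ξ‖ ≤ K * ‖flow A s ξ‖ := by
  obtain ⟨K, hK⟩ := (isCompact_Icc (a := -T) (b := T)).exists_bound_of_continuousOn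
    (continuous_exp_smul A).continuousOn
  refine ⟨max K 1, le_max_right _ _, fun s hs ξ => ?_⟩
  nth_rewrite 1 [← flow_neg_flow A s ξ]
  rw [flow_apply A (-s)]
  refine (ContinuousLinearMap.le_opNorm _ _).trans ?_
  gcongr
  exact (hK (-s) (by rw [abs_le] at hs; constructor <;> linarith)).trans (le_max_left _ _)

/-- In a basis the determinant is multilinear in the rows. Its derivative at the identity sums the
determinants with one row replaced by that of A, and Cramer's rule for the identity evaluates each
as a diagonal entry. -/
lemma hasDerivAt_det_exp_zero (A : V →L[ℝ] V) :
    HasDerivAt (fun s : ℝ => LinearMap.det (NormedSpace.exp (s • A) : V →L[ℝ] V).toLinearMap)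
      (LinearMap.trace ℝ V A) 0 := by
  let b := Module.finBasis ℝ V
  let D : ContinuousMultilinearMap ℝ (fun _ : Fin (Module.finrank ℝ V) =>
      Fin (Module.finrank ℝ V) → ℝ) ℝ :=
    ⟨(Matrix.detRowAlternating).toMultilinearMap, by
      exact (continuous_id (X := Matrix (Fin (Module.finrank ℝ V)) (Fin (Module.finrank ℝ V)) ℝ)).matrix_det⟩
  let L : (V →L[ℝ] V) →ₗ[ℝ] (Fin (Module.finrank ℝ V) → Fin (Module.finrank ℝ V) → ℝ) :=
    (LinearMap.toMatrix b b).toLinearMap ∘ₗ ContinuousLinearMap.coeLM ℝ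
  have hL : ∀ f : V →L[ℝ] V, LinearMap.det f.toLinearMap = D (L f) := fun f =>
    (LinearMap.det_toMatrix b f.toLinearMap).symm
  have h1 : HasDerivAt (fun s : ℝ => L (NormedSpace.exp (s • A))) (L A) 0 := by
    have h := hasDerivAt_exp_smul_const' (𝕂 := ℝ) A 0
    have h2 := (L.toContinuousLinearMap).hasFDerivAt.comp_hasDerivAt (0 : ℝ) h
    rw [zero_smul, NormedSpace.exp_zero, mul_one] at h2
    exact h2
  have h2 := (D.hasFDerivAt (L 1)).comp_hasDerivAt_of_eq (0 : ℝ) h1 (by simp)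
  have h3 : D.linearDeriv (L 1) (L A) = LinearMap.trace ℝ V A := by
    rw [ContinuousMultilinearMap.linearDeriv_apply, LinearMap.trace_eq_matrix_trace ℝ b,
      Matrix.trace]
    refine Finset.sum_congr rfl fun i _ => ?_
    have h4 : L 1 = (1 : Matrix _ _ ℝ) := LinearMap.toMatrix_one b
    rw [h4]
    have h5 := Matrix.cramer_transpose_apply (1 : Matrix (Fin (Module.finrank ℝ V))
      (Fin (Module.finrank ℝ V)) ℝ) (L A i) i
    rw [Matrix.transpose_one, Matrix.cramer_one] at h5
    exact h5.symm
  rw [h3] at h2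
  refine h2.congr_of_eventuallyEq (.of_forall fun s => ?_)
  exact hL _

/-- Multiplicativity of the determinant propagates the derivative at 0 to every time, giving δ' = δ
tr A; then δ e^{-s tr A} is constant. -/
lemma det_flow (A : V →L[ℝ] V) (s : ℝ) :
    LinearMap.det (flow A s : V →L[ℝ] V).toLinearMap =
      Real.exp (s * LinearMap.trace ℝ V A) := by
  set τ := LinearMap.trace ℝ V A
  set δ : ℝ → ℝ := fun s => LinearMap.det (NormedSpace.exp (s • A) : V →L[ℝ] V).toLinearMap with hδ
  have hmul : ∀ a b, δ (a + b) = δ a * δ b := by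
    intro a b
    simp only [hδ]
    rw [← LinearMap.det_comp, ← exp_smul_mul_exp_smul]
    rfl
  have h0 : δ 0 = 1 := by
    simp only [hδ, zero_smul, NormedSpace.exp_zero]
    exact LinearMap.det_id
  have hd : ∀ s, HasDerivAt δ (δ s * τ) s := by
    intro s
    have h1 : HasDerivAt (fun x => δ (x - s)) τ s := by
      have := hasDerivAt_det_exp_zero A
      rw [← sub_self s] at this
      exact this.comp_sub_const s s
    refine (h1.const_mul (δ s)).congr_of_eventuallyEq (.of_forall fun x => ?_)
    dsimp only
    rw [← hmul]
    congr 1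
    ring
  have hc : ∀ s, HasDerivAt (fun s => δ s * Real.exp (-(s * τ))) 0 s := by
    intro s
    have h1 : HasDerivAt (fun s => Real.exp (-(s * τ))) (Real.exp (-(s * τ)) * (-(1 * τ))) s :=
      (((hasDerivAt_id s).mul_const τ).neg).exp
    convert! (hd s).mul h1 using 1
    ring
  have := is_const_of_deriv_eq_zero (fun s => (hc s).differentiableAt) (fun s => (hc s).deriv) s 0
  simp only [h0, zero_mul, neg_zero, Real.exp_zero, mul_one] at this
  rw [coe_flow]
  change δ s = _
  rw [Real.exp_neg] at this
  field_simp at this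
  exact this

end Flow

section Propagator

variable {V : Type*} [NormedAddCommGroup V] [InnerProductSpace ℝ V] [FiniteDimensional ℝ V]

/-- The quadratic form `∫₀ˢ ⟨q e^{σA}ξ, e^{σA}ξ⟩ dσ`. -/
noncomputable def flowQuad (A q : V →L[ℝ] V) (s : ℝ) (ξ : V) : ℝ :=
  ∫ σ in (0 : ℝ)..s, inner ℝ (q (flow A σ ξ)) (flow A σ ξ)

lemma continuous_flowQuad_integrand (A q : V →L[ℝ] V) (ξ : V) :
    Continuous fun σ => inner ℝ (q (flow A σ ξ)) (flow A σ ξ) :=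
  (q.continuous.comp (continuous_flow A ξ)).inner (continuous_flow A ξ)

lemma hasDerivAt_flowQuad (A q : V →L[ℝ] V) (s : ℝ) (ξ : V) :
    HasDerivAt (fun s => flowQuad A q s ξ) (inner ℝ (q (flow A s ξ)) (flow A s ξ)) s :=
  (continuous_flowQuad_integrand A q ξ).integral_hasStrictDerivAt 0 s |>.hasDerivAt

/-- The cocycle identity behind the group law of `propagator`; with opposite times it also converts
negative times into positive ones. -/
lemma flowQuad_add (A q : V →L[ℝ] V) (s t : ℝ) (ξ : V) :
    flowQuad A q (s + t) ξ = flowQuad A q s (flow A t ξ) + flowQuad A q t ξ := by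
  have hi := fun a b => (continuous_flowQuad_integrand A q ξ).intervalIntegrable
    (μ := volume) a b
  rw [flowQuad, ← intervalIntegral.integral_add_adjacent_intervals (hi 0 t) (hi t (s + t)), add_comm]
  congr 1
  rw [flowQuad]
  simp only [← flow_add_apply]
  have := intervalIntegral.integral_comp_add_right (a := 0) (b := s)
    (fun σ => inner ℝ (q (flow A σ ξ)) (flow A σ ξ)) t
  rw [this, zero_add]

lemma flowQuad_zero (A q : V →L[ℝ] V) (ξ : V) : flowQuad A q 0 ξ = 0 := by
  simp [flowQuad]

/-- Integrating the operators rather than the scalars exhibits the form as ⟨Gξ, ξ⟩ with one fixed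
operator G, hence as a bounded bilinear expression. -/
lemma hasTemperateGrowth_flowQuad (A q : V →L[ℝ] V) (s : ℝ) :
    (flowQuad A q s).HasTemperateGrowth := by
  have hc : Continuous fun σ : ℝ =>
      (ContinuousLinearMap.adjoint (NormedSpace.exp (σ • A))) ∘L (q ∘L NormedSpace.exp (σ • A)) :=
    ((ContinuousLinearMap.adjoint (𝕜 := ℝ) (E := V) (F := V)).continuous.comp
      (continuous_exp_smul A)).clm_comp (continuous_const.clm_comp (continuous_exp_smul A))
  set G : V →L[ℝ] V := ∫ σ in (0 : ℝ)..s,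
      (ContinuousLinearMap.adjoint (NormedSpace.exp (σ • A))) ∘L (q ∘L NormedSpace.exp (σ • A)) with hG
  have hq : flowQuad A q s = fun ξ => inner ℝ (G ξ) ξ := by
    ext ξ
    rw [hG, ContinuousLinearMap.intervalIntegral_apply (hc.intervalIntegrable _ _), real_inner_comm]
    have := (innerSL ℝ ξ).intervalIntegral_comp_comm (μ := volume) (a := 0) (b := s)
      (f := fun σ => ((ContinuousLinearMap.adjoint (NormedSpace.exp (σ • A))) ∘L
        (q ∘L NormedSpace.exp (σ • A))) ξ)
      ((hc.clm_apply continuous_const).intervalIntegrable _ _)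
    simp only [innerSL_apply_apply] at this
    rw [← this, flowQuad]
    congr 1
    ext σ
    simp only [ContinuousLinearMap.comp_apply]
    rw [ContinuousLinearMap.adjoint_inner_right, real_inner_comm]
    rfl
  rw [hq]
  exact (innerSL ℝ).bilinear_hasTemperateGrowth G.hasTemperateGrowth .id'

lemma hasTemperateGrowth_flowSymbol (A q : V →L[ℝ] V) (s : ℝ) :
    (fun ξ => Complex.exp ((-(4 * Real.pi ^ 2 * flowQuad A q s ξ) : ℝ) *
      Complex.I)).HasTemperateGrowth :=
  hasTemperateGrowth_cexp_mul_I.comp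
    (((Function.HasTemperateGrowth.const (4 * Real.pi ^ 2)).mul
      (hasTemperateGrowth_flowQuad A q s)).neg)

/-- The propagator on the Fourier side. -/
noncomputable def propagator (A q : V →L[ℝ] V) (s : ℝ) (η : SchwartzMap V ℂ) : SchwartzMap V ℂ :=
  SchwartzMap.smulLeftCLM ℂ
    (fun ξ => Complex.exp ((-(4 * Real.pi ^ 2 * flowQuad A q s ξ) : ℝ) * Complex.I))
    (SchwartzMap.compCLMOfContinuousLinearEquiv ℂ (flow A s) η)

lemma propagator_apply (A q : V →L[ℝ] V) (s : ℝ) (η : SchwartzMap V ℂ) (ξ : V) :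
    propagator A q s η ξ =
      Complex.exp ((-(4 * Real.pi ^ 2 * flowQuad A q s ξ) : ℝ) * Complex.I) * η (flow A s ξ) := by
  rw [propagator, SchwartzMap.smulLeftCLM_apply_apply (hasTemperateGrowth_flowSymbol A q s)]
  rfl

lemma norm_propagator_apply (A q : V →L[ℝ] V) (s : ℝ) (η : SchwartzMap V ℂ) (ξ : V) :
    ‖propagator A q s η ξ‖ = ‖η (flow A s ξ)‖ := by
  rw [propagator_apply, norm_mul, Complex.norm_exp_ofReal_mul_I, one_mul]

lemma propagator_add (A q : V →L[ℝ] V) (s t : ℝ) (η : SchwartzMap V ℂ) :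
    propagator A q (s + t) η = propagator A q t (propagator A q s η) := by
  ext ξ
  rw [propagator_apply, propagator_apply, propagator_apply, ← mul_assoc, ← Complex.exp_add,
    flow_add_apply, flowQuad_add]
  congr 2
  push_cast
  ring

lemma propagator_zero (A q : V →L[ℝ] V) (η : SchwartzMap V ℂ) : propagator A q 0 η = η := by
  ext ξ
  rw [propagator_apply, flowQuad_zero, flow_zero_apply]
  simp

lemma hasTemperateGrowth_quadSymbol (q : V →L[ℝ] V) :
    (fun ξ => ((-(4 * Real.pi ^ 2 * inner ℝ (q ξ) ξ) : ℝ) : ℂ) * Complex.I).HasTemperateGrowth := by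
  have h1 : (fun ξ => (inner ℝ (q ξ) ξ : ℝ)).HasTemperateGrowth :=
    (innerSL ℝ).bilinear_hasTemperateGrowth q.hasTemperateGrowth .id'
  exact (Function.Complex.hasTemperateGrowth_ofReal.comp
    (((Function.HasTemperateGrowth.const (4 * Real.pi ^ 2)).mul h1).neg)).mul (.const Complex.I)

/-- The generator of the propagator on the Fourier side. -/
noncomputable def generator (A q : V →L[ℝ] V) (η : SchwartzMap V ℂ) : SchwartzMap V ℂ :=
  SchwartzMap.smulLeftCLM ℂ
    (fun ξ => ((-(4 * Real.pi ^ 2 * inner ℝ (q ξ) ξ) : ℝ) : ℂ) * Complex.I) η +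
  SchwartzMap.bilinLeftCLM (ContinuousLinearMap.id ℝ (V →L[ℝ] ℂ)) A.hasTemperateGrowth
    (SchwartzMap.fderivCLM ℝ V ℂ η)

lemma generator_apply (A q : V →L[ℝ] V) (η : SchwartzMap V ℂ) (ξ : V) :
    generator A q η ξ = ((-(4 * Real.pi ^ 2 * inner ℝ (q ξ) ξ) : ℝ) : ℂ) * Complex.I * η ξ +
      fderiv ℝ η ξ (A ξ) := by
  rw [generator, add_apply, SchwartzMap.smulLeftCLM_apply_apply (hasTemperateGrowth_quadSymbol q)]
  rfl

lemma hasDerivAt_propagator (A q : V →L[ℝ] V) (s : ℝ) (η : SchwartzMap V ℂ) (ξ : V) :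
    HasDerivAt (fun s => propagator A q s η ξ) (propagator A q s (generator A q η) ξ) s := by
  simp only [propagator_apply, generator_apply]
  have h1 : HasDerivAt (fun s => ((-(4 * Real.pi ^ 2 * flowQuad A q s ξ) : ℝ) : ℂ) * Complex.I)
      (((-(4 * Real.pi ^ 2 * inner ℝ (q (flow A s ξ)) (flow A s ξ)) : ℝ) : ℂ) * Complex.I) s :=
    ((((hasDerivAt_flowQuad A q s ξ).const_mul (4 * Real.pi ^ 2)).neg).ofReal_comp).mul_const _
  have h2 : HasDerivAt (fun s => η (flow A s ξ)) (fderiv ℝ η (flow A s ξ) (A (flow A s ξ))) s :=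
    (η.hasFDerivAt (flow A s ξ)).comp_hasDerivAt s (hasDerivAt_flow A s ξ)
  convert! h1.cexp.mul h2 using 1
  ring

/-- Differentiate the group law at time s in two ways: as the evolution at time 0 of the profile
already evolved to s, and as the derivative at s of the original evolution. Uniqueness of
derivatives gives the commutation. -/
lemma generator_propagator (A q : V →L[ℝ] V) (s : ℝ) (η : SchwartzMap V ℂ) :
    generator A q (propagator A q s η) = propagator A q s (generator A q η) := by
  ext ξ
  have h1 := hasDerivAt_propagator A q 0 (propagator A q s η) ξ
  rw [propagator_zero] at h1
  have h2 : HasDerivAt (fun t => propagator A q (s + t) η ξ)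
      (propagator A q (s + 0) (generator A q η) ξ) 0 :=
    (hasDerivAt_propagator A q (s + 0) η ξ).comp_const_add s 0
  rw [add_zero] at h2
  simp only [propagator_add] at h2
  exact h1.unique h2

end Propagator

/-! ### Locally uniform bounds for the propagator -/

section Estimates

variable {V : Type*} [NormedAddCommGroup V] [InnerProductSpace ℝ V] [FiniteDimensional ℝ V]

/-- The phase is unimodular and, for bounded times, the flow distorts ‖ξ‖ at most by a constant
factor, so the decay of ζ survives. Time derivatives of the propagator only replace η by its
generator, so the difference and Taylor bounds below rest on this one. -/
lemma exists_norm_propagator_le (A q : V →L[ℝ] V) (ζ : SchwartzMap V ℂ) (T : ℝ) (k : ℕ) :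
    ∃ C : ℝ, 0 ≤ C ∧ ∀ s, |s| ≤ T → ∀ ξ,
      ‖propagator A q s ζ ξ‖ ≤ C * (1 + ‖ξ‖) ^ (-k : ℝ) := by
  obtain ⟨K, hK1, hK⟩ := exists_norm_flow_le A T
  set S : ℝ := 2 ^ k * ((Finset.Iic (k, 0)).sup (schwartzSeminormFamily ℝ V ℂ)) ζ
  have hS0 : 0 ≤ S := by positivity
  have hS : ∀ x, (1 + ‖x‖) ^ k * ‖ζ x‖ ≤ S := fun x => by
    have := SchwartzMap.one_add_le_sup_seminorm_apply (𝕜 := ℝ) (m := (k, 0)) le_rfl le_rfl ζ x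
    rwa [norm_iteratedFDeriv_zero] at this
  refine ⟨K ^ k * S, by positivity, fun s hs ξ => ?_⟩
  rw [norm_propagator_apply, Real.rpow_neg (by positivity), Real.rpow_natCast, ← div_eq_mul_inv,
    le_div_iff₀ (by positivity)]
  have h1 : 1 + ‖ξ‖ ≤ K * (1 + ‖flow A s ξ‖) := by nlinarith [hK s hs ξ]
  calc _ ≤ ‖ζ (flow A s ξ)‖ * (K * (1 + ‖flow A s ξ‖)) ^ k := by gcongr
    _ = K ^ k * ((1 + ‖flow A s ξ‖) ^ k * ‖ζ (flow A s ξ)‖) := by rw [mul_pow]; ring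
    _ ≤ _ := by gcongr; exact hS _

lemma exists_norm_propagator_sub_le (A q : V →L[ℝ] V) (η : SchwartzMap V ℂ) (T : ℝ) (k : ℕ) :
    ∃ C : ℝ, 0 ≤ C ∧ ∀ a b, |a| ≤ T → |b| ≤ T → ∀ ξ,
      ‖propagator A q b η ξ - propagator A q a η ξ‖ ≤ C * |b - a| * (1 + ‖ξ‖) ^ (-k : ℝ) := by
  obtain ⟨C, hC, h⟩ := exists_norm_propagator_le A q (generator A q η) T k
  refine ⟨C, hC, fun a b ha hb ξ => ?_⟩
  have := (convex_Icc (-T) T).norm_image_sub_le_of_norm_hasDerivWithin_le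
    (f := fun s => propagator A q s η ξ) (fun s _ => (hasDerivAt_propagator A q s η ξ).hasDerivWithinAt)
    (fun s hs => h s (abs_le.2 hs) ξ) (abs_le.1 ha) (abs_le.1 hb)
  refine this.trans (le_of_eq ?_)
  rw [Real.norm_eq_abs]
  ring

/-- Mean value inequality for the propagator minus its linear part with slope frozen at time a; the
derivative of that difference is O(|b-a|) by the Lipschitz bound for the generator's profile. -/
lemma exists_norm_propagator_taylor_le (A q : V →L[ℝ] V) (η : SchwartzMap V ℂ) (T : ℝ) (k : ℕ) :
    ∃ C : ℝ, 0 ≤ C ∧ ∀ a b, |a| ≤ T → |b| ≤ T → ∀ ξ,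
      ‖propagator A q a η ξ - propagator A q b η ξ +
        (b - a : ℝ) * propagator A q a (generator A q η) ξ‖ ≤
        C * (b - a) ^ 2 * (1 + ‖ξ‖) ^ (-k : ℝ) := by
  obtain ⟨C, hC, h⟩ := exists_norm_propagator_sub_le A q (generator A q η) T k
  refine ⟨C, hC, fun a b ha hb ξ => ?_⟩
  have := (convex_uIcc a b).norm_image_sub_le_of_norm_hasDerivWithin_le
    (f := fun s : ℝ => propagator A q s η ξ - (s : ℂ) * propagator A q a (generator A q η) ξ)
    (C := C * |b - a| * (1 + ‖ξ‖) ^ (-k : ℝ))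
    (fun s _ => ((hasDerivAt_propagator A q s η ξ).sub
      ((Complex.ofRealCLM.hasDerivAt (x := s)).mul_const _)).hasDerivWithinAt)
    (fun s hs => ?_) Set.left_mem_uIcc Set.right_mem_uIcc
  · rw [← norm_neg]
    refine (le_of_eq ?_).trans (this.trans (le_of_eq ?_))
    · congr 1
      push_cast
      ring
    · rw [Real.norm_eq_abs, ← sq_abs]
      ring
  · have hs' : |s| ≤ T := by
      rw [abs_le] at ha hb ⊢
      exact Set.uIcc_subset_Icc ha hb hs
    simp only [Complex.ofRealCLM_apply, Complex.ofReal_one, one_mul]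
    refine (h a s ha hs' ξ).trans ?_
    exact mul_le_mul_of_nonneg_right (mul_le_mul_of_nonneg_left
      (Set.abs_sub_left_of_mem_uIcc hs) hC) (by positivity)

variable [MeasurableSpace V] [BorelSpace V]

/-- By Plancherel, pointwise decay of the profile controls the L² norm of its transform;
Hausdorff-Young does the same for L^r in the next lemma. Thus pointwise bounds on the Fourier side
suffice to control the evolved test functions. -/
lemma exists_eLpNorm_fourier_two_le :
    ∃ (k : ℕ) (c : ℝ), 0 ≤ c ∧ ∀ (y : SchwartzMap V ℂ) (ε : ℝ), 0 ≤ ε →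
      (∀ ξ, ‖y ξ‖ ≤ ε * (1 + ‖ξ‖) ^ (-k : ℝ)) →
      (eLpNorm (𝓕 y : SchwartzMap V ℂ) 2).toReal ≤ c * ε := by
  obtain ⟨k, hk⟩ := Measure.HasTemperateGrowth.exists_eLpNorm_lt_top (E := V) 2
    (μ := volume) inferInstance
  refine ⟨k, (eLpNorm (fun ξ : V => (1 + ‖ξ‖) ^ (-k : ℝ)) 2).toReal, ENNReal.toReal_nonneg,
    fun y ε hε hy => ?_⟩
  have h1 := eLpNorm_le_mul_eLpNorm_of_ae_le_mul (p := 2) (μ := (volume : Measure V))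
    (f := y) (g := fun ξ : V => (1 + ‖ξ‖) ^ (-k : ℝ)) (c := ε) (.of_forall fun ξ => by
      rw [Real.norm_of_nonneg (by positivity)]; exact hy ξ)
  rw [SchwartzMap.fourier_coe, eLpNorm_fourier_two y.integrable (y.memLp 2 volume), mul_comm]
  refine (ENNReal.toReal_mono (ENNReal.mul_ne_top ENNReal.ofReal_ne_top hk.ne) h1).trans ?_
  rw [ENNReal.toReal_mul, ENNReal.toReal_ofReal hε]

lemma exists_eLpNorm_fourier_le {r p : ℝ} (hr : 2 < r) (hpr : p.HolderConjugate r) :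
    ∃ (k : ℕ) (c : ℝ), 0 ≤ c ∧ ∀ (y : SchwartzMap V ℂ) (ε : ℝ), 0 ≤ ε →
      (∀ ξ, ‖y ξ‖ ≤ ε * (1 + ‖ξ‖) ^ (-k : ℝ)) →
      (eLpNorm (𝓕 y : SchwartzMap V ℂ) (ENNReal.ofReal r)).toReal ≤ c * ε := by
  obtain ⟨k, hk⟩ := Measure.HasTemperateGrowth.exists_eLpNorm_lt_top (E := V) (ENNReal.ofReal p)
    (μ := volume) inferInstance
  set W := eLpNorm (fun ξ : V => (1 + ‖ξ‖) ^ (-k : ℝ)) (ENNReal.ofReal p)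
  set H := ENNReal.ofReal (hyConst r) ^ (1 / r)
  have hH : H ≠ ⊤ := ENNReal.rpow_ne_top_of_nonneg (by have := hr; positivity) ENNReal.ofReal_ne_top
  refine ⟨k, H.toReal * W.toReal, by positivity, fun y ε hε hy => ?_⟩
  have h1 := eLpNorm_le_mul_eLpNorm_of_ae_le_mul (p := ENNReal.ofReal p) (μ := (volume : Measure V))
    (f := y) (g := fun ξ : V => (1 + ‖ξ‖) ^ (-k : ℝ)) (c := ε) (.of_forall fun ξ => by
      rw [Real.norm_of_nonneg (by positivity)]; exact hy ξ)
  have h2 := eLpNorm_fourier_le hr hpr y.integrable (y.memLp 2 volume)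
  have h3 : eLpNorm (𝓕 y : SchwartzMap V ℂ) (ENNReal.ofReal r) ≤ H * (ENNReal.ofReal ε * W) := by
    rw [SchwartzMap.fourier_coe]
    exact h2.trans (by gcongr)
  refine (ENNReal.toReal_mono (ENNReal.mul_ne_top hH
    (ENNReal.mul_ne_top ENNReal.ofReal_ne_top hk.ne)) h3).trans ?_
  rw [ENNReal.toReal_mul, ENNReal.toReal_mul, ENNReal.toReal_ofReal hε]
  exact le_of_eq (by ring)

lemma integral_comp_equiv (E : V ≃L[ℝ] V) (g : V → ℂ) :
    ∫ ξ, g (E ξ) = ((|LinearMap.det (E : V →ₗ[ℝ] V)|⁻¹ : ℝ) : ℂ) * ∫ ξ, g ξ := by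
  have hd : LinearMap.det (E : V →ₗ[ℝ] V) ≠ 0 := (LinearEquiv.isUnit_det' E.toLinearEquiv).ne_zero
  have h2 : Measure.map E.toHomeomorph (volume : Measure V)
      = ENNReal.ofReal |(LinearMap.det (E : V →ₗ[ℝ] V))⁻¹| • volume :=
    Measure.map_linearMap_addHaar_eq_smul_addHaar volume hd
  have h := E.toHomeomorph.measurableEmbedding.integral_map (μ := (volume : Measure V)) g
  rw [h2, integral_smul_measure, ENNReal.toReal_ofReal (abs_nonneg _), abs_inv] at h
  rw [← Complex.real_smul]
  exact h.symm

/-- Pull out the common evolution to time s: the phases cancel and the change of variables by the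
flow leaves its Jacobian. The resulting failure of unitarity is exactly what the weight e^{t tr B/2}
repairs. -/
lemma inner_fourier_propagator (A q : V →L[ℝ] V) (t s : ℝ) (η ζ : SchwartzMap V ℂ) :
    (inner ℂ ((𝓕 (propagator A q t η) : SchwartzMap V ℂ).toLp 2)
      ((𝓕 (propagator A q s ζ) : SchwartzMap V ℂ).toLp 2) : ℂ) =
      (Real.exp (-(s * LinearMap.trace ℝ V A)) : ℂ) *
        inner ℂ ((𝓕 (propagator A q (t - s) η) : SchwartzMap V ℂ).toLp 2)
          ((𝓕 ζ : SchwartzMap V ℂ).toLp 2) := by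
  rw [SchwartzMap.inner_fourier_toL2_eq, SchwartzMap.inner_fourier_toL2_eq,
    SchwartzMap.inner_toL2_toL2_eq _ _ volume, SchwartzMap.inner_toL2_toL2_eq _ _ volume]
  have h1 : propagator A q t η = propagator A q s (propagator A q (t - s) η) := by
    rw [← propagator_add, sub_add_cancel]
  have h2 : ∀ ξ, (inner ℂ (propagator A q t η ξ) (propagator A q s ζ ξ) : ℂ) =
      (fun x => (inner ℂ (propagator A q (t - s) η x) (ζ x) : ℂ)) (flow A s ξ) := by
    intro ξ
    rw [h1, propagator_apply A q s, propagator_apply A q s ζ]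
    set c := Complex.exp ((-(4 * Real.pi ^ 2 * flowQuad A q s ξ) : ℝ) * Complex.I)
    have hc : (starRingEnd ℂ) c * c = 1 := by
      rw [mul_comm, Complex.mul_conj, Complex.normSq_eq_norm_sq, Complex.norm_exp_ofReal_mul_I]
      simp
    simp only [RCLike.inner_apply, map_mul]
    linear_combination ζ (flow A s ξ) * (starRingEnd ℂ) (propagator A q (t - s) η (flow A s ξ)) * hc
  simp_rw [h2]
  rw [integral_comp_equiv (flow A s) fun x => (inner ℂ (propagator A q (t - s) η x) (ζ x) : ℂ)]
  congr 2
  have h3 := det_flow A s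
  rw [Real.exp_neg, ← h3]
  congr 1
  rw [abs_of_pos]
  · rfl
  · change 0 < LinearMap.det ((flow A s : V →L[ℝ] V) : V →ₗ[ℝ] V)
    rw [h3]
    positivity

end Estimates

section DuhamelCurve

variable {V : Type*} [NormedAddCommGroup V] [InnerProductSpace ℝ V] [FiniteDimensional ℝ V]

/-- Uniform bounds along the propagator for a functional controlled by weighted sup norms. -/
lemma exists_propagator_bounds (A q : V →L[ℝ] V) (η : SchwartzMap V ℂ) (T : ℝ)
    {N : SchwartzMap V ℂ → ℝ} {k : ℕ} {c : ℝ} (hc : 0 ≤ c)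
    (hN : ∀ (y : SchwartzMap V ℂ) (ε : ℝ), 0 ≤ ε →
      (∀ ξ, ‖y ξ‖ ≤ ε * (1 + ‖ξ‖) ^ (-k : ℝ)) → N y ≤ c * ε) :
    ∃ C : ℝ, 0 ≤ C ∧ (∀ a, |a| ≤ T → N (propagator A q a η) ≤ C) ∧
      (∀ a b, |a| ≤ T → |b| ≤ T → N (propagator A q b η - propagator A q a η) ≤ C * |b - a|) ∧
      ∀ a b, |a| ≤ T → |b| ≤ T →
        N (propagator A q a η - propagator A q b η +
          ((b - a : ℝ) : ℂ) • propagator A q a (generator A q η)) ≤ C * (b - a) ^ 2 := by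
  obtain ⟨C₀, h₀, H₀⟩ := exists_norm_propagator_le A q η T k
  obtain ⟨C₁, h₁, H₁⟩ := exists_norm_propagator_sub_le A q η T k
  obtain ⟨C₂, h₂, H₂⟩ := exists_norm_propagator_taylor_le A q η T k
  refine ⟨c * C₀ + c * C₁ + c * C₂, by positivity, fun a ha => ?_, fun a b ha hb => ?_,
    fun a b ha hb => ?_⟩
  · refine (hN _ C₀ h₀ (H₀ a ha)).trans ?_
    have : 0 ≤ c * C₁ := by positivity
    have : 0 ≤ c * C₂ := by positivity
    linarith
  · refine (hN _ (C₁ * |b - a|) (by positivity) fun ξ => ?_).trans ?_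
    · rw [sub_apply]
      exact H₁ a b ha hb ξ
    · rw [← mul_assoc]
      gcongr
      have : 0 ≤ c * C₀ := by positivity
      have : 0 ≤ c * C₂ := by positivity
      linarith
  · refine (hN _ (C₂ * (b - a) ^ 2) (by positivity) fun ξ => ?_).trans ?_
    · rw [add_apply, sub_apply, smul_apply, smul_eq_mul]
      exact H₂ a b ha hb ξ
    · rw [← mul_assoc]
      gcongr
      have : 0 ≤ c * C₀ := by positivity
      have : 0 ≤ c * C₁ := by positivity
      linarith

end DuhamelCurve

/-! ### The Gramian and the dispersive estimate -/

section Matrices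

variable {ι : Type} [Fintype ι] [DecidableEq ι]

/-- The drift `Bᵀ` on the Fourier side. -/
noncomputable abbrev dualDrift (B : Matrix ι ι ℝ) : EuclideanSpace ℝ ι →L[ℝ] EuclideanSpace ℝ ι :=
  Matrix.toEuclideanCLM (𝕜 := ℝ) B.transpose

noncomputable abbrev diffusion (Q : Matrix ι ι ℝ) : EuclideanSpace ℝ ι →L[ℝ] EuclideanSpace ℝ ι :=
  Matrix.toEuclideanCLM (𝕜 := ℝ) Q

lemma det_toEuclideanCLM (M : Matrix ι ι ℝ) :
    LinearMap.det (Matrix.toEuclideanCLM (𝕜 := ℝ) M : EuclideanSpace ℝ ι →L[ℝ] EuclideanSpace ℝ ι).toLinearMap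
      = M.det := by
  rw [Matrix.coe_toEuclideanCLM_eq_toEuclideanLin, Matrix.toEuclideanLin_eq_toLin_orthonormal,
    LinearMap.det_toLin]

lemma trace_dualDrift (B : Matrix ι ι ℝ) :
    LinearMap.trace ℝ (EuclideanSpace ℝ ι) (dualDrift B) = B.trace := by
  rw [dualDrift, Matrix.coe_toEuclideanCLM_eq_toEuclideanLin, Matrix.toEuclideanLin_eq_toLin_orthonormal,
    Matrix.trace_toLin_eq, Matrix.trace_transpose]

lemma continuous_toEuclideanCLM_symm :
    Continuous (Matrix.toEuclideanCLM (n := ι) (𝕜 := ℝ)).symm :=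
  LinearMap.continuous_of_finiteDimensional
    ((Matrix.toEuclideanCLM (n := ι) (𝕜 := ℝ)).symm : _ ≃⋆ₐ[ℝ] _).toAlgEquiv.toLinearMap

/-- The exponential series is summed among operators, where a norm is at hand, and carried back by a
continuous algebra isomorphism. -/
lemma exp_smul_transpose (B : Matrix ι ι ℝ) (s : ℝ) :
    NormedSpace.exp (s • B.transpose) =
      (Matrix.toEuclideanCLM (n := ι) (𝕜 := ℝ)).symm (NormedSpace.exp (s • dualDrift B)) := by
  have h := (NormedSpace.exp_series_hasSum_exp' (𝕂 := ℝ) (s • dualDrift B)).map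
    (Matrix.toEuclideanCLM (n := ι) (𝕜 := ℝ)).symm continuous_toEuclideanCLM_symm
  rw [← h.tsum_eq, NormedSpace.exp_eq_tsum ℝ]
  refine tsum_congr fun n => ?_
  rw [Function.comp_apply, map_smul, map_pow, map_smul, dualDrift, StarAlgEquiv.symm_apply_apply]

lemma toEuclideanCLM_exp_mul (Q B : Matrix ι ι ℝ) (s : ℝ) :
    Matrix.toEuclideanCLM (𝕜 := ℝ)
      (NormedSpace.exp (s • B) * Q * NormedSpace.exp (s • B.transpose)) =
    (ContinuousLinearMap.adjoint (NormedSpace.exp (s • dualDrift B))) ∘L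
      (diffusion Q ∘L NormedSpace.exp (s • dualDrift B)) := by
  have h1 : NormedSpace.exp (s • B) = star (NormedSpace.exp (s • B.transpose)) := by
    rw [← Matrix.transpose_smul, Matrix.exp_transpose, Matrix.star_eq_conjTranspose,
      Matrix.conjTranspose_eq_transpose_of_trivial, Matrix.transpose_transpose]
  rw [h1, exp_smul_transpose, map_mul, map_mul, map_star, StarAlgEquiv.apply_symm_apply,
    ContinuousLinearMap.star_eq_adjoint]
  rfl

lemma continuous_exp_mul (Q B : Matrix ι ι ℝ) (i j : ι) :
    Continuous fun s : ℝ =>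
      (NormedSpace.exp (s • B) * Q * NormedSpace.exp (s • B.transpose)) i j := by
  have h2 : Continuous fun s : ℝ => NormedSpace.exp (s • B.transpose) := by
    simp_rw [exp_smul_transpose]
    exact continuous_toEuclideanCLM_symm.comp (continuous_exp_smul _)
  have h1 : Continuous fun s : ℝ => NormedSpace.exp (s • B) := by
    have : ∀ s : ℝ, NormedSpace.exp (s • B) = (NormedSpace.exp (s • B.transpose)).transpose := by
      intro s
      rw [← Matrix.transpose_smul, Matrix.exp_transpose, Matrix.transpose_transpose]
    simp_rw [this]
    exact h2.matrix_transpose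
  exact ((h1.matrix_mul continuous_const).matrix_mul h2).matrix_elem i j

lemma inner_toEuclideanCLM_eq_sum (M : Matrix ι ι ℝ) (ξ : EuclideanSpace ℝ ι) :
    inner ℝ ξ (Matrix.toEuclideanCLM (𝕜 := ℝ) M ξ) = ∑ i, ∑ j, ξ i * (M i j * ξ j) := by
  rw [Matrix.inner_toEuclideanCLM]
  simp only [dotProduct, Matrix.mulVec, Finset.mul_sum]

/-- Identifies the phase of the propagator with the Gramian, through which a lower bound on det Q(s)
becomes dispersion. -/
lemma flowQuad_eq_gramian (Q B : Matrix ι ι ℝ) (s : ℝ) (ξ : EuclideanSpace ℝ ι) :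
    flowQuad (dualDrift B) (diffusion Q) s ξ =
      inner ℝ ξ (Matrix.toEuclideanCLM (𝕜 := ℝ) (gramian Q B s) ξ) := by
  have h1 : ∀ σ, inner ℝ (diffusion Q (flow (dualDrift B) σ ξ)) (flow (dualDrift B) σ ξ) =
      ∑ i, ∑ j, ξ i * ((NormedSpace.exp (σ • B) * Q * NormedSpace.exp (σ • B.transpose)) i j * ξ j) := by
    intro σ
    rw [← inner_toEuclideanCLM_eq_sum, toEuclideanCLM_exp_mul, ContinuousLinearMap.comp_apply,
      ContinuousLinearMap.adjoint_inner_right, real_inner_comm]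
    rfl
  rw [flowQuad, inner_toEuclideanCLM_eq_sum]
  simp_rw [h1]
  have hi : ∀ i j, IntervalIntegrable (fun σ : ℝ => ξ i *
      ((NormedSpace.exp (σ • B) * Q * NormedSpace.exp (σ • B.transpose)) i j * ξ j)) volume 0 s :=
    fun i j => (continuous_const.mul ((continuous_exp_mul Q B i j).mul
      continuous_const)).intervalIntegrable _ _
  have hi' : ∀ i, IntervalIntegrable (fun σ : ℝ => ∑ j, ξ i *
      ((NormedSpace.exp (σ • B) * Q * NormedSpace.exp (σ • B.transpose)) i j * ξ j)) volume 0 s :=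
    fun i => (continuous_finsetSum _ fun j _ => continuous_const.mul
      ((continuous_exp_mul Q B i j).mul continuous_const)).intervalIntegrable _ _
  rw [intervalIntegral.integral_finsetSum fun i _ => hi' i]
  refine Finset.sum_congr rfl fun i _ => ?_
  rw [intervalIntegral.integral_finsetSum fun j _ => hi i j]
  refine Finset.sum_congr rfl fun j _ => ?_
  rw [intervalIntegral.integral_const_mul, intervalIntegral.integral_mul_const]
  rfl

lemma posSemidef_gramian {Q : Matrix ι ι ℝ} (hQ : Q.PosSemidef) (B : Matrix ι ι ℝ) {s : ℝ}
    (hs : 0 ≤ s) : (gramian Q B s).PosSemidef := by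
  refine Matrix.PosSemidef.of_dotProduct_mulVec_nonneg ?_ fun x => ?_
  · ext i j
    simp only [Matrix.conjTranspose_apply, gramian, Matrix.of_apply, star_trivial]
    congr 1
    ext σ
    have h : (NormedSpace.exp (σ • B) * Q * NormedSpace.exp (σ • B.transpose)).transpose =
        NormedSpace.exp (σ • B) * Q * NormedSpace.exp (σ • B.transpose) := by
      have hQ' : Q.transpose = Q := by
        have := hQ.isHermitian
        rwa [Matrix.IsHermitian, Matrix.conjTranspose_eq_transpose_of_trivial] at this
      rw [Matrix.transpose_mul, Matrix.transpose_mul, hQ', ← Matrix.exp_transpose,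
        ← Matrix.exp_transpose, Matrix.transpose_smul, Matrix.transpose_smul,
        Matrix.transpose_transpose, mul_assoc]
    exact congrFun (congrFun h i) j
  · have h := flowQuad_eq_gramian Q B s (WithLp.toLp 2 x)
    rw [Matrix.inner_toEuclideanCLM] at h
    rw [star_trivial]
    change 0 ≤ x ⬝ᵥ _ 
    refine le_of_le_of_eq ?_ h
    refine intervalIntegral.integral_nonneg hs fun σ _ => ?_
    rw [real_inner_comm, Matrix.inner_toEuclideanCLM]
    exact hQ.dotProduct_mulVec_nonneg _

lemma posSemidef_of_isCanonicalForm {n m : ℕ} {p : Fin (m + 1) → ℕ}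
    {Q B : Matrix (Idx p) (Idx p) ℝ} (h : IsCanonicalForm n p Q B) : Q.PosSemidef := by
  have hz : ∀ (i j : Fin (m + 1)) (a : Fin (p i)) (b : Fin (p j)), (i ≠ 0 ∨ j ≠ 0) →
      Q ⟨i, a⟩ ⟨j, b⟩ = 0 := fun i j a b hij => congrFun (congrFun (h.Q_zero i j hij) a) b
  refine Matrix.PosSemidef.of_dotProduct_mulVec_nonneg ?_ fun x => ?_
  · ext ⟨i, a⟩ ⟨j, b⟩
    rw [Matrix.conjTranspose_apply, star_trivial]
    by_cases hij : i ≠ 0 ∨ j ≠ 0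
    · rw [hz i j a b hij, hz j i b a hij.symm]
    · push Not at hij
      obtain ⟨rfl, rfl⟩ := hij
      exact congrFun (congrFun h.posDef.isHermitian a) b
  · have h1 := h.posDef.posSemidef.dotProduct_mulVec_nonneg fun a => x ⟨0, a⟩
    refine h1.trans (le_of_eq ?_)
    simp only [dotProduct, Matrix.mulVec, star_trivial, Fintype.sum_sigma, Pi.star_apply]
    rw [Fintype.sum_eq_single (0 : Fin (m + 1))]
    · refine Finset.sum_congr rfl fun a _ => ?_
      congr 1
      rw [Fintype.sum_eq_single (0 : Fin (m + 1))]
      · rfl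
      · intro j hj
        exact Finset.sum_eq_zero fun b _ => by rw [hz 0 j a b (Or.inr hj), zero_mul]
    · intro i hi
      refine Finset.sum_eq_zero fun a _ => ?_
      rw [Finset.sum_eq_zero fun j _ => Finset.sum_eq_zero fun b _ => by
        rw [hz i j a b (Or.inl hi), zero_mul], mul_zero]

open scoped MatrixOrder in
-- Write the positive semidefinite Gramian as X*X and take R = 2√π X, so that the phase 4π²
-- ∫⟨Qe^{σBᵀ}ξ, e^{σBᵀ}ξ⟩dσ becomes π‖Rξ‖². As 4π ≥ 1, the scaling only increases the determinant,
-- so V(s) remains a lower bound; its positivity makes R invertible.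
lemma exists_factor_of_pos {Q B : Matrix ι ι ℝ} (hQ : Q.PosSemidef) {D : ℕ} {γ : ℝ} (hγ : 0 < γ)
    (hA : HypothesisA D γ Q B) {s : ℝ} (hs : 0 < s) :
    ∃ R : EuclideanSpace ℝ ι ≃L[ℝ] EuclideanSpace ℝ ι,
      (∀ ξ, ‖R ξ‖ ^ 2 = 4 * Real.pi * flowQuad (dualDrift B) (diffusion Q) s ξ) ∧
      γ * s ^ D * Real.exp (s * B.trace) ≤
        (LinearMap.det (R : EuclideanSpace ℝ ι →L[ℝ] EuclideanSpace ℝ ι).toLinearMap) ^ 2 := by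
  obtain ⟨X, hX⟩ := CStarAlgebra.nonneg_iff_eq_star_mul_self.mp (posSemidef_gramian hQ B hs.le).nonneg
  set c : ℝ := 2 * Real.sqrt Real.pi with hc
  have hc2 : c ^ 2 = 4 * Real.pi := by
    rw [hc, mul_pow, Real.sq_sqrt Real.pi_pos.le]; norm_num
  have hc1 : 1 ≤ c ^ 2 := by rw [hc2]; nlinarith [Real.pi_gt_three]
  set R₀ : EuclideanSpace ℝ ι →L[ℝ] EuclideanSpace ℝ ι := Matrix.toEuclideanCLM (𝕜 := ℝ) (c • X)
  have hdet : (gramian Q B s).det = X.det ^ 2 := by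
    rw [hX, Matrix.det_mul, Matrix.star_eq_conjTranspose, Matrix.det_conjTranspose, star_trivial, sq]
  have hbd : γ * s ^ D * Real.exp (s * B.trace) ≤ X.det ^ 2 := by
    rw [← hdet]; exact hA s hs
  have hR₀ : LinearMap.det R₀.toLinearMap = c ^ Fintype.card ι * X.det := by
    rw [det_toEuclideanCLM, Matrix.det_smul]
  have hXd : X.det ^ 2 ≤ (LinearMap.det R₀.toLinearMap) ^ 2 := by
    rw [hR₀, mul_pow, ← pow_mul, mul_comm (Fintype.card ι), pow_mul]
    exact le_mul_of_one_le_left (sq_nonneg _) (one_le_pow₀ hc1)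
  have hpos : 0 < γ * s ^ D * Real.exp (s * B.trace) := by positivity
  have hne : LinearMap.det R₀.toLinearMap ≠ 0 := by
    intro h0
    rw [h0] at hXd
    have : (0 : ℝ) ^ 2 = 0 := by norm_num
    linarith
  let R : EuclideanSpace ℝ ι ≃L[ℝ] EuclideanSpace ℝ ι :=
    (LinearEquiv.ofIsUnitDet (f := R₀.toLinearMap)
      (v := Module.finBasis ℝ (EuclideanSpace ℝ ι)) (v' := Module.finBasis ℝ (EuclideanSpace ℝ ι)) (by
      rw [LinearMap.det_toMatrix]
      exact hne.isUnit)).toContinuousLinearEquiv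
  have hR : ∀ ξ, R ξ = R₀ ξ := fun ξ => rfl
  have hRL : (R : EuclideanSpace ℝ ι →L[ℝ] EuclideanSpace ℝ ι).toLinearMap = R₀.toLinearMap := rfl
  refine ⟨R, fun ξ => ?_, ?_⟩
  · have h1 : ContinuousLinearMap.adjoint R₀ ∘L R₀ =
        Matrix.toEuclideanCLM (𝕜 := ℝ) (c ^ 2 • gramian Q B s) := by
      rw [hX, ← ContinuousLinearMap.star_eq_adjoint]
      change star R₀ * R₀ = _
      rw [← map_star, ← map_mul, star_smul, star_trivial, smul_mul_smul_comm, sq]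
    have h2 := ContinuousLinearMap.adjoint_inner_right R₀ ξ (R₀ ξ)
    rw [← ContinuousLinearMap.comp_apply, h1, real_inner_self_eq_norm_sq, map_smul, smul_apply,
      inner_smul_right, ← flowQuad_eq_gramian, hc2] at h2
    rw [hR, ← h2]
  · rw [hRL]
    exact hbd.trans hXd

lemma flowQuad_neg {V : Type*} [NormedAddCommGroup V] [InnerProductSpace ℝ V]
    [FiniteDimensional ℝ V] (A q : V →L[ℝ] V) (s : ℝ) (ξ : V) :
    flowQuad A q s ξ = -flowQuad A q (-s) (flow A s ξ) := by
  have := flowQuad_add A q (-s) s ξ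
  rw [neg_add_cancel, flowQuad_zero] at this
  linarith

/-- For s < 0 the cocycle identity writes the form as minus the form at time -s composed with
e^{sBᵀ}. The squared determinant of the flow, e^{2s tr B}, turns e^{-s tr B} into e^{s tr B}, so the
bound has the same shape for both signs. -/
lemma exists_factor {Q B : Matrix ι ι ℝ} (hQ : Q.PosSemidef) {D : ℕ} {γ : ℝ} (hγ : 0 < γ)
    (hA : HypothesisA D γ Q B) {s : ℝ} (hs : s ≠ 0) :
    ∃ (e : ℝ) (R : EuclideanSpace ℝ ι ≃L[ℝ] EuclideanSpace ℝ ι), e ^ 2 = 1 ∧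
      (∀ ξ, e * ‖R ξ‖ ^ 2 = 4 * Real.pi * flowQuad (dualDrift B) (diffusion Q) s ξ) ∧
      γ * |s| ^ D * Real.exp (s * B.trace) ≤
        (LinearMap.det (R : EuclideanSpace ℝ ι →L[ℝ] EuclideanSpace ℝ ι).toLinearMap) ^ 2 := by
  rcases hs.lt_or_gt with h | h
  · obtain ⟨R, hR, hd⟩ := exists_factor_of_pos hQ hγ hA (neg_pos.2 h)
    refine ⟨-1, (flow (dualDrift B) s).trans R, by norm_num, fun ξ => ?_, ?_⟩
    · rw [ContinuousLinearEquiv.trans_apply, hR, flowQuad_neg _ _ s ξ]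
      ring
    · have h1 : (((flow (dualDrift B) s).trans R : EuclideanSpace ℝ ι ≃L[ℝ] EuclideanSpace ℝ ι) :
          EuclideanSpace ℝ ι →L[ℝ] EuclideanSpace ℝ ι).toLinearMap =
          (R : EuclideanSpace ℝ ι →L[ℝ] EuclideanSpace ℝ ι).toLinearMap ∘ₗ
          (flow (dualDrift B) s : EuclideanSpace ℝ ι →L[ℝ] EuclideanSpace ℝ ι).toLinearMap := rfl
      rw [h1, LinearMap.det_comp, det_flow, trace_dualDrift, mul_pow, abs_of_neg h]
      calc _ = γ * (-s) ^ D * Real.exp (-s * B.trace) * Real.exp (s * B.trace) ^ 2 := by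
            rw [sq, mul_assoc (γ * (-s) ^ D), ← Real.exp_add, ← Real.exp_add]
            congr 2
            ring
        _ ≤ _ := by gcongr
  · obtain ⟨R, hR, hd⟩ := exists_factor_of_pos hQ hγ hA h
    refine ⟨1, R, by norm_num, fun ξ => by rw [one_mul, hR], ?_⟩
    rwa [abs_of_pos h]

/-- The constant of the dispersive estimate. -/
noncomputable def dispersiveConst (r γ : ℝ) : ℝ := hyConst r ^ (1 / r) * γ ^ (-(1 / 2 - 1 / r))

/-- The dispersive estimate for the propagator. -/
theorem eLpNorm_fourier_propagator_le {r p : ℝ} (hr : 2 < r) (hpr : p.HolderConjugate r)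
    {Q B : Matrix ι ι ℝ} (hQ : Q.PosSemidef) {D : ℕ} {γ : ℝ} (hγ : 0 < γ)
    (hA : HypothesisA D γ Q B) {s : ℝ} (hs : s ≠ 0) (η : SchwartzMap (EuclideanSpace ℝ ι) ℂ) :
    eLpNorm (𝓕 (propagator (dualDrift B) (diffusion Q) s η) : SchwartzMap _ ℂ) (ENNReal.ofReal r) ≤
      ENNReal.ofReal (dispersiveConst r γ *
        (|s| ^ (-(D * (1 / 2 - 1 / r))) * Real.exp (-(s * (B.trace / 2))))) *
      eLpNorm (𝓕 η : SchwartzMap _ ℂ) (ENNReal.ofReal p) := by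
  obtain ⟨e, R, he, hR, hd⟩ := exists_factor hQ hγ hA hs
  have h := eLpNorm_fourier_quadratic_le hr hpr he R (flow (dualDrift B) s) η
  have h1 : (fun ξ => Complex.exp ((-(Real.pi * e * ‖R ξ‖ ^ 2) : ℝ) * Complex.I) *
      η (flow (dualDrift B) s ξ)) = ⇑(propagator (dualDrift B) (diffusion Q) s η) := by
    ext ξ
    rw [propagator_apply]
    congr 5
    rw [mul_assoc, hR]
    ring
  rw [h1] at h
  refine h.trans ?_
  gcongr
  have hh := hyConst_pos hr
  rw [dispersiveConst, ENNReal.ofReal_rpow_of_nonneg hh.le (by positivity),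
    ← ENNReal.ofReal_mul (by positivity), mul_assoc]
  refine ENNReal.ofReal_le_ofReal (mul_le_mul_of_nonneg_left ?_ (by positivity))
  set d := LinearMap.det (R : EuclideanSpace ℝ ι →L[ℝ] EuclideanSpace ℝ ι).toLinearMap
  have hs0 : 0 < |s| := abs_pos.2 hs
  have hX : 0 < γ * |s| ^ D * Real.exp (s * B.trace) := by positivity
  have hδ : 0 ≤ 1 / 2 - 1 / r := by
    rw [sub_nonneg]; exact one_div_le_one_div_of_le (by norm_num) hr.le
  -- The exponent is negative, so the lower bound on d² becomes an upper bound.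
  have e1 : |d| ^ (-(1 - 2 / r)) ≤ (γ * |s| ^ D * Real.exp (s * B.trace)) ^ (-(1 / 2 - 1 / r)) := by
    have : |d| ^ (-(1 - 2 / r)) = (d ^ 2) ^ (-(1 / 2 - 1 / r)) := by
      rw [← sq_abs d, ← Real.rpow_natCast, ← Real.rpow_mul (abs_nonneg _)]
      congr 1
      push_cast
      ring
    rw [this]
    exact Real.rpow_le_rpow_of_nonpos hX hd (by linarith)
  have e2 : LinearMap.det ((flow (dualDrift B) s : EuclideanSpace ℝ ι →L[ℝ] EuclideanSpace ℝ ι) :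
      EuclideanSpace ℝ ι →ₗ[ℝ] EuclideanSpace ℝ ι) = Real.exp (s * B.trace) := by
    rw [det_flow, trace_dualDrift]
  have e3 : ((flow (dualDrift B) s : EuclideanSpace ℝ ι ≃L[ℝ] EuclideanSpace ℝ ι) :
      EuclideanSpace ℝ ι →ₗ[ℝ] EuclideanSpace ℝ ι) =
      ((flow (dualDrift B) s : EuclideanSpace ℝ ι →L[ℝ] EuclideanSpace ℝ ι) :
      EuclideanSpace ℝ ι →ₗ[ℝ] EuclideanSpace ℝ ι) := rfl
  rw [e3, e2, abs_of_pos (Real.exp_pos _)]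
  refine (mul_le_mul_of_nonneg_right e1 (by positivity)).trans (le_of_eq ?_)
  rw [Real.mul_rpow (by positivity) (by positivity), Real.mul_rpow hγ.le (by positivity),
    ← Real.exp_mul, ← Real.exp_mul, ← Real.rpow_natCast, ← Real.rpow_mul hs0.le, mul_assoc, mul_assoc,
    ← Real.exp_add]
  congr 3
  · ring_nf
  · ring

end Matrices

/-! ### Fourier conjugation of the transposed operator -/

section Intertwining

variable {ι : Type} [Fintype ι] [DecidableEq ι]

/-- Multiplication by the `i`-th coordinate on Schwartz functions. -/
noncomputable def coordMul (i : ι) (f : SchwartzMap (EuclideanSpace ℝ ι) ℂ) :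
    SchwartzMap (EuclideanSpace ℝ ι) ℂ :=
  SchwartzMap.smulLeftCLM ℂ (inner ℝ · (EuclideanSpace.single i (1 : ℝ))) f

lemma coordMul_apply (i : ι) (f : SchwartzMap (EuclideanSpace ℝ ι) ℂ) (ξ : EuclideanSpace ℝ ι) :
    coordMul i f ξ = (ξ i : ℂ) * f ξ := by
  have h : (fun ξ : EuclideanSpace ℝ ι =>
      (inner ℝ ξ (EuclideanSpace.single i (1 : ℝ)) : ℝ)).HasTemperateGrowth :=
    Function.hasTemperateGrowth_inner_left _
  have h1 : inner ℝ ξ (EuclideanSpace.single i (1 : ℝ)) = ξ i := by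
    rw [EuclideanSpace.inner_single_right]
    simp
  rw [coordMul, SchwartzMap.smulLeftCLM_apply_apply h, h1, Complex.real_smul]

lemma smulLeftCLM_rowSum (b : ι → ℝ) (f : SchwartzMap (EuclideanSpace ℝ ι) ℂ) :
    SchwartzMap.smulLeftCLM ℂ (fun x : EuclideanSpace ℝ ι => ((∑ j, b j * x j : ℝ) : ℂ)) f =
      ∑ j, (b j : ℂ) • coordMul j f := by
  ext ξ
  rw [SchwartzMap.smulLeftCLM_apply_apply (hasTemperateGrowth_rowSum b)]
  simp only [sum_apply, smul_apply, coordMul_apply, smul_eq_mul]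
  push_cast
  rw [Finset.sum_mul]
  exact Finset.sum_congr rfl fun j _ => by ring

lemma lineDerivOp_coordMul_apply (i j : ι) (f : SchwartzMap (EuclideanSpace ℝ ι) ℂ)
    (ξ : EuclideanSpace ℝ ι) :
    (∂_{EuclideanSpace.single j (1 : ℝ)} (coordMul i f) : SchwartzMap (EuclideanSpace ℝ ι) ℂ) ξ =
      (if i = j then 1 else 0) * f ξ +
        (ξ i : ℂ) * fderiv ℝ f ξ (EuclideanSpace.single j (1 : ℝ)) := by
  rw [SchwartzMap.lineDerivOp_apply_eq_fderiv]
  have h1 : HasFDerivAt (fun ξ : EuclideanSpace ℝ ι => (ξ i : ℂ))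
      (Complex.ofRealCLM ∘L (EuclideanSpace.proj i : EuclideanSpace ℝ ι →L[ℝ] ℝ)) ξ :=
    (Complex.ofRealCLM ∘L (EuclideanSpace.proj i : EuclideanSpace ℝ ι →L[ℝ] ℝ)).hasFDerivAt
  have h2 : ⇑(coordMul i f) = fun ξ => (ξ i : ℂ) * f ξ := funext (coordMul_apply i f)
  have h3 : HasFDerivAt (fun ξ => (ξ i : ℂ) * f ξ) _ ξ := h1.mul (f.hasFDerivAt ξ)
  rw [h2, h3.fderiv]
  have h4 : (EuclideanSpace.proj i : EuclideanSpace ℝ ι →L[ℝ] ℝ)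
      (EuclideanSpace.single j (1 : ℝ)) = if i = j then 1 else 0 := by
    rw [← PiLp.single_apply 2 ℝ j 1 i]
    rfl
  simp only [add_apply, smul_apply, ContinuousLinearMap.comp_apply, Complex.ofRealCLM_apply, h4,
    smul_eq_mul]
  split_ifs <;> simp [add_comm]

/-- The transport term is put in divergence form, ⟨Bᵀξ, ∇f⟩ = Σ B_ij ∂_j(ξ_i f) - (tr B) f. In this
order each factor turns under the Fourier transform into the matching factor of ⟨Bx, ∇·⟩. -/
lemma generator_eq_sum (Q B : Matrix ι ι ℝ) (f : SchwartzMap (EuclideanSpace ℝ ι) ℂ) :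
    generator (dualDrift B) (diffusion Q) f =
      Complex.I • (∑ i, ∑ j, (Q i j : ℂ) • (-(4 * Real.pi ^ 2) : ℂ) • coordMul j (coordMul i f)) +
      ((∑ i, ∑ j, (B i j : ℂ) • (∂_{EuclideanSpace.single j (1 : ℝ)} (coordMul i f) :
        SchwartzMap (EuclideanSpace ℝ ι) ℂ)) - (B.trace : ℂ) • f) := by
  ext ξ
  rw [generator_apply]
  simp only [add_apply, sub_apply, smul_apply, sum_apply, lineDerivOp_coordMul_apply, coordMul_apply,
    smul_eq_mul]
  congr 1
  · rw [real_inner_comm, inner_toEuclideanCLM_eq_sum]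
    push_cast
    simp only [Finset.mul_sum, Finset.sum_mul, ← Finset.sum_neg_distrib]
    refine Finset.sum_congr rfl fun i _ => Finset.sum_congr rfl fun j _ => ?_
    ring
  · have h1 : dualDrift B ξ = ∑ j, (∑ i, B i j * ξ i) • EuclideanSpace.single j (1 : ℝ) := by
      ext k
      simp [Matrix.mulVec, dotProduct, Pi.single_apply]
    rw [h1, map_sum]
    simp only [map_smul, Complex.real_smul, mul_add, Finset.sum_add_distrib]
    have h2 : ∑ i, ∑ j, (B i j : ℂ) * ((if i = j then 1 else 0) * f ξ) = (B.trace : ℂ) * f ξ := by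
      simp [Matrix.trace, Finset.sum_mul]
    rw [h2, add_sub_cancel_left, Finset.sum_comm]
    refine Finset.sum_congr rfl fun j _ => ?_
    push_cast
    rw [Finset.sum_mul]
    exact Finset.sum_congr rfl fun i _ => by ring

/-- Derivatives become -2πi times a coordinate inside the transform, and conversely. Two derivatives
give the factor -4π²; in the drift the constants 2πi cancel and leave a minus sign, while the term
in tr B is carried over. Hence 𝓕 of the propagator evolves by the transposed operator. -/
lemma transposeCLM_fourier (Q B : Matrix ι ι ℝ) (f : SchwartzMap (EuclideanSpace ℝ ι) ℂ) :
    transposeCLM Q B (𝓕 f) = 𝓕 (generator (dualDrift B) (diffusion Q) f) := by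
  let Φ := SchwartzMap.fourierTransformCLM ℂ (V := EuclideanSpace ℝ ι) (E := ℂ)
  have hΦ : ∀ g, (𝓕 g : SchwartzMap (EuclideanSpace ℝ ι) ℂ) = Φ g := fun g => rfl
  have hd : ∀ i g, (∂_{EuclideanSpace.single i (1 : ℝ)} (Φ g) : SchwartzMap (EuclideanSpace ℝ ι) ℂ) =
      (-(2 * Real.pi * Complex.I)) • Φ (coordMul i g) := by
    intro i g
    rw [← hΦ, SchwartzMap.lineDerivOp_fourier_eq, hΦ, map_smul]
    rfl
  have hm : ∀ i g, coordMul i (Φ g) = (2 * Real.pi * Complex.I)⁻¹ •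
      Φ (∂_{EuclideanSpace.single i (1 : ℝ)} g) := by
    intro i g
    rw [← hΦ (∂_{_} g), SchwartzMap.fourier_lineDerivOp_eq, smul_smul, inv_mul_cancel₀, one_smul]
    · rfl
    · simp [Real.pi_ne_zero]
  have hpi : (2 * Real.pi * Complex.I) ≠ 0 := by simp [Real.pi_ne_zero]
  rw [hΦ, hΦ, generator_eq_sum, transposeCLM]
  simp only [sub_apply, add_apply, smul_apply, sum_apply, ContinuousLinearMap.comp_apply,
    lineDerivOpCLM_apply, ContinuousLinearMap.id_apply, smulLeftCLM_rowSum, map_add, map_sub,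
    map_smul, map_sum, hd]
  have e1 : ∀ g : SchwartzMap (EuclideanSpace ℝ ι) ℂ,
      -(2 * Real.pi * Complex.I) • -(2 * Real.pi * Complex.I) • g = -(4 * Real.pi ^ 2 : ℂ) • g := by
    intro g
    rw [smul_smul]
    congr 1
    linear_combination (4 * Real.pi ^ 2 : ℂ) * Complex.I_sq
  have e2 : ∀ i, -(2 * Real.pi * Complex.I) • ∑ j, (B i j : ℂ) • coordMul j (Φ (coordMul i f)) =
      -∑ j, (B i j : ℂ) • Φ (∂_{EuclideanSpace.single j (1 : ℝ)} (coordMul i f)) := by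
    intro i
    rw [neg_smul, Finset.smul_sum]
    congr 1
    refine Finset.sum_congr rfl fun j _ => ?_
    rw [hm, smul_comm (B i j : ℂ), smul_smul, mul_inv_cancel₀ hpi, one_smul]
  simp only [e1, e2, Finset.sum_neg_distrib]
  abel

end Intertwining

/-! ### Duhamel bound for weak solutions -/

section Solutions

variable {ι : Type} [Fintype ι] [DecidableEq ι] {Q B : Matrix ι ι ℝ} {J : Set ℝ}
  {φ : EuclideanSpace ℝ ι → ℂ} {F u : ℝ → EuclideanSpace ℝ ι → ℂ}

lemma aestronglyMeasurable_restrict_prod_mono {V : Type*} [MeasurableSpace V] {ν : Measure V}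
    [SFinite ν] {f : ℝ × V → ℂ} {K : Set ℝ} (hK : K ⊆ J)
    (hf : AEStronglyMeasurable f ((volume.restrict J).prod ν)) :
    AEStronglyMeasurable f ((volume.restrict K).prod ν) :=
  hf.mono_ac ((Measure.restrict_mono hK le_rfl).absolutelyContinuous.prod .rfl)

lemma IsSolution.exists_bound (hu : IsSolution Q B J φ F u) (hJ : J.OrdConnected)
    (h0 : (0 : ℝ) ∈ J) {t : ℝ} (ht : t ∈ J) :
    ∃ M : ℝ≥0, ∀ s ∈ Set.uIcc 0 t, MemLp (u s) 2 ∧ eLpNorm (u s) 2 ≤ M := by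
  have hs := hJ.uIcc_subset h0 ht
  obtain ⟨M, hM⟩ := hu.locally_bounded _ hs isCompact_uIcc
  exact ⟨M, fun s h => ⟨hu.memLp s (hs h), hM s h⟩⟩

lemma IsSolution.intervalIntegrable_pairing (hu : IsSolution Q B J φ F u) (hJ : J.OrdConnected)
    (h0 : (0 : ℝ) ∈ J) {t : ℝ} (ht : t ∈ J) (ψ : SchwartzMap (EuclideanSpace ℝ ι) ℂ) :
    IntervalIntegrable (fun s => ∫ x, u s x * ψ x) volume 0 t := by
  obtain ⟨M, hM⟩ := hu.exists_bound hJ h0 ht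
  rw [intervalIntegrable_iff]
  have : IsFiniteMeasure (volume.restrict (Set.uIoc 0 t)) :=
    inferInstanceAs (IsFiniteMeasure (volume.restrict (Set.Ioc (min 0 t) (max 0 t))))
  refine integrable_integral_mul_two (M := M) (aestronglyMeasurable_restrict_prod_mono
    (Set.uIoc_subset_uIcc.trans (hJ.uIcc_subset h0 ht)) hu.measurable) ?_ ψ
  exact (ae_restrict_iff' measurableSet_uIoc).2
    (.of_forall fun s hs => (hM s (Set.uIoc_subset_uIcc hs)).2)

lemma intervalIntegrable_forcing_pairing {p r : ℝ} (hpr : p.HolderConjugate r)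
    (hF : AEStronglyMeasurable (Function.uncurry F) ((volume.restrict J).prod volume))
    (hJ : J.OrdConnected) (h0 : (0 : ℝ) ∈ J) {t : ℝ} (ht : t ∈ J)
    (hG : ∫⁻ s in Set.uIoc 0 t, eLpNorm (F s) (ENNReal.ofReal p) ≠ ⊤)
    (ψ : SchwartzMap (EuclideanSpace ℝ ι) ℂ) :
    IntervalIntegrable (fun s => ∫ x, F s x * ψ x) volume 0 t := by
  rw [intervalIntegrable_iff]
  exact integrable_integral_mul hpr (aestronglyMeasurable_restrict_prod_mono
    (Set.uIoc_subset_uIcc.trans (hJ.uIcc_subset h0 ht)) hF) hG ψ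

lemma IsSolution.weak_equation (hu : IsSolution Q B J φ F u) {p r : ℝ} (hpr : p.HolderConjugate r)
    (hF : AEStronglyMeasurable (Function.uncurry F) ((volume.restrict J).prod volume))
    (hJ : J.OrdConnected) (h0 : (0 : ℝ) ∈ J) (hφ : MemLp φ 2) {t : ℝ} (ht : t ∈ J)
    (hG : ∫⁻ s in Set.uIoc 0 t, eLpNorm (F s) (ENNReal.ofReal p) ≠ ⊤)
    (ψ : SchwartzMap (EuclideanSpace ℝ ι) ℂ) :
    ∫ x, u t x * ψ x = (∫ x, φ x * ψ x) +
        ∫ s in (0 : ℝ)..t, ((∫ x, u s x * transposeCLM Q B ψ x) + ∫ x, F s x * ψ x) := by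
  obtain ⟨M, hM⟩ := hu.exists_bound hJ h0 ht
  have hK := Set.uIoc_subset_uIcc.trans (hJ.uIcc_subset h0 ht)
  exact weak_equation_schwartz hpr (aestronglyMeasurable_restrict_prod_mono hK hu.measurable)
    (aestronglyMeasurable_restrict_prod_mono hK hF)
    (fun s hs => hM s (Set.uIoc_subset_uIcc hs)) hG hφ (hu.memLp t ht)
    (fun ψ h1 h2 => hu.equation ψ h1 h2 t ht) ψ

theorem ofReal_integral_le_lintegral {α : Type*} [MeasurableSpace α] {μ : Measure α} {h : α → ℝ}
    (h0 : ∀ x, 0 ≤ h x) : ENNReal.ofReal (∫ x, h x ∂μ) ≤ ∫⁻ x, ENNReal.ofReal (h x) ∂μ := by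
  rw [← Real.enorm_of_nonneg (integral_nonneg h0)]
  refine (enorm_integral_le_lintegral_enorm _).trans (lintegral_mono fun x => ?_)
  rw [Real.enorm_of_nonneg (h0 x)]

lemma toReal_eLpNorm_le_add {V : Type*} [NormedAddCommGroup V] [InnerProductSpace ℝ V]
    [FiniteDimensional ℝ V] [MeasurableSpace V] [BorelSpace V] {r : ℝ≥0∞} (hr : 1 ≤ r)
    (f g : SchwartzMap V ℂ) :
    (eLpNorm f r).toReal ≤ (eLpNorm g r).toReal + (eLpNorm (f - g : SchwartzMap V ℂ) r).toReal := by
  have h1 : ⇑f = ⇑g + ⇑(f - g) := by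
    ext x
    simp
  have h2 := (g.eLpNorm_lt_top r volume).ne
  have h3 := ((f - g).eLpNorm_lt_top r volume).ne
  rw [← ENNReal.toReal_add h2 h3]
  refine ENNReal.toReal_mono (ENNReal.add_ne_top.2 ⟨h2, h3⟩) ?_
  nth_rewrite 1 [h1]
  exact eLpNorm_add_le g.continuous.aestronglyMeasurable (f - g).continuous.aestronglyMeasurable hr

set_option maxHeartbeats 400000 in
/-- The Duhamel bound for weak solutions, tested against the Fourier transform of a Schwartz
function. -/
theorem IsSolution.enorm_pairing_le (hu : IsSolution Q B J φ F u) {p r : ℝ} (hr : 2 < r)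
    (hpr : p.HolderConjugate r)
    (hF : AEStronglyMeasurable (Function.uncurry F) ((volume.restrict J).prod volume))
    (hJ : J.OrdConnected) (h0 : (0 : ℝ) ∈ J) (hφ : MemLp φ 2)
    (hG : ∀ t ∈ J, ∫⁻ s in Set.uIoc 0 t, eLpNorm (F s) (ENNReal.ofReal p) ≠ ⊤)
    {t : ℝ} (ht : t ∈ J) (η : SchwartzMap (EuclideanSpace ℝ ι) ℂ) :
    ‖∫ x, u t x * (𝓕 η : SchwartzMap _ ℂ) x‖ₑ ≤
      ‖∫ x, φ x * (𝓕 (propagator (dualDrift B) (diffusion Q) t η) : SchwartzMap _ ℂ) x‖ₑ +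
      ∫⁻ s in Set.uIoc 0 t, eLpNorm (F s) (ENNReal.ofReal p) *
        eLpNorm (𝓕 (propagator (dualDrift B) (diffusion Q) (t - s) η) : SchwartzMap _ ℂ)
          (ENNReal.ofReal r) := by
  have hLZ := generator_propagator (dualDrift B) (diffusion Q)
  have hLF := fun ζ => transposeCLM_fourier Q B ζ
  have hZ0 := propagator_zero (dualDrift B) (diffusion Q)
  obtain ⟨k₂, c₂, hc₂, hN₂⟩ := exists_eLpNorm_fourier_two_le (V := EuclideanSpace ℝ ι)
  obtain ⟨k, c, hc, hN⟩ := exists_eLpNorm_fourier_le (V := EuclideanSpace ℝ ι) hr hpr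
  have hZ₂ := fun η T => exists_propagator_bounds (dualDrift B) (diffusion Q) η T hc₂ hN₂
  have hZr := fun η T => exists_propagator_bounds (dualDrift B) (diffusion Q) η T hc hN
  generalize propagator (dualDrift B) (diffusion Q) = Z at *
  generalize generator (dualDrift B) (diffusion Q) = L at *
  -- The sign of t: reparametrising time by s ↦ e s reduces both directions to the interval [0, T]
  -- with T = |t|.
  obtain ⟨e, he1, hemp, hte⟩ : ∃ e : ℝ, (e = 1 ∨ e = -1) ∧
      MeasurePreserving (fun s : ℝ => e * s) volume volume ∧ t = e * |t| := by
    rcases le_total 0 t with h | h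
    · refine ⟨1, Or.inl rfl, ?_, by rw [abs_of_nonneg h, one_mul]⟩
      simp only [one_mul]
      exact MeasurePreserving.id volume
    · refine ⟨-1, Or.inr rfl, ?_, by rw [abs_of_nonpos h]; ring⟩
      simpa using Measure.measurePreserving_neg (volume : Measure ℝ)
  have he : e * e = 1 := by rcases he1 with rfl | rfl <;> norm_num
  have he0 : e ≠ 0 := by rintro rfl; norm_num at he
  have heabs : |e| = 1 := by rcases he1 with rfl | rfl <;> norm_num
  have heC : ‖(e : ℂ)‖ₑ = 1 := by
    rw [← ofReal_norm, Complex.norm_real, Real.norm_eq_abs, heabs, ENNReal.ofReal_one]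
  have hT0 : 0 ≤ |t| := abs_nonneg t
  generalize |t| = T at *
  have hmemI : ∀ s ∈ Set.Icc 0 T, e * s ∈ Set.uIcc 0 t := by
    intro s hs
    rw [hte, show (0 : ℝ) = e * 0 by ring, ← Set.image_const_mul_uIcc]
    exact ⟨s, by rwa [Set.uIcc_of_le hT0], rfl⟩
  have hmemJ : ∀ s ∈ Set.Icc 0 T, e * s ∈ J := fun s hs => hJ.uIcc_subset h0 ht (hmemI s hs)
  -- The inclusion holds only almost everywhere: for negative t, s = T is sent to the endpoint t,
  -- which the half-open interval omits.
  have hpre : ∀ᵐ s : ℝ, s ∈ Set.Ioc 0 T → e * s ∈ Set.uIoc 0 t := by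
    filter_upwards [Measure.ae_ne volume T] with s hsT hs
    have hlt : s < T := lt_of_le_of_ne hs.2 hsT
    rw [Set.mem_uIoc, hte]
    rcases he1 with rfl | rfl
    · left
      constructor <;> linarith [hs.1]
    · right
      constructor <;> linarith [hs.1]
  have hemb : MeasurableEmbedding (fun s : ℝ => e * s) :=
    (Homeomorph.mulLeft₀ e he0).measurableEmbedding
  obtain ⟨M, hM⟩ := hu.exists_bound hJ h0 ht
  have hK := Set.uIoc_subset_uIcc.trans (hJ.uIcc_subset h0 ht)
  have hFK := aestronglyMeasurable_restrict_prod_mono hK hF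
  have hFp : ∀ᵐ s : ℝ, s ∈ Set.Ioc 0 T → MemLp (F (e * s)) (ENNReal.ofReal p) := by
    have h1 := hemp.quasiMeasurePreserving.ae
      ((ae_restrict_iff' measurableSet_uIoc).1 (memLp_slice hFK hpr.pos (hG t ht)))
    filter_upwards [h1, hpre] with s hs1 hs2 hs using hs1 (hs2 hs)
  obtain ⟨g, hg⟩ : ∃ g : ℝ → ℝ, ∀ s, g s = (eLpNorm (F (e * s)) (ENNReal.ofReal p)).toReal :=
    ⟨_, fun _ => rfl⟩
  have hcomp : ∀ {h : ℝ → ℂ} {s : ℝ}, IntervalIntegrable h volume 0 (e * s) →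
      IntervalIntegrable (fun x => h (e * x)) volume 0 s := by
    intro h s hh
    have := hh.comp_mul_left (c := e)
    rwa [zero_div, mul_div_cancel_left₀ _ he0] at this
  have hgi : IntervalIntegrable g volume 0 T := by
    have h1 : IntervalIntegrable (fun s => (eLpNorm (F s) (ENNReal.ofReal p)).toReal)
        volume 0 (e * T) := by
      rw [← hte, intervalIntegrable_iff]
      exact integrable_toReal_of_lintegral_ne_top (aemeasurable_eLpNorm_slice hFK hpr.pos) (hG t ht)
    have := h1.comp_mul_left (c := e)
    rw [zero_div, mul_div_cancel_left₀ _ he0] at this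
    rwa [funext hg]
  obtain ⟨U, hU⟩ : ∃ U : ℝ → SchwartzMap (EuclideanSpace ℝ ι) ℂ → ℂ,
    ∀ s ψ, U s ψ = ∫ x, u (e * s) x * ψ x := ⟨_, fun _ _ => rfl⟩
  obtain ⟨f, hf⟩ : ∃ f : ℝ → SchwartzMap (EuclideanSpace ℝ ι) ℂ → ℂ,
    ∀ s ψ, f s ψ = e * ∫ x, F (e * s) x * ψ x := ⟨_, fun _ _ => rfl⟩
  obtain ⟨T', hT'⟩ : ∃ T' : SchwartzMap (EuclideanSpace ℝ ι) ℂ → SchwartzMap (EuclideanSpace ℝ ι) ℂ,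
    ∀ ψ, T' ψ = (e : ℂ) • transposeCLM Q B ψ := ⟨_, fun _ => rfl⟩
  -- The test function evolved backwards: it equals 𝓕η at time T, is fully evolved at time 0, and
  -- solves Ψ' = -T'Ψ.
  obtain ⟨Ψ, hΨ⟩ : ∃ Ψ : ℝ → SchwartzMap (EuclideanSpace ℝ ι) ℂ,
    ∀ s, Ψ s = 𝓕 (Z (e * (T - s)) η) := ⟨_, fun _ => rfl⟩
  have hT'Ψ : ∀ (c : ℝ) (ζ : SchwartzMap (EuclideanSpace ℝ ι) ℂ),
      T' (𝓕 (Z c ζ)) = (e : ℂ) • 𝓕 (Z c (L ζ)) := by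
    intro c ζ
    rw [hT', hLF, hLZ]
  have hFadd : ∀ x y : SchwartzMap (EuclideanSpace ℝ ι) ℂ, (𝓕 x - 𝓕 y : SchwartzMap _ ℂ) = 𝓕 (x - y) :=
    fun x y => (map_sub (SchwartzMap.fourierTransformCLM ℂ) x y).symm
  have hFadd' : ∀ x y : SchwartzMap (EuclideanSpace ℝ ι) ℂ, (𝓕 x + 𝓕 y : SchwartzMap _ ℂ) = 𝓕 (x + y) :=
    fun x y => (map_add (SchwartzMap.fourierTransformCLM ℂ) x y).symm
  have hFsmul : ∀ (c : ℂ) (x : SchwartzMap (EuclideanSpace ℝ ι) ℂ), (c • 𝓕 x : SchwartzMap _ ℂ) = 𝓕 (c • x) :=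
    fun c x => (map_smul (SchwartzMap.fourierTransformCLM ℂ) c x).symm
  have hreal : ∀ (c : ℝ) (x : SchwartzMap (EuclideanSpace ℝ ι) ℂ), c • x = (c : ℂ) • x := by
    intro c x
    ext ξ
    simp
  have harg : ∀ s ∈ Set.Icc 0 T, |e * (T - s)| ≤ T := by
    intro s hs
    rw [abs_mul, heabs, one_mul, abs_of_nonneg (by linarith [hs.2])]
    linarith [hs.1]
  obtain ⟨C₁, hC₁, -, -, H₁⟩ := hZ₂ η T
  obtain ⟨C₂, hC₂, H₂, -, -⟩ := hZ₂ (L (L η)) T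
  obtain ⟨C₃, hC₃, -, H₃, -⟩ := hZr η T
  obtain ⟨C₄, hC₄, H₄, -, -⟩ := hZr (L η) T
  have hr1 : (1 : ℝ≥0∞) ≤ ENNReal.ofReal r := by
    rw [← ENNReal.ofReal_one]; exact ENNReal.ofReal_le_ofReal (by linarith)
  have hlip : ∀ s ∈ Set.Icc 0 T, ∀ s' ∈ Set.Icc 0 T,
      (eLpNorm (Ψ s') (ENNReal.ofReal r)).toReal ≤
        (eLpNorm (Ψ s) (ENNReal.ofReal r)).toReal + C₃ * |s' - s| := by
    intro s hs s' hs'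
    refine (toReal_eLpNorm_le_add hr1 (Ψ s') (Ψ s)).trans ?_
    gcongr
    have := H₃ _ _ (harg s hs) (harg s' hs')
    rw [show e * (T - s') - e * (T - s) = e * (s - s') by ring, abs_mul, heabs, one_mul,
      abs_sub_comm] at this
    simp only [hΨ]
    rw [hFadd]
    exact this
  have key := norm_pairing_sub_le (T := T') (U := U) (f := f)
    (N₂ := fun ψ => (eLpNorm ψ 2).toReal) (N := fun ψ => (eLpNorm ψ (ENNReal.ofReal r)).toReal)
    (g := g) (M := M) (C := C₁ + C₂ + C₃ + C₄) (t := T) (Ψ := Ψ) hT0 M.2 (by positivity)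
    (fun s => by rw [hg]; exact ENNReal.toReal_nonneg) hgi
    (fun s hs x y z a => by
      have hi := fun w => integrable_mul_schwartz (p := 2) (r := 2)
        (by constructor <;> norm_num) (by simpa using (hM _ (hmemI s hs)).1) w
      simp only [hU]
      have hxy : Integrable fun v => u (e * s) v * x v - u (e * s) v * y v := (hi x).sub (hi y)
      rw [← integral_sub (hi x) (hi y), ← integral_const_mul, ← integral_add hxy
        ((hi z).const_mul _)]
      refine integral_congr_ae (.of_forall fun v => ?_)
      simp only [add_apply, sub_apply, smul_apply, Complex.real_smul]
      ring)
    (fun s hs x => by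
      rw [hU]
      refine (norm_integral_mul_schwartz_le_two (hM _ (hmemI s hs)).1 x).trans ?_
      gcongr
      exact ENNReal.toReal_le_of_le_ofReal M.2 (by simpa using (hM _ (hmemI s hs)).2))
    (by
      filter_upwards [hFp] with s hs hsm x
      simp only [hf]
      rw [norm_mul, Complex.norm_real, Real.norm_eq_abs, heabs, one_mul, hg]
      exact norm_integral_mul_schwartz_le hpr (hs hsm) x)
    (fun x => by
      simp only [hU]
      exact hcomp (h := fun s => ∫ v, u s v * x v)
        (hte ▸ hu.intervalIntegrable_pairing hJ h0 ht x))
    (fun x => by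
      simp only [hf]
      exact (hcomp (h := fun s => ∫ v, F s v * x v)
        (hte ▸ intervalIntegrable_forcing_pairing hpr hF hJ h0 ht (hG t ht) x)).const_mul _)
    (fun s hs s' hs' hss x => by
      have i1 := fun s hs => hu.intervalIntegrable_pairing hJ h0 (hmemJ s hs) (transposeCLM Q B x)
      have i2 := fun s hs => intervalIntegrable_forcing_pairing hpr hF hJ h0 (hmemJ s hs)
        (hG _ (hmemJ s hs)) x
      have w := fun s hs => hu.weak_equation hpr hF hJ h0 hφ (hmemJ s hs) (hG _ (hmemJ s hs)) x
      simp only [hU, hf]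
      rw [w s hs, w s' hs', add_sub_add_left_eq_sub, intervalIntegral.integral_interval_sub_left
        ((i1 s' hs').add (i2 s' hs')) ((i1 s hs).add (i2 s hs)),
        ← intervalIntegral.smul_integral_comp_mul_left, ← intervalIntegral.integral_smul]
      refine intervalIntegral.integral_congr fun σ _ => ?_
      simp only [hT', integral_mul_schwartz_smul, Complex.real_smul]
      ring)
    (fun s hs s' hs' hss => by
      have := H₁ _ _ (harg s' hs') (harg s hs)
      simp only [hΨ]
      rw [hT'Ψ, hreal, smul_smul, hFadd, hFsmul, hFadd']
      rw [show e * (T - s) - e * (T - s') = (s' - s) * e by ring, mul_pow, sq e, he, mul_one,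
        Complex.ofReal_mul] at this
      refine this.trans ?_
      gcongr
      linarith)
    (fun s hs s' hs' hss => by
      refine (hlip s hs s' hs').trans ?_
      rw [abs_of_nonneg (by linarith)]
      gcongr
      linarith)
    (by
      refine LipschitzOnWith.continuousOn (K := ⟨C₃, hC₃⟩) (LipschitzOnWith.of_dist_le_mul ?_)
      intro s hs s' hs'
      rw [Real.dist_eq, Real.dist_eq, abs_le]
      have h1 := hlip s hs s' hs'
      have h2 := hlip s' hs' s hs
      rw [abs_sub_comm] at h1
      change _ ≤ _ ∧ _ ≤ C₃ * |s - s'|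
      change -(C₃ * |s - s'|) ≤ _ ∧ _
      constructor <;> linarith)
    (fun s hs => by
      simp only [hΨ]
      rw [hT'Ψ]
      have : T' ((e : ℂ) • 𝓕 (Z (e * (T - s)) (L η))) = 𝓕 (Z (e * (T - s)) (L (L η))) := by
        have h1 : T' ((e : ℂ) • 𝓕 (Z (e * (T - s)) (L η))) =
            (e : ℂ) • T' (𝓕 (Z (e * (T - s)) (L η))) := by
          simp only [hT', map_smul]
        rw [h1, hT'Ψ, smul_smul, ← Complex.ofReal_mul, he, Complex.ofReal_one, one_smul]
      rw [this]
      refine (H₂ _ (harg s hs)).trans ?_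
      linarith)
    (fun s hs => by
      simp only [hΨ]
      rw [hT'Ψ, eLpNorm_schwartz_smul, heC, one_mul]
      refine (H₄ _ (harg s hs)).trans ?_
      linarith)
  have hUt : U T (Ψ T) = ∫ x, u t x * (𝓕 η : SchwartzMap _ ℂ) x := by
    simp only [hU, hΨ, sub_self, mul_zero, ← hte]
    rw [hZ0]
  have hU0 : U 0 (Ψ 0) = ∫ x, φ x * (𝓕 (Z t η) : SchwartzMap _ ℂ) x := by
    -- At time 0 the weak equation identifies u(0) with φ against Schwartz functions; this is how
    -- the initial datum enters.
    have h1 := hu.weak_equation hpr hF hJ h0 hφ h0 (hG 0 h0) (𝓕 (Z t η))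
    rw [intervalIntegral.integral_same, add_zero] at h1
    simp only [hU, hΨ, sub_zero, mul_zero, ← hte]
    exact h1
  rw [hUt, hU0] at key
  have e1 : (∫ x, u t x * (𝓕 η : SchwartzMap _ ℂ) x) =
      (∫ x, φ x * (𝓕 (Z t η) : SchwartzMap _ ℂ) x) + ((∫ x, u t x * (𝓕 η : SchwartzMap _ ℂ) x) -
        ∫ x, φ x * (𝓕 (Z t η) : SchwartzMap _ ℂ) x) := by ring
  rw [e1]
  refine (enorm_add_le _ _).trans ?_
  gcongr
  rw [← ofReal_norm]
  refine (ENNReal.ofReal_le_ofReal key).trans ?_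
  obtain ⟨H, hH⟩ : ∃ H : ℝ → ℝ≥0∞, ∀ s, H s = eLpNorm (F s) (ENNReal.ofReal p) *
    eLpNorm (𝓕 (Z (t - s) η) : SchwartzMap _ ℂ) (ENNReal.ofReal r) := ⟨_, fun _ => rfl⟩
  simp only [← hH]
  rw [intervalIntegral.integral_of_le hT0]
  have b1 : ENNReal.ofReal (∫ s in Set.Ioc 0 T, g s * (eLpNorm (Ψ s) (ENNReal.ofReal r)).toReal) ≤
      ∫⁻ s in Set.Ioc 0 T, ENNReal.ofReal (g s * (eLpNorm (Ψ s) (ENNReal.ofReal r)).toReal) :=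
    ofReal_integral_le_lintegral fun s =>
      mul_nonneg (by rw [hg]; exact ENNReal.toReal_nonneg) ENNReal.toReal_nonneg
  have b2 : ∀ s, ENNReal.ofReal (g s * (eLpNorm (Ψ s) (ENNReal.ofReal r)).toReal) ≤ H (e * s) := by
    intro s
    rw [ENNReal.ofReal_mul (by rw [hg]; exact ENNReal.toReal_nonneg), hH, hg, hΨ,
      show e * (T - s) = t - e * s by rw [mul_sub, ← hte]]
    exact mul_le_mul' ENNReal.ofReal_toReal_le ENNReal.ofReal_toReal_le
  have b3 : ∫⁻ s in Set.Ioc 0 T, H (e * s) ≤ ∫⁻ s, (Set.uIoc 0 t).indicator H (e * s) := by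
    rw [← lintegral_indicator measurableSet_Ioc]
    refine lintegral_mono_ae ?_
    filter_upwards [hpre] with s hs
    by_cases hsI : s ∈ Set.Ioc 0 T
    · rw [Set.indicator_of_mem hsI, Set.indicator_of_mem (hs hsI)]
    · rw [Set.indicator_of_notMem hsI]
      exact zero_le
  have b4 : ∫⁻ s, (Set.uIoc 0 t).indicator H (e * s) = ∫⁻ s in Set.uIoc 0 t, H s := by
    rw [hemp.lintegral_comp_emb hemb, lintegral_indicator measurableSet_uIoc]
  exact b1.trans ((lintegral_mono fun s => b2 s).trans (b3.trans b4.le))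

end Solutions

/-! ### Evolved profiles as curves in L² -/

section Wave

variable {V : Type*} [NormedAddCommGroup V] [InnerProductSpace ℝ V] [FiniteDimensional ℝ V]
  [MeasurableSpace V] [BorelSpace V]

lemma continuous_toLp_fourier_propagator (A q : V →L[ℝ] V) (η : SchwartzMap V ℂ) :
    Continuous fun t => (𝓕 (propagator A q t η) : SchwartzMap V ℂ).toLp 2 := by
  obtain ⟨k, c, hc, hN⟩ := exists_eLpNorm_fourier_two_le (V := V)
  refine continuous_iff_continuousAt.2 fun t => ?_
  obtain ⟨C, hC, -, h, -⟩ := exists_propagator_bounds A q η (|t| + 1) hc hN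
  have hL : LipschitzOnWith ⟨C, hC⟩ (fun t => (𝓕 (propagator A q t η) : SchwartzMap V ℂ).toLp 2)
      {a | |a| ≤ |t| + 1} := by
    refine LipschitzOnWith.of_dist_le_mul fun a ha b hb => ?_
    have h1 : (𝓕 (propagator A q a η) : SchwartzMap V ℂ).toLp 2 volume -
        (𝓕 (propagator A q b η) : SchwartzMap V ℂ).toLp 2 volume =
        (𝓕 (propagator A q a η - propagator A q b η) : SchwartzMap V ℂ).toLp 2 := by
      have h2 : (𝓕 (propagator A q a η - propagator A q b η) : SchwartzMap V ℂ) =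
        𝓕 (propagator A q a η) - 𝓕 (propagator A q b η) :=
        map_sub (SchwartzMap.fourierTransformCLM ℂ) _ _
      rw [h2]
      rfl
    rw [dist_eq_norm, h1, SchwartzMap.norm_toLp, Real.dist_eq]
    exact h b a hb ha
  refine hL.continuousOn.continuousAt (Filter.mem_of_superset (Metric.ball_mem_nhds t one_pos) ?_)
  intro a ha
  rw [Metric.mem_ball, Real.dist_eq] at ha
  have := abs_sub_abs_le_abs_sub a t
  simp only [Set.mem_ofPred_eq]
  linarith

lemma enorm_inner_toLp_le {r p : ℝ} (hpr : p.HolderConjugate r) (x y : SchwartzMap V ℂ) :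
    ‖(inner ℂ (x.toLp 2) (y.toLp 2) : ℂ)‖ₑ ≤
      eLpNorm x (ENNReal.ofReal r) * eLpNorm y (ENNReal.ofReal p) := by
  rw [SchwartzMap.inner_toL2_toL2_eq x y volume]
  have h1 : ∀ v, (inner ℂ (x v) (y v) : ℂ) = star (x v) * y v := fun v => by
    rw [RCLike.inner_apply]; exact mul_comm _ _
  simp_rw [h1]
  have h2 := enorm_integral_mul_le (μ := (volume : Measure V)) hpr.symm (f := star ⇑x) (g := y)
    x.continuous.star.aestronglyMeasurable y.continuous.aestronglyMeasurable
  refine h2.trans_eq ?_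
  congr 1
  exact eLpNorm_congr_norm_ae (.of_forall fun v => by simp)

end Wave

section Drift

variable {ι : Type} [Fintype ι] [DecidableEq ι] {Q B : Matrix ι ι ℝ}

/-- The `L²`-normalized evolution of a Schwartz profile under the adjoint group. -/
noncomputable def adjointWave (Q B : Matrix ι ι ℝ) (η : SchwartzMap (EuclideanSpace ℝ ι) ℂ) (t : ℝ) :
    Lp ℂ 2 (volume : Measure (EuclideanSpace ℝ ι)) :=
  (Real.exp (B.trace / 2 * t) : ℂ) •
    (𝓕 (propagator (dualDrift B) (diffusion Q) t η) : SchwartzMap _ ℂ).toLp 2 volume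

lemma continuous_adjointWave (η : SchwartzMap (EuclideanSpace ℝ ι) ℂ) :
    Continuous (adjointWave Q B η) :=
  Continuous.smul (f := fun t => (Real.exp (B.trace / 2 * t) : ℂ)) (by fun_prop)
    (continuous_toLp_fourier_propagator _ _ η)

lemma inner_adjointWave (η ζ : SchwartzMap (EuclideanSpace ℝ ι) ℂ) (t s : ℝ) :
    (inner ℂ (adjointWave Q B η t) (adjointWave Q B ζ s) : ℂ) =
      (Real.exp (B.trace / 2 * (t - s)) : ℂ) *
        inner ℂ ((𝓕 (propagator (dualDrift B) (diffusion Q) (t - s) η) : SchwartzMap _ ℂ).toLp 2)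
          ((𝓕 ζ : SchwartzMap _ ℂ).toLp 2) := by
  rw [adjointWave, adjointWave, inner_smul_left, inner_smul_right, inner_fourier_propagator,
    Complex.conj_ofReal, ← mul_assoc, ← mul_assoc, ← Complex.ofReal_mul, ← Complex.ofReal_mul,
    ← Real.exp_add, ← Real.exp_add, trace_dualDrift]
  congr 4
  ring

/-- The diagonal case t = s of the correlation formula: with its weight the adjoint evolution is
isometric, which supplies the bounded curves that TT* requires. -/
lemma norm_adjointWave (η : SchwartzMap (EuclideanSpace ℝ ι) ℂ) (t : ℝ) :
    ‖adjointWave Q B η t‖ = ‖(𝓕 η : SchwartzMap _ ℂ).toLp 2‖ := by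
  have h := inner_adjointWave (Q := Q) (B := B) η η t t
  rw [sub_self, propagator_zero, mul_zero, Real.exp_zero, Complex.ofReal_one, one_mul,
    inner_self_eq_norm_sq_to_K, inner_self_eq_norm_sq_to_K] at h
  have h' : ‖adjointWave Q B η t‖ ^ 2 = ‖(𝓕 η : SchwartzMap _ ℂ).toLp 2‖ ^ 2 := by exact_mod_cast h
  exact (sq_eq_sq₀ (norm_nonneg _) (norm_nonneg _)).1 h'

lemma dispersiveConst_pos {r γ : ℝ} (hr : 2 < r) (hγ : 0 < γ) : 0 < dispersiveConst r γ :=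
  mul_pos (Real.rpow_pos_of_pos (hyConst_pos hr) _) (Real.rpow_pos_of_pos hγ _)

/-- The weight cancels the exponential of the dispersive estimate, and admissibility turns the
exponent D(1/2 - 1/r) into 2/q, the order of the fractional integral. -/
lemma weighted_eLpNorm_fourier_propagator_le {r p q : ℝ} (hr : 2 < r) (hpr : p.HolderConjugate r)
    (hQ : Q.PosSemidef) {D : ℕ} {γ : ℝ} (hγ : 0 < γ) (hA : HypothesisA D γ Q B)
    (hD : 2 / q = D * (1 / 2 - 1 / r)) {t s : ℝ} (hts : t ≠ s)
    {η : SchwartzMap (EuclideanSpace ℝ ι) ℂ}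
    (hη : eLpNorm (𝓕 η : SchwartzMap _ ℂ) (ENNReal.ofReal p) ≤ 1) :
    ENNReal.ofReal (Real.exp (B.trace / 2 * (t - s))) *
      eLpNorm (𝓕 (propagator (dualDrift B) (diffusion Q) (t - s) η) : SchwartzMap _ ℂ)
        (ENNReal.ofReal r) ≤
      ENNReal.ofReal (dispersiveConst r γ) * rieszKernel (2 / q) (t - s) := by
  have h := eLpNorm_fourier_propagator_le hr hpr hQ hγ hA (sub_ne_zero.2 hts) η
  have hK := (dispersiveConst_pos hr hγ).le
  calc _ ≤ ENNReal.ofReal (Real.exp (B.trace / 2 * (t - s))) *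
        (ENNReal.ofReal (dispersiveConst r γ *
        (|t - s| ^ (-(D * (1 / 2 - 1 / r))) * Real.exp (-((t - s) * (B.trace / 2))))) * 1) := by
        gcongr
        exact h.trans (by gcongr)
    _ = _ := by
        rw [mul_one, rieszKernel, ← ENNReal.ofReal_mul (Real.exp_pos _).le, ← ENNReal.ofReal_mul hK,
          hD, mul_left_comm, mul_left_comm (Real.exp _), ← Real.exp_add,
          show B.trace / 2 * (t - s) + -((t - s) * (B.trace / 2)) = 0 by ring, Real.exp_zero, mul_one]

/-- The conjugate of φ appears because the inner product is conjugate-linear in its first slot,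
whereas the weak formulation pairs bilinearly. -/
lemma enorm_weighted_pairing {φ : EuclideanSpace ℝ ι → ℂ} (hφ : MemLp φ 2)
    (η : SchwartzMap (EuclideanSpace ℝ ι) ℂ) (t : ℝ) :
    ENNReal.ofReal (Real.exp (B.trace / 2 * t)) *
      ‖∫ x, φ x * (𝓕 (propagator (dualDrift B) (diffusion Q) t η) : SchwartzMap _ ℂ) x‖ₑ =
      ‖(inner ℂ (hφ.star.toLp (star φ)) (adjointWave Q B η t) : ℂ)‖ₑ := by
  rw [adjointWave, inner_smul_right, enorm_mul, ← integral_mul_eq_inner hφ]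
  congr 1
  · rw [← ofReal_norm, Complex.norm_real, Real.norm_of_nonneg (Real.exp_pos _).le]
  · congr 1
    refine integral_congr_ae ?_
    filter_upwards [(𝓕 (propagator (dualDrift B) (diffusion Q) t η) :
      SchwartzMap _ ℂ).coeFn_toLp 2 volume] with v hv
    rw [hv]

/-- The homogeneous Strichartz estimate, in dual form. -/
theorem lintegral_iSup_homogeneous_le {r p q : ℝ} (hr : 2 < r) (hpr : p.HolderConjugate r)
    (hq : 2 < q) (hQ : Q.PosSemidef) {D : ℕ} {γ : ℝ} (hγ : 0 < γ) (hA : HypothesisA D γ Q B)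
    (hD : 2 / q = D * (1 / 2 - 1 / r)) {η : ℕ → SchwartzMap (EuclideanSpace ℝ ι) ℂ}
    (hη : ∀ j, eLpNorm (𝓕 (η j) : SchwartzMap _ ℂ) (ENNReal.ofReal p) ≤ 1)
    {φ : EuclideanSpace ℝ ι → ℂ} (hφ : MemLp φ 2) :
    (∫⁻ t, (⨆ j, ENNReal.ofReal (Real.exp (B.trace / 2 * t)) *
      ‖∫ x, φ x * (𝓕 (propagator (dualDrift B) (diffusion Q) t (η j)) : SchwartzMap _ ℂ) x‖ₑ) ^ q)
        ^ (1 / q) ≤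
      eLpNorm φ 2 *
        (ENNReal.ofReal (dispersiveConst r γ) * ENNReal.ofReal (2 * hlsConst q)) ^ (1 / 2 : ℝ) := by
  simp_rw [enorm_weighted_pairing hφ]
  have h2 : eLpNorm φ 2 = ‖hφ.star.toLp (star φ)‖ₑ := by
    rw [Lp.enorm_toLp]
    exact eLpNorm_congr_norm_ae (.of_forall fun v => by simp)
  rw [h2]
  refine lintegral_iSup_inner_rpow_le hq (Real.HolderConjugate.conjExponent (by linarith)).symm
    (fun j => (continuous_adjointWave (η j)).stronglyMeasurable)
    (fun j t => (norm_adjointWave (η j) t).le) (fun j l t s hts => ?_) _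
  rw [inner_adjointWave, enorm_mul]
  calc _ ≤ ENNReal.ofReal (Real.exp (B.trace / 2 * (t - s))) *
        (eLpNorm (𝓕 (propagator (dualDrift B) (diffusion Q) (t - s) (η j)) : SchwartzMap _ ℂ)
          (ENNReal.ofReal r) * 1) := by
        gcongr
        · rw [← ofReal_norm, Complex.norm_real, Real.norm_of_nonneg (Real.exp_pos _).le]
        · exact (enorm_inner_toLp_le hpr _ _).trans (by gcongr; exact hη l)
    _ ≤ _ := by
        rw [mul_one]
        exact weighted_eLpNorm_fourier_propagator_le hr hpr hQ hγ hA hD hts (hη j)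

end Drift

/-! ### The inhomogeneous Strichartz estimate -/

section Strichartz

variable {ι : Type} [Fintype ι] [DecidableEq ι] {Q B : Matrix ι ι ℝ}

lemma mixedNorm_eq (J : Set ℝ) (τ : ℝ) {q r : ℝ} (hq : 0 < q) (hr : 0 < r)
    (u : ℝ → EuclideanSpace ℝ ι → ℂ) :
    mixedNorm J τ q r u = (∫⁻ t in J, (ENNReal.ofReal (Real.exp (τ * t)) *
      eLpNorm (u t) (ENNReal.ofReal r)) ^ q) ^ (1 / q) := by
  unfold mixedNorm
  congr 1
  refine lintegral_congr fun t => ?_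
  rw [ENNReal.mul_rpow_of_nonneg _ _ hq.le, ENNReal.ofReal_rpow_of_pos (Real.exp_pos _),
    ← Real.exp_mul, eLpNorm_eq_lintegral_rpow_enorm_toReal (by simpa using hr) (by simp),
    ENNReal.toReal_ofReal hr.le, ← ENNReal.rpow_mul]
  congr 3 <;> ring

/-- Hölder in time over a bounded set, on which the exponential weight is bounded below. This turns
the finite mixed norm of the forcing into the local time integrability that the Duhamel bound needs.
-/
lemma lintegral_ne_top_of_weighted_rpow {f : ℝ → ℝ≥0∞} {J K : Set ℝ} (hKJ : K ⊆ J)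
    (hK : MeasurableSet K) {M τ p : ℝ} (hKM : ∀ s ∈ K, |s| ≤ M) (hp : 1 < p)
    (hf : AEMeasurable f (volume.restrict J))
    (hfin : ∫⁻ t in J, (ENNReal.ofReal (Real.exp (τ * t)) * f t) ^ p ≠ ⊤) :
    ∫⁻ s in K, f s ≠ ⊤ := by
  have hc := Real.HolderConjugate.conjExponent hp
  have hvol : volume K ≠ ⊤ := by
    refine (lt_of_le_of_lt (measure_mono (t := Set.Icc (-M) M) fun s hs => ?_)
      measure_Icc_lt_top).ne
    exact abs_le.1 (hKM s hs)
  have hg : AEMeasurable (fun t => ENNReal.ofReal (Real.exp (τ * t)) * f t) (volume.restrict K) :=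
    AEMeasurable.mul (by fun_prop) (hf.mono_measure (Measure.restrict_mono hKJ le_rfl))
  have h1 : ∫⁻ s in K, f s ≤ ENNReal.ofReal (Real.exp (|τ| * M)) *
      ∫⁻ s in K, ENNReal.ofReal (Real.exp (τ * s)) * f s := by
    rw [← lintegral_const_mul' _ _ ENNReal.ofReal_ne_top]
    refine setLIntegral_mono' hK fun s hs => ?_
    rw [← mul_assoc, ← ENNReal.ofReal_mul (Real.exp_pos _).le, ← Real.exp_add]
    have h2 : 0 ≤ |τ| * M + τ * s := by
      have h3 : |τ * s| ≤ |τ| * M := by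
        rw [abs_mul]; exact mul_le_mul_of_nonneg_left (hKM s hs) (abs_nonneg _)
      linarith [neg_abs_le (τ * s)]
    calc f s = 1 * f s := (one_mul _).symm
      _ ≤ _ := by
        gcongr
        rw [← ENNReal.ofReal_one]
        exact ENNReal.ofReal_le_ofReal (Real.one_le_exp h2)
  have h2 := ENNReal.lintegral_mul_le_Lp_mul_Lq (volume.restrict K) hc hg
    (aemeasurable_const (b := (1 : ℝ≥0∞)))
  simp only [Pi.mul_apply, mul_one, ENNReal.one_rpow, lintegral_const, one_mul,
    Measure.restrict_apply MeasurableSet.univ, Set.univ_inter] at h2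
  refine (lt_of_le_of_lt (h1.trans (mul_le_mul_right h2 _)) ?_).ne
  refine ENNReal.mul_lt_top ENNReal.ofReal_lt_top (ENNReal.mul_lt_top ?_ ?_)
  · refine ENNReal.rpow_lt_top_of_nonneg (by positivity) (ne_of_lt ?_)
    exact lt_of_le_of_lt (lintegral_mono_set hKJ) (lt_top_iff_ne_top.2 hfin)
  · exact ENNReal.rpow_lt_top_of_nonneg (by have := hc.symm.pos; positivity) hvol

/-- The constant in the Strichartz estimate. -/
noncomputable def strichartzConst (q r γ : ℝ) : ℝ :=
  (dispersiveConst r γ * (2 * hlsConst q)) ^ (1 / 2 : ℝ) + dispersiveConst r γ * (2 * hlsConst q)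

lemma hlsConst_pos {q : ℝ} (hq : 2 < q) : 0 < hlsConst q := by
  have h1 : 2 / q < 1 := by rw [div_lt_one (by linarith)]; exact hq
  have h2 : 0 < 1 - 2 / q := by linarith
  unfold hlsConst
  positivity

/-- The inhomogeneous Strichartz estimate for weak solutions. -/
theorem IsSolution.mixedNorm_le {J : Set ℝ} {φ : EuclideanSpace ℝ ι → ℂ}
    {F u : ℝ → EuclideanSpace ℝ ι → ℂ} (hu : IsSolution Q B J φ F u) {r p q q' : ℝ} (hr : 2 < r)
    (hpr : p.HolderConjugate r) (hq : 2 < q) (hqq : q'.HolderConjugate q) (hQ : Q.PosSemidef)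
    {D : ℕ} {γ : ℝ} (hγ : 0 < γ) (hA : HypothesisA D γ Q B)
    (hD : 2 / q = D * (1 / 2 - 1 / r)) (hJ : J.OrdConnected) (h0 : (0 : ℝ) ∈ J)
    (hφ : MemLp φ 2)
    (hF : AEStronglyMeasurable (Function.uncurry F) ((volume.restrict J).prod volume))
    (hFfin : mixedNorm J (B.trace / 2) q' p F < ⊤) :
    mixedNorm J (B.trace / 2) q r u ≤ ENNReal.ofReal (strichartzConst q r γ) *
      (eLpNorm φ 2 + mixedNorm J (B.trace / 2) q' p F) := by
  have hq'0 := hqq.pos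
  have hq'1 := hqq.lt
  have hq0 : 0 < q := by linarith
  have hr0 : 0 < r := by linarith
  have hJm : MeasurableSet J := hJ.measurableSet
  rw [mixedNorm_eq J _ hq'0 hpr.pos] at hFfin ⊢
  rw [mixedNorm_eq J _ hq0 hr0]
  set τ := B.trace / 2 with hτ
  have hFm := aemeasurable_eLpNorm_slice hF hpr.pos
  have hFI : ∫⁻ t in J, (ENNReal.ofReal (Real.exp (τ * t)) *
      eLpNorm (F t) (ENNReal.ofReal p)) ^ q' ≠ ⊤ := fun h => by
    rw [h, ENNReal.top_rpow_of_pos (by positivity)] at hFfin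
    exact lt_irrefl _ hFfin
  have hG : ∀ t ∈ J, ∫⁻ s in Set.uIoc 0 t, eLpNorm (F s) (ENNReal.ofReal p) ≠ ⊤ := by
    intro t ht
    refine lintegral_ne_top_of_weighted_rpow (M := |t|)
      (Set.uIoc_subset_uIcc.trans (hJ.uIcc_subset h0 ht)) measurableSet_uIoc (fun s hs => ?_)
      hq'1 hFm hFI
    have := Set.abs_sub_left_of_mem_uIcc (Set.uIoc_subset_uIcc hs)
    simpa using this
  have hwm : AEMeasurable (J.indicator fun t => ENNReal.ofReal (Real.exp (τ * t)) *
      eLpNorm (F t) (ENNReal.ofReal p)) :=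
    (aemeasurable_indicator_iff hJm).2 (AEMeasurable.mul (by fun_prop) hFm)
  -- A measurable version of the weighted norm of F, extended by zero outside J, so that the
  -- estimates in time take place on the whole line.
  obtain ⟨w, hw, hwe⟩ := hwm
  have hwn : ∫⁻ t, w t ^ q' = ∫⁻ t in J, (ENNReal.ofReal (Real.exp (τ * t)) *
      eLpNorm (F t) (ENNReal.ofReal p)) ^ q' := by
    rw [← lintegral_indicator hJm]
    refine lintegral_congr_ae ?_
    filter_upwards [hwe] with t ht
    rw [← ht]
    by_cases hJt : t ∈ J
    · simp only [Set.indicator_of_mem hJt]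
    · simp only [Set.indicator_of_notMem hJt, ENNReal.zero_rpow_of_pos hq'0]
  rw [← hwn]
  -- One countable family serves all times at once, which keeps the supremum over test functions
  -- measurable in t.
  obtain ⟨e, he1, he⟩ := exists_countable_norming (V := EuclideanSpace ℝ ι) hr hpr
  obtain ⟨η, hη⟩ : ∃ η : ℕ → SchwartzMap (EuclideanSpace ℝ ι) ℂ, ∀ j, 𝓕 (η j) = e j :=
    ⟨fun j => 𝓕⁻ (e j), fun j => fourier_fourierInv_eq _⟩
  have hη1 : ∀ j, eLpNorm (𝓕 (η j) : SchwartzMap _ ℂ) (ENNReal.ofReal p) ≤ 1 := fun j => by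
    rw [hη]; exact he1 j
  have hhom := lintegral_iSup_homogeneous_le hr hpr hq hQ hγ hA hD hη1 hφ
  rw [← hτ] at hhom
  obtain ⟨a, ha⟩ : ∃ a : ℝ → ℝ≥0∞, ∀ t, a t = ⨆ j, ENNReal.ofReal (Real.exp (τ * t)) *
      ‖∫ x, φ x * (𝓕 (propagator (dualDrift B) (diffusion Q) t (η j)) : SchwartzMap _ ℂ) x‖ₑ :=
    ⟨_, fun _ => rfl⟩
  simp_rw [← ha] at hhom
  have ham : Measurable a := by
    rw [funext ha]
    refine Measurable.iSup fun j => ?_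
    simp_rw [hτ, enorm_weighted_pairing hφ]
    exact (Continuous.inner continuous_const (continuous_adjointWave (η j))).enorm.measurable
  obtain ⟨b, hb⟩ : ∃ b : ℝ → ℝ≥0∞, ∀ t, b t = ENNReal.ofReal (dispersiveConst r γ) *
      ∫⁻ s, w s * rieszKernel (2 / q) (t - s) := ⟨_, fun _ => rfl⟩
  have hbm : Measurable b := by
    have hkm := measurable_rieszKernel (2 / q)
    have hm2 : Measurable fun z : ℝ × ℝ => w z.2 * rieszKernel (2 / q) (z.1 - z.2) := by fun_prop
    rw [funext hb]
    exact hm2.lintegral_prod_right'.const_mul _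
  have hpt : ∀ t ∈ J, ENNReal.ofReal (Real.exp (τ * t)) * eLpNorm (u t) (ENNReal.ofReal r) ≤
      a t + b t := by
    intro t ht
    refine (mul_le_mul_right (he _ (hu.memLp t ht)) _).trans ?_
    rw [ENNReal.mul_iSup]
    refine iSup_le fun j => ?_
    have h1 := hu.enorm_pairing_le hr hpr hF hJ h0 hφ hG ht (η j)
    rw [hη] at h1
    refine (mul_le_mul_right h1 _).trans ?_
    rw [mul_add]
    refine add_le_add ?_ ?_
    · rw [ha]
      exact le_iSup (fun j => ENNReal.ofReal (Real.exp (τ * t)) *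
        ‖∫ x, φ x * (𝓕 (propagator (dualDrift B) (diffusion Q) t (η j)) : SchwartzMap _ ℂ) x‖ₑ) j
    -- The kernel is positive, so enlarging the integral from 0 to t to the whole line costs
    -- nothing, and the cutoff in time needs no separate treatment.
    · rw [hb, ← lintegral_const_mul' _ _ ENNReal.ofReal_ne_top,
        ← lintegral_const_mul' _ _ ENNReal.ofReal_ne_top, ← lintegral_indicator measurableSet_uIoc]
      refine lintegral_mono_ae ?_
      filter_upwards [hwe, Measure.ae_ne volume t] with s hs hst
      by_cases hsI : s ∈ Set.uIoc 0 t
      swap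
      · rw [Set.indicator_of_notMem hsI]; exact zero_le
      have hsJ : s ∈ J := hJ.uIcc_subset h0 ht (Set.uIoc_subset_uIcc hsI)
      rw [Set.indicator_of_mem hsI, ← hs, Set.indicator_of_mem hsJ]
      have h2 := weighted_eLpNorm_fourier_propagator_le hr hpr hQ hγ hA hD hst.symm (hη1 j)
      rw [← hτ] at h2
      have h3 : ENNReal.ofReal (Real.exp (τ * t)) =
          ENNReal.ofReal (Real.exp (τ * s)) * ENNReal.ofReal (Real.exp (τ * (t - s))) := by
        rw [← ENNReal.ofReal_mul (Real.exp_pos _).le, ← Real.exp_add]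
        congr 2
        ring
      rw [h3]
      calc _ = (ENNReal.ofReal (Real.exp (τ * s)) * eLpNorm (F s) (ENNReal.ofReal p)) *
            (ENNReal.ofReal (Real.exp (τ * (t - s))) *
              eLpNorm (𝓕 (propagator (dualDrift B) (diffusion Q) (t - s) (η j)) : SchwartzMap _ ℂ)
                (ENNReal.ofReal r)) := by ring
        _ ≤ (ENNReal.ofReal (Real.exp (τ * s)) * eLpNorm (F s) (ENNReal.ofReal p)) *
            (ENNReal.ofReal (dispersiveConst r γ) * rieszKernel (2 / q) (t - s)) := by gcongr
        _ = _ := by ring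
  have hKpos := dispersiveConst_pos hr hγ
  have hHpos := hlsConst_pos hq
  have hbn : (∫⁻ t, b t ^ q) ^ (1 / q) ≤ ENNReal.ofReal (dispersiveConst r γ * (2 * hlsConst q)) *
      (∫⁻ t, w t ^ q') ^ (1 / q') := by
    have h1 := lintegral_rieszPotential_rpow_le hq hqq hw
    simp_rw [hb, ENNReal.mul_rpow_of_nonneg _ _ hq0.le]
    rw [lintegral_const_mul' _ _ (ENNReal.rpow_ne_top_of_nonneg hq0.le ENNReal.ofReal_ne_top),
      ENNReal.mul_rpow_of_nonneg _ _ (by positivity), ← ENNReal.rpow_mul, mul_one_div_cancel hq0.ne',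
      ENNReal.rpow_one, ENNReal.ofReal_mul hKpos.le, mul_assoc]
    gcongr
  rw [← ENNReal.ofReal_mul hKpos.le, ENNReal.ofReal_rpow_of_pos (by positivity)] at hhom
  calc _ ≤ (∫⁻ t in J, (a t + b t) ^ q) ^ (1 / q) := by
        gcongr ?_ ^ _
        exact setLIntegral_mono' hJm fun t ht => by gcongr; exact hpt t ht
    _ ≤ (∫⁻ t, (b + a) t ^ q) ^ (1 / q) := by
        gcongr ?_ ^ _
        refine (setLIntegral_le_lintegral _ _).trans (lintegral_mono fun t => ?_)
        rw [Pi.add_apply, add_comm]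
    _ ≤ (∫⁻ t, b t ^ q) ^ (1 / q) + (∫⁻ t, a t ^ q) ^ (1 / q) :=
        ENNReal.lintegral_Lp_add_le hbm.aemeasurable ham.aemeasurable (by linarith)
    _ ≤ _ := by
        rw [add_comm, mul_add]
        refine add_le_add (hhom.trans ?_) (hbn.trans ?_)
        · rw [mul_comm]
          gcongr
          rw [strichartzConst]
          exact le_add_of_nonneg_right (by positivity)
        · gcongr
          rw [strichartzConst]
          exact le_add_of_nonneg_left (by positivity)

end Strichartz

/-! ### Exponents and uniformity of the constant -/

lemma IsCanonicalForm.le_homDim {n m : ℕ} {p : Fin (m + 1) → ℕ} {Q B : Matrix (Idx p) (Idx p) ℝ}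
    (h : IsCanonicalForm n p Q B) : n ≤ homDim p := by
  rw [← h.sum_eq, homDim]
  exact Finset.sum_le_sum fun j _ => Nat.le_mul_of_pos_left _ (by omega)

lemma IsCanonicalForm.homDim_le {n m : ℕ} {p : Fin (m + 1) → ℕ} {Q B : Matrix (Idx p) (Idx p) ℝ}
    (h : IsCanonicalForm n p Q B) : homDim p ≤ (2 * n + 1) * n := by
  have hm : m + 1 ≤ n := by
    rw [← h.sum_eq]
    simpa using Finset.sum_le_sum fun (j : Fin (m + 1)) (_ : j ∈ Finset.univ) => h.one_le j
  calc homDim p ≤ ∑ j, (2 * n + 1) * p j :=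
        Finset.sum_le_sum fun j _ => Nat.mul_le_mul_right _ (by omega)
    _ = (2 * n + 1) * n := by rw [← Finset.mul_sum, h.sum_eq]

/-- For fixed n only finitely many dimensions D occur, since n blocks at most force D ≤ (2n+1)n.
Summing the absolute values over all of them bounds each constant, whatever the block structure. -/
lemma exists_uniform_const (n : ℕ) (c : ℕ → ℝ) :
    ∃ C : ℝ, 0 < C ∧ ∀ {m : ℕ} {p : Fin (m + 1) → ℕ} {Q B : Matrix (Idx p) (Idx p) ℝ},
      IsCanonicalForm n p Q B → c (homDim p) ≤ C := by
  refine ⟨∑ D ∈ Finset.range ((2 * n + 1) * n + 1), |c D| + 1, by positivity, fun h => ?_⟩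
  have h1 := Finset.single_le_sum (f := fun D => |c D|) (fun D _ => abs_nonneg _)
    (Finset.mem_range.2 (Nat.lt_succ_of_le h.homDim_le))
  exact ((le_abs_self _).trans h1).trans (le_add_of_nonneg_right zero_le_one)

/-- The strict bound on r says exactly that D(1/2 - 1/r) < 1, the local integrability of the kernel
|t|^{-2/q}. For D = 2 every finite r qualifies. -/
lemma Admissible.two_lt {D : ℕ} {q r : ℝ} (hD : 2 ≤ D) (hr : 2 < r)
    (hrD : 2 < D → r < 2 * (D : ℝ) / ((D : ℝ) - 2)) (h : Admissible D q r) : 2 < q := by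
  have hq := h.1
  have hlt : (D : ℝ) * (1 / 2 - 1 / r) < 1 := by
    have hr0 : 0 < r := by linarith
    have hDr : (2 : ℝ) ≤ D := by exact_mod_cast hD
    have key : (D - 2 : ℝ) * r < 2 * D := by
      rcases hD.eq_or_lt with h2 | h2
      · rw [← h2]; norm_num
      · have : (0 : ℝ) < D - 2 := by
          have : (2 : ℝ) < D := by exact_mod_cast h2
          linarith
        have := (lt_div_iff₀ this).1 (hrD h2)
        linarith
    rw [show (D : ℝ) * (1 / 2 - 1 / r) = ((D : ℝ) * r - 2 * D) / (2 * r) by field_simp,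
      div_lt_one (by positivity)]
    linarith
  rw [← h.2.2.2, div_lt_one hq] at hlt
  exact hlt

lemma mixedNorm_zero_eq {ι : Type} [Fintype ι] {J : Set ℝ} {q : ℝ} (hq : 0 < q)
    {u : ℝ → EuclideanSpace ℝ ι → ℂ}
    (hu : AEStronglyMeasurable (Function.uncurry u) ((volume.restrict J).prod volume)) :
    mixedNorm J 0 q q u =
      eLpNorm (Function.uncurry u) (ENNReal.ofReal q) ((volume.restrict J).prod volume) := by
  rw [eLpNorm_eq_lintegral_rpow_enorm_toReal (by simpa using hq) (by simp),
    ENNReal.toReal_ofReal hq.le, lintegral_prod _ (hu.enorm.pow_const q)]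
  simp [mixedNorm, div_self hq.ne']

end DriftSchrodinger

theorem theoremA :
    -- the mixed norm estimate, with a constant depending only on `n`, `r` and `γ`
    (∀ (n : ℕ) (_ : 2 ≤ n) (r : ℝ) (_ : 2 < r) (γ : ℝ) (_ : 0 < γ),
      ∃ C : ℝ, 0 < C ∧
        ∀ (m : ℕ) (p : Fin (m + 1) → ℕ)
          (Q B : Matrix (DriftSchrodinger.Idx p) (DriftSchrodinger.Idx p) ℝ)
          (_ : DriftSchrodinger.IsCanonicalForm n p Q B)
          (_ : DriftSchrodinger.HypothesisA (DriftSchrodinger.homDim p) γ Q B)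
          (_ : 2 < DriftSchrodinger.homDim p →
            r < 2 * (DriftSchrodinger.homDim p : ℝ) / ((DriftSchrodinger.homDim p : ℝ) - 2))
          (q : ℝ) (_ : DriftSchrodinger.Admissible (DriftSchrodinger.homDim p) q r)
          (J : Set ℝ) (_ : J.OrdConnected) (_ : (0 : ℝ) ∈ J)
          (φ : EuclideanSpace ℝ (DriftSchrodinger.Idx p) → ℂ)
          (F u : ℝ → EuclideanSpace ℝ (DriftSchrodinger.Idx p) → ℂ)
          (_ : MemLp φ 2 volume)
          (_ : AEStronglyMeasurable (Function.uncurry F) ((volume.restrict J).prod volume))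
          (_ : DriftSchrodinger.mixedNorm J (B.trace / 2) q.conjExponent r.conjExponent F < ⊤)
          (_ : DriftSchrodinger.IsSolution Q B J φ F u),
          DriftSchrodinger.mixedNorm J (B.trace / 2) q r u ≤
            ENNReal.ofReal C * (eLpNorm φ 2 volume +
              DriftSchrodinger.mixedNorm J (B.trace / 2) q.conjExponent r.conjExponent F)) ∧
    -- the case `tr B = 0`, `q = r = 2(D+2)/D`
    (∀ (n : ℕ) (_ : 2 ≤ n) (γ : ℝ) (_ : 0 < γ),
      ∃ C : ℝ, 0 < C ∧
        ∀ (m : ℕ) (p : Fin (m + 1) → ℕ)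
          (Q B : Matrix (DriftSchrodinger.Idx p) (DriftSchrodinger.Idx p) ℝ)
          (_ : DriftSchrodinger.IsCanonicalForm n p Q B)
          (_ : DriftSchrodinger.HypothesisA (DriftSchrodinger.homDim p) γ Q B)
          (_ : B.trace = 0)
          (D : ℝ) (_ : D = (DriftSchrodinger.homDim p : ℝ))
          (J : Set ℝ) (_ : J.OrdConnected) (_ : (0 : ℝ) ∈ J)
          (φ : EuclideanSpace ℝ (DriftSchrodinger.Idx p) → ℂ)
          (F u : ℝ → EuclideanSpace ℝ (DriftSchrodinger.Idx p) → ℂ)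
          (_ : MemLp φ 2 volume)
          (_ : MemLp (Function.uncurry F) (ENNReal.ofReal (2 * (D + 2) / (D + 4)))
            ((volume.restrict J).prod volume))
          (_ : DriftSchrodinger.IsSolution Q B J φ F u),
          eLpNorm (Function.uncurry u) (ENNReal.ofReal (2 * (D + 2) / D))
              ((volume.restrict J).prod volume) ≤
            ENNReal.ofReal C * (eLpNorm φ 2 volume +
              eLpNorm (Function.uncurry F) (ENNReal.ofReal (2 * (D + 2) / (D + 4)))
                ((volume.restrict J).prod volume))) := by
  refine ⟨fun n hn r hr γ hγ => ?_, fun n hn γ hγ => ?_⟩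
  · obtain ⟨C, hC, hCn⟩ := DriftSchrodinger.exists_uniform_const n
      -- Admissibility determines q from D and r, so the constant is a function of D alone once r
      -- and γ are fixed.
      fun D => DriftSchrodinger.strichartzConst (2 / ((D : ℝ) * (1 / 2 - 1 / r))) r γ
    refine ⟨C, hC, fun m p Q B hQB hA hrD q hadm J hJ h0 φ F u hφ hF hFfin hu => ?_⟩
    have hq := hadm.two_lt (hn.trans hQB.le_homDim) hr hrD
    have h1 := hu.mixedNorm_le hr (Real.HolderConjugate.conjExponent (by linarith)).symm hq
      (Real.HolderConjugate.conjExponent (by linarith)).symm (DriftSchrodinger.posSemidef_of_isCanonicalForm hQB)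
      hγ hA hadm.2.2.2 hJ h0 hφ hF hFfin
    refine h1.trans ?_
    gcongr
    have h2 := hCn hQB
    rwa [← hadm.2.2.2, div_div_cancel₀ two_ne_zero] at h2
  · obtain ⟨C, hC, hCn⟩ := DriftSchrodinger.exists_uniform_const n
      -- The diagonal admissible pair q = r = 2(D+2)/D: it satisfies D(1/2 - 1/r) = 2/r and always
      -- exceeds 2, and its conjugate exponent is 2(D+2)/(D+4).
      fun D => DriftSchrodinger.strichartzConst (2 * ((D : ℝ) + 2) / D) (2 * ((D : ℝ) + 2) / D) γ
    refine ⟨C, hC, fun m p Q B hQB hA hB D hD J hJ h0 φ F u hφ hF hu => ?_⟩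
    have hD0 : 0 < D := by
      rw [hD]
      exact_mod_cast (by omega : 0 < n).trans_le hQB.le_homDim
    have hr : 2 < 2 * (D + 2) / D := by
      rw [lt_div_iff₀ hD0]
      linarith
    have hpr : (2 * (D + 2) / (D + 4)).HolderConjugate (2 * (D + 2) / D) := by
      refine Real.holderConjugate_iff.2 ⟨?_, ?_⟩
      · rw [one_lt_div (by positivity)]
        linarith
      · field_simp
        ring
    have hFn := DriftSchrodinger.mixedNorm_zero_eq hpr.pos hF.1
    have hB0 : B.trace / 2 = 0 := by rw [hB, zero_div]
    have h1 := hu.mixedNorm_le hr hpr hr hpr (DriftSchrodinger.posSemidef_of_isCanonicalForm hQB) hγ hA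
      (by rw [← hD]; field_simp; ring) hJ h0 hφ hF.1 (by rw [hB0, hFn]; exact hF.2)
    rw [hB0, hFn, DriftSchrodinger.mixedNorm_zero_eq hpr.symm.pos hu.measurable] at h1
    refine h1.trans ?_
    gcongr
    have h2 := hCn hQB
    rwa [← hD] at h2
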